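/- Let $P$ be a convex lattice polygon of genus $g\ge 3$ (that is, with exactly $g$ interior lattice points) which is hyperelliptic, meaning that its interior lattice points are collinear. Let $h$ be a height function on the lattice points of $P$ such that the regular subdivision of $P$ induced by the upper convex hull of the points $(a,h(a))$ is a nodal subdivision, i.e. each of its polygons is a triangle of area $\tfrac12$ or a parallelogram of area $1$ (a unit parallelogram), and suppose that it has at most $g-2$ unit parallelograms. Consider the dual nodal tropical plane curve, defined by the tropical polynomial $w\mapsto\max_{a\in P\cap\mathbb Z^2}\,(h(a)+\langle a,w\rangle)$, as an abstract graph: its vertices are dual to the triangles, and at each node (the $4$-valent vertex dual to a unit parallelogram) the two branches through the node are regarded as crossing without meeting. Let $G$ be the skeleton of this curve, obtained by removing all rays, iteratively removing vertices of degree $1$ together with their edges, and then smoothing over all $2$-valent vertices. If $G$ is connected, then $G$ is a chain: a trivalent multigraph consisting of $m\ge 2$ cycles in a line such that each pair of adjacent cycles either shares an edge or is joined by a bridge. -/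

import Mathlib

open scoped Graph

namespace NodalCurve

/-! ### Lattice polygons -/

/-- The inclusion of the lattice `ℤ²` in the plane `ℝ²`. -/
def toPlane (a : ℤ × ℤ) : ℝ × ℝ := ((a.1 : ℝ), (a.2 : ℝ))

/-- A (convex, two-dimensional) lattice polygon: the convex hull of finitely many lattice points,
with non-empty interior. -/
def IsLatticePolygon (P : Set (ℝ × ℝ)) : Prop :=
  (∃ S : Set (ℤ × ℤ), S.Finite ∧ P = convexHull ℝ (toPlane '' S)) ∧ (interior P).Nonempty

/-- The lattice points of `P`. -/
def latticePoints (P : Set (ℝ × ℝ)) : Set (ℤ × ℤ) := {a | toPlane a ∈ P}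

/-- The lattice points in the interior of `P`. -/
def interiorLatticePoints (P : Set (ℝ × ℝ)) : Set (ℤ × ℤ) := {a | toPlane a ∈ interior P}

/-- The genus of a lattice polygon is its number of interior lattice points. -/
noncomputable def genus (P : Set (ℝ × ℝ)) : ℕ := (interiorLatticePoints P).ncard

/-- `P` is hyperelliptic if its interior lattice points are collinear, that is, if their convex
hull is not two-dimensional. -/
def IsHyperelliptic (P : Set (ℝ × ℝ)) : Prop := Collinear ℝ (toPlane '' interiorLatticePoints P)

/-! ### Regular subdivisions and their dual tropical curves

A height function `h` on the lattice points of `P` is the coefficient vector of the tropical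
polynomial `w ↦ max_a (h a + ⟨a, w⟩)` with Newton polygon `P`. -/

/-- The value at `w` of the tropical monomial with exponent `a`. -/
noncomputable def monomial (h : ℤ × ℤ → ℝ) (a : ℤ × ℤ) (w : ℝ × ℝ) : ℝ :=
  h a + ((a.1 : ℝ) * w.1 + (a.2 : ℝ) * w.2)

/-- The lattice points of `P` whose monomial attains the maximum of the tropical polynomial at `w`.
The convex hulls of these sets, for `w` in the plane, are the polygons, edges and vertices of the
regular subdivision of `P` induced by `h`, that is, the projections of the faces of the upper
convex hull of the lifted points `(a, h a)`. The set of all `w` with a given `cell P h w` is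
the dual (relatively open) cell of the tropical curve: `w` is on the tropical curve if `cell P h w`
has at least two elements, it is a vertex of the curve if `cell P h w` is two-dimensional, and
the edges of the curve are dual to the one-dimensional cells. -/
def cell (P : Set (ℝ × ℝ)) (h : ℤ × ℤ → ℝ) (w : ℝ × ℝ) : Set (ℤ × ℤ) :=
  {a | a ∈ latticePoints P ∧ ∀ b ∈ latticePoints P, monomial h b w ≤ monomial h a w}

/-- The determinant of two vectors of `ℤ²`: the signed area of the parallelogram they span. -/
def det (u v : ℤ × ℤ) : ℤ := u.1 * v.2 - u.2 * v.1

/-- The vertices of a lattice triangle of area `1/2` (it has no other lattice points). -/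
def IsUnitTriangle (σ : Set (ℤ × ℤ)) : Prop :=
  ∃ p u v : ℤ × ℤ, |det u v| = 1 ∧ σ = {p, p + u, p + v}

/-- The vertices of a lattice parallelogram of area `1` (it has no other lattice points). -/
def IsUnitParallelogram (σ : Set (ℤ × ℤ)) : Prop :=
  ∃ p u v : ℤ × ℤ, |det u v| = 1 ∧ σ = {p, p + u, p + v, p + u + v}

/-- The subdivision of `P` induced by `h` is nodal: each of its (two-dimensional) polygons is a
triangle of area `1/2` or a parallelogram of area `1`. -/
def IsNodal (P : Set (ℝ × ℝ)) (h : ℤ × ℤ → ℝ) : Prop :=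
  ∀ w : ℝ × ℝ, ¬ Collinear ℝ (toPlane '' cell P h w) →
    IsUnitTriangle (cell P h w) ∨ IsUnitParallelogram (cell P h w)

/-- The number of unit parallelograms in the subdivision of `P` induced by `h`. -/
noncomputable def numParallelograms (P : Set (ℝ × ℝ)) (h : ℤ × ℤ → ℝ) : ℕ :=
  {σ : Set (ℤ × ℤ) | IsUnitParallelogram σ ∧ ∃ w, cell P h w = σ}.ncard

/-- The sides of the polygon dual to the point `w`: the edges of the subdivision (with
two lattice points) contained in that polygon. -/
def sides (P : Set (ℝ × ℝ)) (h : ℤ × ℤ → ℝ) (w : ℝ × ℝ) : Set (Set (ℤ × ℤ)) :=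
  {e | e ⊆ cell P h w ∧ e.ncard = 2 ∧ ∃ w', cell P h w' = e}

/-- The points of the abstract curve over the vertices of a nodal tropical curve. A point is
recorded as a pair `(w, B)`, where `w` is a vertex of the tropical curve in the plane and `B` is
the set of (duals of) the edges of the curve that meet in this point. Over a vertex dual to a
triangle there is one point, in which the three edges at `w` meet. A node, that is, a vertex dual
to a parallelogram, is not part of the abstract curve: it is the crossing of two branches,
each of which runs through the edges dual to two opposite sides `e` and `cell P h w \ e` of the
parallelogram; so there are two points over it, one on each branch, both of valency two. -/
def curvePoints (P : Set (ℝ × ℝ)) (h : ℤ × ℤ → ℝ) : Set ((ℝ × ℝ) × Set (Set (ℤ × ℤ))) :=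
  {x | (IsUnitTriangle (cell P h x.1) ∧ x.2 = sides P h x.1) ∨
    (IsUnitParallelogram (cell P h x.1) ∧ ∃ e ∈ sides P h x.1, x.2 = {e, cell P h x.1 \ e})}

lemma monomial_sub (h : ℤ × ℤ → ℝ) {P : Set (ℝ × ℝ)} {p q : ℤ × ℤ} {w : ℝ × ℝ}
    (hp : p ∈ cell P h w) (hq : q ∈ cell P h w) : monomial h p w = monomial h q w :=
  le_antisymm (hq.2 p hp.1) (hp.2 q hq.1)

lemma exists_noncollinear {P : Set (ℝ × ℝ)} {h : ℤ × ℤ → ℝ}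
    {x : (ℝ × ℝ) × Set (Set (ℤ × ℤ))} (hx : x ∈ curvePoints P h) :
    ∃ p u v : ℤ × ℤ, |det u v| = 1 ∧ p ∈ cell P h x.1 ∧ p + u ∈ cell P h x.1 ∧
      p + v ∈ cell P h x.1 := by
  rcases hx with ⟨⟨p, u, v, hd, hc⟩, -⟩ | ⟨⟨p, u, v, hd, hc⟩, -⟩ <;>
    exact ⟨p, u, v, hd, by simp [hc], by simp [hc], by simp [hc]⟩

/-- A point dual to a two-dimensional cell is determined by any three non-collinear lattice
points of the cell. -/
lemma eq_of_noncollinear {P : Set (ℝ × ℝ)} {h : ℤ × ℤ → ℝ} {a b : ℝ × ℝ} {p u v : ℤ × ℤ}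
    (hd : |det u v| = 1)
    (ha : p ∈ cell P h a ∧ p + u ∈ cell P h a ∧ p + v ∈ cell P h a)
    (hb : p ∈ cell P h b ∧ p + u ∈ cell P h b ∧ p + v ∈ cell P h b) : a = b := by
  have h1 := monomial_sub h ha.1 ha.2.1
  have h2 := monomial_sub h ha.1 ha.2.2
  have h3 := monomial_sub h hb.1 hb.2.1
  have h4 := monomial_sub h hb.1 hb.2.2
  have hd' : ((u.1 : ℝ) * v.2 - u.2 * v.1) ≠ 0 := by
    intro h0
    have : det u v = 0 := by
      have : ((det u v : ℤ) : ℝ) = 0 := by simpa [det] using h0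
      exact_mod_cast this
    simp [this] at hd
  simp only [monomial, Prod.fst_add, Prod.snd_add, Int.cast_add] at h1 h2 h3 h4
  have e1 : (u.1 : ℝ) * (a.1 - b.1) + u.2 * (a.2 - b.2) = 0 := by linarith
  have e2 : (v.1 : ℝ) * (a.1 - b.1) + v.2 * (a.2 - b.2) = 0 := by linarith
  have f1 : ((u.1 : ℝ) * v.2 - u.2 * v.1) * (a.1 - b.1) = 0 := by
    linear_combination (v.2 : ℝ) * e1 - (u.2 : ℝ) * e2
  have f2 : ((u.1 : ℝ) * v.2 - u.2 * v.1) * (a.2 - b.2) = 0 := by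
    linear_combination (u.1 : ℝ) * e2 - (v.1 : ℝ) * e1
  have g1 := (mul_eq_zero.1 f1).resolve_left hd'
  have g2 := (mul_eq_zero.1 f2).resolve_left hd'
  exact Prod.ext (by linarith) (by linarith)

lemma cell_subset_of_mem_segment {P : Set (ℝ × ℝ)} {h : ℤ × ℤ → ℝ} {a b : ℝ × ℝ} {p : ℤ × ℤ}
    {t : ℝ} (ht0 : 0 < t) (ht1 : t < 1) (ha : p ∈ cell P h a) (hb : p ∈ cell P h b) :
    cell P h ((1 - t) * a.1 + t * b.1, (1 - t) * a.2 + t * b.2) ⊆ cell P h a := by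
  intro c hc
  have h1 := hc.2 p ha.1
  have h2 := ha.2 c hc.1
  have h3 := hb.2 c hc.1
  have key : monomial h p a ≤ monomial h c a := by
    simp only [monomial] at *
    nlinarith [mul_le_mul_of_nonneg_left h3 ht0.le, sub_pos.2 ht1]
  exact ⟨hc.1, fun d hd ↦ (ha.2 d hd).trans key⟩

lemma eq_or_eq_of_between {P : Set (ℝ × ℝ)} {h : ℤ × ℤ → ℝ} {a m b : ℝ × ℝ} {p q : ℤ × ℤ}
    (hpq : p ≠ q) (hm : ∃ p u v : ℤ × ℤ, |det u v| = 1 ∧ p ∈ cell P h m ∧ p + u ∈ cell P h m ∧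
      p + v ∈ cell P h m)
    (hpa : p ∈ cell P h a) (hqa : q ∈ cell P h a) (hpm : p ∈ cell P h m) (hqm : q ∈ cell P h m)
    (hpb : p ∈ cell P h b) (hqb : q ∈ cell P h b)
    (hle : ((q.2 : ℝ) - p.2) * a.1 - (q.1 - p.1) * a.2 ≤ (q.2 - p.2) * m.1 - (q.1 - p.1) * m.2)
    (hle' : ((q.2 : ℝ) - p.2) * m.1 - (q.1 - p.1) * m.2 ≤ (q.2 - p.2) * b.1 - (q.1 - p.1) * b.2) :
    m = a ∨ m = b := by
  have ea := monomial_sub h hpa hqa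
  have em := monomial_sub h hpm hqm
  have eb := monomial_sub h hpb hqb
  simp only [monomial] at ea em eb
  set x : ℝ := (q.1 : ℝ) - p.1 with hx
  set y : ℝ := (q.2 : ℝ) - p.2 with hy
  have hN : 0 < x ^ 2 + y ^ 2 := by
    have : x ≠ 0 ∨ y ≠ 0 := by
      by_contra! hc
      refine hpq (Prod.ext ?_ ?_)
      · have : (q.1 : ℝ) = p.1 := by linarith [hc.1]
        exact_mod_cast this.symm
      · have : (q.2 : ℝ) = p.2 := by linarith [hc.2]
        exact_mod_cast this.symm
    rcases this with h0 | h0 <;> positivity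
  have dam : x * (a.1 - m.1) + y * (a.2 - m.2) = 0 := by rw [hx, hy]; linarith
  have dmb : x * (b.1 - m.1) + y * (b.2 - m.2) = 0 := by rw [hx, hy]; linarith
  -- two points of the line with the same coordinate along the line agree
  have uniq : ∀ c : ℝ × ℝ, x * (c.1 - m.1) + y * (c.2 - m.2) = 0 →
      y * (c.1 - m.1) - x * (c.2 - m.2) = 0 → m = c := by
    intro c h1 h2
    have g1 : (x ^ 2 + y ^ 2) * (c.1 - m.1) = 0 := by linear_combination x * h1 + y * h2
    have g2 : (x ^ 2 + y ^ 2) * (c.2 - m.2) = 0 := by linear_combination y * h1 - x * h2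
    have g1 := (mul_eq_zero.1 g1).resolve_left hN.ne'
    have g2 := (mul_eq_zero.1 g2).resolve_left hN.ne'
    exact Prod.ext (by linarith) (by linarith)
  rcases hle.eq_or_lt with h0 | hlt
  · exact Or.inl (uniq a dam (by linarith))
  rcases hle'.eq_or_lt with h0 | hlt'
  · exact Or.inr (uniq b dmb (by linarith))
  left
  set sa := y * a.1 - x * a.2 with hsa
  set sm := y * m.1 - x * m.2 with hsm
  set sb := y * b.1 - x * b.2 with hsb
  have hD : 0 < sb - sa := by linarith
  set t := (sm - sa) / (sb - sa) with ht
  have ht0 : 0 < t := div_pos (by linarith) hD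
  have ht1 : t < 1 := (div_lt_one hD).2 (by linarith)
  have hts : t * (sb - sa) = sm - sa := div_mul_cancel₀ _ hD.ne'
  have hmid : m = ((1 - t) * a.1 + t * b.1, (1 - t) * a.2 + t * b.2) := by
    apply uniq
    · linear_combination (1 - t) * dam + t * dmb
    · simp only [hsa, hsm, hsb] at hts
      linear_combination hts
  obtain ⟨r, u, v, hd, h1, h2, h3⟩ := hm
  have hsub : cell P h m ⊆ cell P h a := by
    rw [hmid]; exact cell_subset_of_mem_segment ht0 ht1 hpa hpb
  exact eq_of_noncollinear hd ⟨h1, h2, h3⟩ ⟨hsub h1, hsub h2, hsub h3⟩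

lemma subset_of_mem_snd {P : Set (ℝ × ℝ)} {h : ℤ × ℤ → ℝ}
    {x : (ℝ × ℝ) × Set (Set (ℤ × ℤ))} (hx : x ∈ curvePoints P h) {e : Set (ℤ × ℤ)}
    (he : e ∈ x.2) : e ⊆ cell P h x.1 := by
  rcases hx with ⟨-, hx⟩ | ⟨-, f, hf, hx⟩
  · rw [hx] at he; exact he.1
  · rw [hx] at he
    rcases he with rfl | he
    · exact hf.1
    · rw [Set.mem_singleton_iff.1 he]; exact Set.sdiff_subset

/-- A branch through a point of the plane is determined by any of its edges. -/
lemma ext_of_mem {P : Set (ℝ × ℝ)} {h : ℤ × ℤ → ℝ}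
    {x y : (ℝ × ℝ) × Set (Set (ℤ × ℤ))} (hx : x ∈ curvePoints P h) (hy : y ∈ curvePoints P h)
    {e : Set (ℤ × ℤ)} (hex : e ∈ x.2) (hey : e ∈ y.2) (hxy : x.1 = y.1) : x = y := by
  have not_both : ∀ σ : Set (ℤ × ℤ), IsUnitTriangle σ → IsUnitParallelogram σ → False := by
    rintro σ ⟨p, u, v, -, rfl⟩ ⟨p', u', v', hd, hc⟩
    have h4 : ({p', p' + u', p' + v', p' + u' + v'} : Set (ℤ × ℤ)).ncard = 4 := by
      have hu : u' ≠ 0 := by rintro rfl; simp [det] at hd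
      have hv : v' ≠ 0 := by rintro rfl; simp [det] at hd
      have huv : u' ≠ v' := by rintro rfl; simp [det, mul_comm] at hd
      have huv' : u' + v' ≠ 0 := by
        intro h0
        rw [eq_neg_of_add_eq_zero_left h0] at hd
        simp [det, mul_comm] at hd
      rw [Set.ncard_insert_of_notMem, Set.ncard_insert_of_notMem, Set.ncard_pair]
      · simpa [add_assoc] using hu
      · simp [huv, hv, add_assoc]
      · simp [hu, hv, huv', add_assoc]
    have h3 : ({p, p + u, p + v} : Set (ℤ × ℤ)).ncard ≤ 3 := by
      refine (Set.ncard_insert_le _ _).trans ?_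
      have := Set.ncard_insert_le (p + u) {p + v}
      simp only [Set.ncard_singleton] at this
      omega
    rw [hc, h4] at h3
    omega
  have branch : ∀ {z : (ℝ × ℝ) × Set (Set (ℤ × ℤ))}, (∃ f ∈ sides P h z.1,
      z.2 = {f, cell P h z.1 \ f}) → e ∈ z.2 → z.2 = {e, cell P h z.1 \ e} := by
    rintro z ⟨f, hf, hz⟩ he
    rw [hz] at he
    rcases he with rfl | he
    · exact hz
    · rw [Set.mem_singleton_iff.1 he, Set.sdiff_sdiff_cancel_left hf.1, hz, Set.pair_comm]
  refine Prod.ext hxy ?_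
  rcases hx with ⟨tx, hx⟩ | ⟨px, hx⟩ <;> rcases hy with ⟨ty, hy⟩ | ⟨py, hy⟩
  · rw [hx, hy, hxy]
  · exact (not_both _ tx (hxy ▸ py)).elim
  · exact (not_both _ ty (hxy ▸ px)).elim
  · rw [branch hx hex, branch hy hey, hxy]

/-- An edge of the curve meets at most two points of the abstract curve. -/
lemma eq_or_eq_of_mem {P : Set (ℝ × ℝ)} {h : ℤ × ℤ → ℝ}
    {x y z : (ℝ × ℝ) × Set (Set (ℤ × ℤ))} (hx : x ∈ curvePoints P h) (hy : y ∈ curvePoints P h)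
    (hz : z ∈ curvePoints P h) {e : Set (ℤ × ℤ)} (he : e.ncard = 2) (hex : e ∈ x.2)
    (hey : e ∈ y.2) (hez : e ∈ z.2) (hyz : y ≠ z) : x = y ∨ x = z := by
  obtain ⟨p, q, hpq, rfl⟩ := Set.ncard_eq_two.1 he
  have sx := subset_of_mem_snd hx hex
  have sy := subset_of_mem_snd hy hey
  have sz := subset_of_mem_snd hz hez
  have px := sx (Set.mem_insert p _)
  have qx := sx (Set.mem_insert_of_mem p rfl)
  have py := sy (Set.mem_insert p _)
  have qy := sy (Set.mem_insert_of_mem p rfl)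
  have pz := sz (Set.mem_insert p _)
  have qz := sz (Set.mem_insert_of_mem p rfl)
  have nx := exists_noncollinear hx
  have ny := exists_noncollinear hy
  have nz := exists_noncollinear hz
  have exy : x.1 = y.1 → x = y := ext_of_mem hx hy hex hey
  have exz : x.1 = z.1 → x = z := ext_of_mem hx hz hex hez
  have eyz : y.1 ≠ z.1 := fun h0 ↦ hyz (ext_of_mem hy hz hey hez h0)
  suffices x.1 = y.1 ∨ x.1 = z.1 from this.imp exy exz
  rcases le_total (((q.2 : ℝ) - p.2) * x.1.1 - (q.1 - p.1) * x.1.2)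
      ((q.2 - p.2) * y.1.1 - (q.1 - p.1) * y.1.2) with h1 | h1 <;>
    rcases le_total (((q.2 : ℝ) - p.2) * x.1.1 - (q.1 - p.1) * x.1.2)
      ((q.2 - p.2) * z.1.1 - (q.1 - p.1) * z.1.2) with h2 | h2
  · rcases le_total (((q.2 : ℝ) - p.2) * y.1.1 - (q.1 - p.1) * y.1.2)
      ((q.2 - p.2) * z.1.1 - (q.1 - p.1) * z.1.2) with h3 | h3
    · exact Or.inl ((eq_or_eq_of_between hpq ny px qx py qy pz qz h1 h3).resolve_right eyz).symm
    · exact Or.inr ((eq_or_eq_of_between hpq nz px qx pz qz py qy h2 h3).resolve_right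
        eyz.symm).symm
  · exact (eq_or_eq_of_between hpq nx pz qz px qx py qy h2 h1).symm
  · exact eq_or_eq_of_between hpq nx py qy px qx pz qz h1 h2
  · rcases le_total (((q.2 : ℝ) - p.2) * y.1.1 - (q.1 - p.1) * y.1.2)
      ((q.2 - p.2) * z.1.1 - (q.1 - p.1) * z.1.2) with h3 | h3
    · exact Or.inr ((eq_or_eq_of_between hpq nz py qy pz qz px qx h3 h2).resolve_left
        eyz.symm).symm
    · exact Or.inl ((eq_or_eq_of_between hpq ny pz qz py qy px qx h3 h1).resolve_left eyz).symm

/-- The bounded part of the abstract nodal tropical curve with coefficients `h` and Newton polygon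
`P`, as a multigraph: the rays, which are dual to the edges of the subdivision that lie on one
polygon only, are removed. -/
def boundedCurve (P : Set (ℝ × ℝ)) (h : ℤ × ℤ → ℝ) :
    Graph ((ℝ × ℝ) × Set (Set (ℤ × ℤ))) (Set (ℤ × ℤ)) where
  vertexSet := curvePoints P h
  IsLink e x y := x ∈ curvePoints P h ∧ y ∈ curvePoints P h ∧ x ≠ y ∧ e.ncard = 2 ∧
    e ∈ x.2 ∧ e ∈ y.2
  isLink_symm _ _ := ⟨fun _ _ ⟨hx, hy, hne, h2, hex, hey⟩ ↦ ⟨hy, hx, hne.symm, h2, hey, hex⟩⟩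
  eq_or_eq_of_isLink_of_isLink := fun _ _ _ _ _ hxy hvw ↦
    eq_or_eq_of_mem hxy.1 hvw.1 hvw.2.1 hxy.2.2.2.1 hxy.2.2.2.2.1 hvw.2.2.2.2.1 hvw.2.2.2.2.2
      hvw.2.2.1
  left_mem_of_isLink := fun _ _ _ hxy ↦ hxy.1

/-! ### Skeleta -/

section Skeleton

variable {α β : Type*}

/-- A multigraph is connected if it is non-empty and any two vertices are joined by a walk. -/
def Connected (G : Graph α β) : Prop :=
  V(G).Nonempty ∧ ∀ x ∈ V(G), ∀ y ∈ V(G), Relation.ReflTransGen G.Adj x y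

/-- `v` is a vertex of degree one. -/
def IsLeaf (G : Graph α β) (v : α) : Prop :=
  ∃ e, G.IsNonloopAt e v ∧ ∀ f, G.Inc f v → f = e

/-- `H` arises from `G` by removing a vertex of degree one and its edge. -/
def LeafRemoval (G H : Graph α β) : Prop :=
  ∃ v, IsLeaf G v ∧ H = G.deleteVerts {v}

/-- `v` is a 2-valent vertex lying on the two different edges `e` and `f`. (The only other kind of
2-valent vertex carries a single loop, and cannot be smoothed.) -/
def IsTwoValent (G : Graph α β) (v : α) (e f : β) : Prop :=
  e ≠ f ∧ G.IsNonloopAt e v ∧ G.IsNonloopAt f v ∧ ∀ g, G.Inc g v → g = e ∨ g = f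

/-- `H` arises from `G` by smoothing over a 2-valent vertex `v`: the edges `e` from `v` to `x`
and `f` from `v` to `y` are replaced by one edge from `x` to `y`, again called `e`. -/
def Smoothing (G H : Graph α β) : Prop :=
  ∃ v e f x y, IsTwoValent G v e f ∧ G.IsLink e v x ∧ G.IsLink f v y ∧
    V(H) = V(G) \ {v} ∧ H.IsLink e x y ∧
    ∀ g, g ≠ e → ∀ a b, H.IsLink g a b ↔ g ≠ f ∧ G.IsLink g a b

/-- `K` is a skeleton of `G`: it is obtained by iteratively removing vertices of degree one
with their edges until there are none, and then smoothing over the 2-valent vertices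
until there are none. -/
def IsSkeleton (G K : Graph α β) : Prop :=
  ∃ C : Graph α β, Relation.ReflTransGen LeafRemoval G C ∧ (∀ v, ¬ IsLeaf C v) ∧
    Relation.ReflTransGen Smoothing C K ∧ ∀ v e f, ¬ IsTwoValent K v e f

/-- Two multigraphs are isomorphic. -/
def Isomorphic {α' β' : Type*} (G : Graph α β) (H : Graph α' β') : Prop :=
  ∃ (φ : V(G) ≃ V(H)) (ψ : E(G) ≃ E(H)), ∀ (e : E(G)) (x y : V(G)),
    G.IsLink e x y ↔ H.IsLink (ψ e : β') (φ x : α') (φ y : α')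

end Skeleton

/-! ### Chains

A chain of genus `k + 2` consists of `k + 2` cycles in a line. There are `k + 1` junctions between
adjacent cycles. The word `s` says of each junction whether the two adjacent
cycles share an edge (`true`) or are joined by a bridge (`false`). Junction `i` has two vertices
`(i, false)` and `(i, true)`, and the shared edge or bridge between them. If the edge is shared,
then both vertices lie on both cycles; if it is a bridge, then `(i, false)` lies on the cycle before
the junction and `(i, true)` on the cycle after it. -/

/-- The edges of a chain with `k + 1` junctions: the shared edge or bridge at each
junction, the two edges `mid i false` and `mid i true` of the cycle between the junctions
`i` and `i + 1`, and the remaining edges of the first and of the last cycle. -/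
inductive ChainEdge (k : ℕ) where
  | junction (i : Fin (k + 1))
  | mid (i : Fin k) (t : Bool)
  | first
  | last

/-- The vertex of junction `i` at which the strand `t` of the cycle before the junction ends. -/
def chainBefore {k : ℕ} (s : Fin (k + 1) → Bool) (i : Fin (k + 1)) (t : Bool) :
    Fin (k + 1) × Bool := (i, if s i then t else false)

/-- The vertex of junction `i` at which the strand `t` of the cycle after the junction begins. -/
def chainAfter {k : ℕ} (s : Fin (k + 1) → Bool) (i : Fin (k + 1)) (t : Bool) :
    Fin (k + 1) × Bool := (i, if s i then t else true)

/-- The ends of the edges of a chain. -/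
def chainEnds {k : ℕ} (s : Fin (k + 1) → Bool) : ChainEdge k → Sym2 (Fin (k + 1) × Bool)
  | .junction i => s((i, false), (i, true))
  | .mid i t => s(chainAfter s i.castSucc t, chainBefore s i.succ t)
  | .first => s(chainBefore s 0 false, chainBefore s 0 true)
  | .last => s(chainAfter s (Fin.last k) false, chainAfter s (Fin.last k) true)

/-- The chain with word `s`. -/
def chainGraph {k : ℕ} (s : Fin (k + 1) → Bool) : Graph (Fin (k + 1) × Bool) (ChainEdge k) where
  vertexSet := Set.univ
  IsLink e x y := chainEnds s e = s(x, y)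
  isLink_symm _ _ := ⟨fun _ _ hxy ↦ hxy.trans Sym2.eq_swap⟩
  eq_or_eq_of_isLink_of_isLink := fun _ _ _ _ _ hxy hvw ↦ by
    rcases Sym2.eq_iff.1 (hxy.symm.trans hvw) with h | h
    · exact Or.inl h.1
    · exact Or.inr h.1
  left_mem_of_isLink := fun _ _ _ _ ↦ Set.mem_univ _

/-- A multigraph is a chain if it is isomorphic to the chain of some word. -/
def IsChain {α β : Type*} (G : Graph α β) : Prop :=
  ∃ (k : ℕ) (s : Fin (k + 1) → Bool), Isomorphic G (chainGraph s)

end NodalCurve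

/-! Choose lattice coordinates `(c, ρ)` in which the interior lattice points lie in the row `ρ = 0`.
As there are at least three of them, all lattice points of `P` lie in the rows `-1`, `0`, `1`
(`row_bound`). In the dual coordinates `(X, Y)`, the tropical polynomial restricted to a vertical
line `X = t` is a maximum of three affine functions of `Y` of slopes `-1`, `0`, `1`, so it breaks at
most twice. Hence at most two non-vertical edges of the curve cross the line (`Strip.not_three`),
and at most one vertical edge lies on it, dual to a segment of the middle row
(`Strip.eq_of_vertical`).

This picture survives the passage to the skeleton, although an edge there is a concatenation of
straight pieces and may turn back. Each edge carries numbers `N e p b`, counting how often it covers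
the cut just before or just after the level `p`; smoothing adds them. Each cut is covered at most
twice in total, and the parity of `N e p b` says whether the cut separates the ends of `e`
(`Covering`, `Tame.of_smoothing`).

A connected skeleton with at least two vertices is trivalent. Three darts at each vertex, at most
two darts leaving a level to each side and at most one flat edge on it leave two possibilities for
an occupied level: one vertex without flat edges, or two vertices joined by a flat edge with two
darts on each side (`LayeredCubic.layer_cases`). No edge passes over an occupied level. Read from
left to right, the graph is therefore a sequence of junctions connected by pairs of strands and
closed up by one arc at each end, which is a chain (`LayeredCubic.exists_chain`,
`LayeredCubic.isChain`).

The bound on the parallelograms excludes a skeleton with one vertex. Removing a leaf and smoothing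
each delete one vertex and one edge, so it suffices that the bounded curve has more edges than
points (`Strip.ncard_curvePoints_lt`). Every point sends an edge to the right, except a flat branch
through a node; a split sends two. Such an edge is slanted and bounded, or it is dual to the right
boundary of `P`. On the other hand, each inner point of the middle row yields a vertical edge, a
split, or a parallelogram meeting all three rows (`Strip.exists_junction`). Adding up, the edges
exceed the points by at least the number of inner points, minus the number of right boundary edges,
minus the number of parallelograms. The first difference is at least `g - 1`, and there are at most
`g - 2` parallelograms. -/

namespace NodalCurve

/-! ### Trivalent graphs with a layering

A dart of a multigraph is one of the two ends of one of its edges. -/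

section Layered

variable {α β : Type*}

/-- The other dart of the same edge. -/
def opp (d : β × Bool) : β × Bool := (d.1, !d.2)

@[simp] lemma opp_fst (d : β × Bool) : (opp d).1 = d.1 := rfl

@[simp] lemma opp_opp (d : β × Bool) : opp (opp d) = d := by simp [opp]

lemma opp_ne (d : β × Bool) : opp d ≠ d := by
  intro h
  have := congrArg Prod.snd h
  simp [opp] at this

lemma eq_or_eq_opp {d d' : β × Bool} (h : d.1 = d'.1) : d = d' ∨ d = opp d' := by
  rcases d with ⟨e, b⟩
  rcases d' with ⟨e', b'⟩
  obtain rfl : e = e' := h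
  cases b <;> cases b' <;> simp [opp]

/-- The lower side of the cut of the vertices just before (`false`) or just after (`true`)
the level `p`. -/
def Below (f : α → ℝ) (p : ℝ) (b : Bool) (z : α) : Prop := if b then f z ≤ p else f z < p

@[simp] lemma below_false {f : α → ℝ} {p : ℝ} {z : α} : Below f p false z ↔ f z < p := by
  simp [Below]

@[simp] lemma below_true {f : α → ℝ} {p : ℝ} {z : α} : Below f p true z ↔ f z ≤ p := by
  simp [Below]

/-- An edge is flat if it does not cover any cut. -/
def Flat (N : β → ℝ → Bool → ℕ) (e : β) : Prop := ∀ p b, N e p b = 0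

open Classical in
/-- A connected trivalent multigraph with vertices `V`, edges `E` and ends `en`, with a level
function `f` and a covering number `N e p b` of each cut by each edge, such that
each cut is covered at most twice. -/
structure LayeredCubic (V : Finset α) (E : Finset β) (en : β × Bool → α) (f : α → ℝ)
    (N : β → ℝ → Bool → ℕ) : Prop where
  end_mem : ∀ d : β × Bool, d.1 ∈ E → en d ∈ V
  card_darts : ∀ z ∈ V, ((E ×ˢ Finset.univ).filter (fun d ↦ en d = z)).card = 3
  parity : ∀ d : β × Bool, d.1 ∈ E → ∀ p b,
    (Odd (N d.1 p b) ↔ ¬ (Below f p b (en d) ↔ Below f p b (en (opp d))))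
  cover_le : ∀ p b, ∑ e ∈ E, N e p b ≤ 2
  adjacent : ∀ d : β × Bool, d.1 ∈ E →
    Flat N d.1 ∨ N d.1 (f (en d)) false ≠ 0 ∨ N d.1 (f (en d)) true ≠ 0
  flat_unique : ∀ d d' : β × Bool, d.1 ∈ E → d'.1 ∈ E → Flat N d.1 → Flat N d'.1 →
    f (en d) = f (en d') → d.1 = d'.1
  flat_ne : ∀ d : β × Bool, d.1 ∈ E → Flat N d.1 → en d ≠ en (opp d)
  cut : ∀ p b, (∃ z ∈ V, Below f p b z) → (∃ z ∈ V, ¬ Below f p b z) →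
    ∃ d : β × Bool, d.1 ∈ E ∧ Below f p b (en d) ∧ ¬ Below f p b (en (opp d))

namespace LayeredCubic

variable {V : Finset α} {E : Finset β} {en : β × Bool → α}
  {f : α → ℝ} {N : β → ℝ → Bool → ℕ}

/-- The vertices on the level `p`. -/
noncomputable def layer (V : Finset α) (f : α → ℝ) (p : ℝ) : Finset α := V.filter (fun z ↦ f z = p)

open Classical in
/-- The darts on level `p` that leave to the left. -/
noncomputable def leftDarts (E : Finset β) (en : β × Bool → α) (f : α → ℝ)
    (N : β → ℝ → Bool → ℕ) (p : ℝ) : Finset (β × Bool) :=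
  (E ×ˢ Finset.univ).filter (fun d ↦ f (en d) = p ∧ N d.1 p false ≠ 0)

open Classical in
/-- The darts on level `p` that leave to the right. -/
noncomputable def rightDarts (E : Finset β) (en : β × Bool → α) (f : α → ℝ)
    (N : β → ℝ → Bool → ℕ) (p : ℝ) : Finset (β × Bool) :=
  (E ×ˢ Finset.univ).filter (fun d ↦ f (en d) = p ∧ N d.1 p false = 0 ∧ N d.1 p true ≠ 0)

open Classical in
/-- The darts on level `p` of flat edges. -/
noncomputable def flatDarts (E : Finset β) (en : β × Bool → α) (f : α → ℝ)
    (N : β → ℝ → Bool → ℕ) (p : ℝ) : Finset (β × Bool) :=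
  (E ×ˢ Finset.univ).filter (fun d ↦ f (en d) = p ∧ Flat N d.1)

lemma mem_leftDarts {p : ℝ} {d : β × Bool} : d ∈ leftDarts E en f N p ↔
    d.1 ∈ E ∧ f (en d) = p ∧ N d.1 p false ≠ 0 := by simp [leftDarts]

lemma mem_rightDarts {p : ℝ} {d : β × Bool} : d ∈ rightDarts E en f N p ↔
    d.1 ∈ E ∧ f (en d) = p ∧ N d.1 p false = 0 ∧ N d.1 p true ≠ 0 := by simp [rightDarts]

lemma mem_flatDarts {p : ℝ} {d : β × Bool} : d ∈ flatDarts E en f N p ↔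
    d.1 ∈ E ∧ f (en d) = p ∧ Flat N d.1 := by simp [flatDarts]

lemma mem_layer {p : ℝ} {z : α} : z ∈ layer V f p ↔ z ∈ V ∧ f z = p := by simp [layer]

open Classical in
-- What `e₀` covers in excess of the darts that it contributes to `S` is lost to the other darts.
-- This excess is what rules out edges that pass over a level or turn back there.
lemma card_add_le {S : Finset (β × Bool)} {n : β → ℕ} (hS : ∀ d ∈ S, d.1 ∈ E)
    (hn : ∀ e ∈ E, (S.filter (fun d ↦ d.1 = e)).card ≤ n e) (hsum : ∑ e ∈ E, n e ≤ 2) {e₀ : β}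
    (he₀ : e₀ ∈ E) : S.card + n e₀ ≤ 2 + (S.filter (fun d ↦ d.1 = e₀)).card := by
  rw [Finset.card_eq_sum_card_fiberwise (f := fun d : β × Bool ↦ d.1) (t := E) hS]
  rw [← Finset.add_sum_erase _ _ he₀] at hsum ⊢
  have : ∑ e ∈ E.erase e₀, (S.filter (fun d ↦ d.1 = e)).card ≤ ∑ e ∈ E.erase e₀, n e :=
    Finset.sum_le_sum fun e he ↦ hn e (Finset.mem_of_mem_erase he)
  omega

open Classical in
-- If both darts of `e` lie in `S`, both ends are on level `p`, so by parity the nonzero number `N e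
-- p b` is even and hence at least two. For a single dart it is enough that it is nonzero.
lemma fiber_le (H : LayeredCubic V E en f N) {p : ℝ} {b : Bool} {S : Finset (β × Bool)}
    (hS : ∀ d ∈ S, d.1 ∈ E ∧ f (en d) = p ∧ N d.1 p b ≠ 0) (e : β) :
    (S.filter (fun d ↦ d.1 = e)).card ≤ N e p b := by
  rcases (S.filter (fun d ↦ d.1 = e)).eq_empty_or_nonempty with h0 | ⟨d, hd⟩
  · simp [h0]
  obtain ⟨hdS, rfl⟩ := Finset.mem_filter.1 hd
  obtain ⟨hdE, hfd, hN⟩ := hS d hdS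
  by_cases ho : opp d ∈ S
  · have hpar := H.parity d hdE p b
    have h2 : ¬ Odd (N d.1 p b) := by
      rw [hpar]
      have := (hS _ ho).2.1
      cases b <;> simp [hfd, this]
    have hle : (S.filter (fun d' ↦ d'.1 = d.1)).card ≤ ({d, opp d} : Finset (β × Bool)).card := by
      refine Finset.card_le_card fun d' hd' ↦ ?_
      rcases eq_or_eq_opp (Finset.mem_filter.1 hd').2 with h | h <;> simp [h]
    have h3 : ({d, opp d} : Finset (β × Bool)).card ≤ 2 := Finset.card_le_two
    rcases Nat.not_odd_iff_even.1 h2 with ⟨k, hk⟩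
    omega
  · have hle : (S.filter (fun d' ↦ d'.1 = d.1)).card ≤ ({d} : Finset (β × Bool)).card := by
      refine Finset.card_le_card fun d' hd' ↦ ?_
      rcases eq_or_eq_opp (Finset.mem_filter.1 hd').2 with h | h
      · simp [h]
      · exact absurd (h ▸ (Finset.mem_filter.1 hd').1) ho
    simp only [Finset.card_singleton] at hle
    omega

open Classical in
lemma left_add_le (H : LayeredCubic V E en f N) (p : ℝ) {e : β} (he : e ∈ E) :
    (leftDarts E en f N p).card + N e p false ≤
      2 + ((leftDarts E en f N p).filter (fun d ↦ d.1 = e)).card :=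
  card_add_le (fun _ hd ↦ (mem_leftDarts.1 hd).1)
    (fun e _ ↦ H.fiber_le (fun _ hd ↦ mem_leftDarts.1 hd) e) (H.cover_le p false) he

open Classical in
lemma right_add_le (H : LayeredCubic V E en f N) (p : ℝ) {e : β} (he : e ∈ E) :
    (rightDarts E en f N p).card + N e p true ≤
      2 + ((rightDarts E en f N p).filter (fun d ↦ d.1 = e)).card :=
  card_add_le (fun _ hd ↦ (mem_rightDarts.1 hd).1)
    (fun e _ ↦ H.fiber_le (fun _ hd ↦ ⟨(mem_rightDarts.1 hd).1, (mem_rightDarts.1 hd).2.1,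
      (mem_rightDarts.1 hd).2.2.2⟩) e) (H.cover_le p true) he

lemma left_le (H : LayeredCubic V E en f N) (p : ℝ) : (leftDarts E en f N p).card ≤ 2 := by
  classical
  rcases (leftDarts E en f N p).eq_empty_or_nonempty with h | ⟨d, hd⟩
  · simp [h]
  · have h1 := H.left_add_le p (mem_leftDarts.1 hd).1
    have h2 := H.fiber_le (fun _ hd ↦ mem_leftDarts.1 hd) d.1 (p := p) (b := false)
      (S := leftDarts E en f N p)
    omega

lemma right_le (H : LayeredCubic V E en f N) (p : ℝ) : (rightDarts E en f N p).card ≤ 2 := by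
  classical
  rcases (rightDarts E en f N p).eq_empty_or_nonempty with h | ⟨d, hd⟩
  · simp [h]
  · have h1 := H.right_add_le p (mem_rightDarts.1 hd).1
    have h2 := H.fiber_le (S := rightDarts E en f N p) (fun _ hd ↦ ⟨(mem_rightDarts.1 hd).1,
      (mem_rightDarts.1 hd).2.1, (mem_rightDarts.1 hd).2.2.2⟩) d.1 (p := p) (b := true)
    omega

lemma flat_subset (H : LayeredCubic V E en f N) {p : ℝ} {d : β × Bool}
    (hd : d ∈ flatDarts E en f N p) {d' : β × Bool} (hd' : d' ∈ flatDarts E en f N p) :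
    d' = d ∨ d' = opp d := by
  rw [mem_flatDarts] at hd hd'
  exact eq_or_eq_opp (H.flat_unique d' d hd'.1 hd.1 hd'.2.2 hd.2.2 (hd'.2.1.trans hd.2.1.symm))

lemma flat_le (H : LayeredCubic V E en f N) (p : ℝ) : (flatDarts E en f N p).card ≤ 2 := by
  classical
  rcases (flatDarts E en f N p).eq_empty_or_nonempty with h | ⟨d, hd⟩
  · simp [h]
  · refine (Finset.card_le_card (t := {d, opp d}) fun d' hd' ↦ ?_).trans Finset.card_le_two
    rcases H.flat_subset hd hd' with h | h <;> simp [h]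

/-- The end of a flat edge opposite to a dart lies on the same level. -/
lemma flat_level (H : LayeredCubic V E en f N) {d : β × Bool} (hd : d.1 ∈ E) (hf : Flat N d.1) :
    f (en (opp d)) = f (en d) := by
  have h1 := H.parity d hd (f (en d)) true
  have h2 := H.parity d hd (f (en (opp d))) true
  simp only [hf _ _, below_true, le_refl, true_iff, iff_true] at h1 h2
  have h3 : ¬ Odd 0 := by decide
  have h4 := not_not.1 (fun h ↦ h3 (h1.2 h))
  have h5 := not_not.1 (fun h ↦ h3 (h2.2 h))
  exact le_antisymm h4 h5

/-- A dart whose edge covers both sides of its level counts as a left dart. This precedence makes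
the three classes disjoint. -/
lemma mem_some (H : LayeredCubic V E en f N) {d : β × Bool} (hd : d.1 ∈ E) :
    d ∈ leftDarts E en f N (f (en d)) ∨ d ∈ rightDarts E en f N (f (en d)) ∨
      d ∈ flatDarts E en f N (f (en d)) := by
  rw [mem_leftDarts, mem_rightDarts, mem_flatDarts]
  rcases H.adjacent d hd with h | h | h
  · exact Or.inr (Or.inr ⟨hd, rfl, h⟩)
  · exact Or.inl ⟨hd, rfl, h⟩
  · by_cases h0 : N d.1 (f (en d)) false = 0
    · exact Or.inr (Or.inl ⟨hd, rfl, h0, h⟩)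
    · exact Or.inl ⟨hd, rfl, h0⟩

/-- The darts on the level are counted by vertices and by classes. -/
lemma three_mul (H : LayeredCubic V E en f N) (p : ℝ) : 3 * (layer V f p).card =
    (leftDarts E en f N p).card + (rightDarts E en f N p).card +
      (flatDarts E en f N p).card := by
  classical
  set D := (E ×ˢ Finset.univ).filter (fun d : β × Bool ↦ f (en d) = p) with hD
  have h1 : D.card = 3 * (layer V f p).card := by
    rw [Finset.card_eq_sum_card_fiberwise (f := en) (t := layer V f p)]
    · rw [Finset.sum_const_nat (m := 3), mul_comm]
      intro z hz
      rw [mem_layer] at hz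
      rw [← H.card_darts z hz.1]
      congr 1
      ext d
      simp only [hD, Finset.mem_filter]
      constructor
      · rintro ⟨⟨h, -⟩, h'⟩; exact ⟨h, h'⟩
      · rintro ⟨h, h'⟩; exact ⟨⟨h, by rw [h', hz.2]⟩, h'⟩
    · intro d hd
      simp only [hD, Finset.coe_filter, Finset.mem_product, Finset.mem_univ, and_true,
        Set.mem_ofPred_eq] at hd
      exact Finset.mem_coe.2 (mem_layer.2 ⟨H.end_mem d hd.1, hd.2⟩)
  have h2 : D = (leftDarts E en f N p ∪ rightDarts E en f N p) ∪ flatDarts E en f N p := by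
    ext d
    simp only [hD, Finset.mem_filter, Finset.mem_product, Finset.mem_univ, and_true,
      Finset.mem_union]
    constructor
    · rintro ⟨h, rfl⟩
      rcases H.mem_some h with h | h | h <;> simp [h]
    · rw [mem_leftDarts, mem_rightDarts, mem_flatDarts]
      rintro ((h | h) | h) <;> exact ⟨h.1, h.2.1⟩
  rw [← h1, h2, Finset.card_union_of_disjoint, Finset.card_union_of_disjoint]
  · rw [Finset.disjoint_left]
    intro d h h'
    rw [mem_leftDarts] at h
    rw [mem_rightDarts] at h'
    exact h.2.2 h'.2.2.1
  · rw [Finset.disjoint_left]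
    intro d h h'
    rw [mem_flatDarts] at h'
    rw [Finset.mem_union, mem_leftDarts, mem_rightDarts] at h
    rcases h with h | h
    · exact h.2.2 (h'.2.2 _ _)
    · exact h.2.2.2 (h'.2.2 _ _)

/-- A flat edge has both ends on its level and is not a loop, so it needs two vertices there. -/
lemma flat_card (H : LayeredCubic V E en f N) (p : ℝ) (h1 : (layer V f p).card ≤ 1) :
    (flatDarts E en f N p).card = 0 := by
  rw [Finset.card_eq_zero, Finset.eq_empty_iff_forall_notMem]
  intro d hd
  rw [mem_flatDarts] at hd
  refine H.flat_ne d hd.1 hd.2.2 (Finset.card_le_one.1 h1 _ ?_ _ ?_)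
  · exact mem_layer.2 ⟨H.end_mem _ hd.1, hd.2.1⟩
  · exact mem_layer.2 ⟨H.end_mem _ hd.1, (H.flat_level hd.1 hd.2.2).trans hd.2.1⟩

/-- A level is occupied by one vertex with three darts leaving to the sides or by two vertices. -/
lemma layer_cases (H : LayeredCubic V E en f N) {p : ℝ} (hp : ∃ z ∈ V, f z = p) :
    ((layer V f p).card = 1 ∧ (leftDarts E en f N p).card + (rightDarts E en f N p).card = 3) ∨
    ((layer V f p).card = 2 ∧ (leftDarts E en f N p).card = 2 ∧
      (rightDarts E en f N p).card = 2 ∧ (flatDarts E en f N p).card = 2) := by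
  have h1 := H.three_mul p
  have h2 := H.left_le p
  have h3 := H.right_le p
  have h4 := H.flat_le p
  have h5 : 0 < (layer V f p).card := by
    obtain ⟨z, hz, hzp⟩ := hp
    exact Finset.card_pos.2 ⟨z, mem_layer.2 ⟨hz, hzp⟩⟩
  have h6 := H.flat_card p
  -- There are at most two darts in each class, so at most six in all. Two vertices use up all six,
  -- and three vertices are impossible.
  by_cases h7 : (layer V f p).card ≤ 1
  · have := h6 h7; omega
  · omega

lemma three_le (H : LayeredCubic V E en f N) {p : ℝ} (hp : ∃ z ∈ V, f z = p) :
    3 ≤ (leftDarts E en f N p).card + (rightDarts E en f N p).card := by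
  rcases H.layer_cases hp with h | h <;> omega

/-- No edge passes over a level. -/
lemma not_pass (H : LayeredCubic V E en f N) {p : ℝ} (hp : ∃ z ∈ V, f z = p) {d : β × Bool}
    (hd : d.1 ∈ E) (h1 : f (en d) < p) : f (en (opp d)) ≤ p := by
  classical
  by_contra! h2
  -- The edge covers both cuts at `p` without contributing a dart there. This leaves at most one
  -- left and one right dart, against `three_le`.
  have o1 : Odd (N d.1 p false) := by
    rw [H.parity d hd]; simp only [below_false]; intro h; linarith [h.1 h1]
  have o2 : Odd (N d.1 p true) := by
    rw [H.parity d hd]; simp only [below_true]; intro h; linarith [h.1 h1.le]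
  have e0 : ∀ d' : β × Bool, d'.1 = d.1 → f (en d') ≠ p := by
    intro d' h
    rcases eq_or_eq_opp h with rfl | rfl
    · exact h1.ne
    · exact h2.ne'
  have e1 : ((leftDarts E en f N p).filter (fun d' ↦ d'.1 = d.1)).card = 0 := by
    rw [Finset.card_eq_zero, Finset.filter_eq_empty_iff]
    exact fun d' hd' h ↦ e0 d' h (mem_leftDarts.1 hd').2.1
  have e2 : ((rightDarts E en f N p).filter (fun d' ↦ d'.1 = d.1)).card = 0 := by
    rw [Finset.card_eq_zero, Finset.filter_eq_empty_iff]
    exact fun d' hd' h ↦ e0 d' h (mem_rightDarts.1 hd').2.1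
  have := H.left_add_le p hd
  have := H.right_add_le p hd
  have := H.three_le hp
  have := o1.pos
  have := o2.pos
  omega

/-- Otherwise the edge covers the cut before the level at least twice, by parity, for a single left
dart, and the cut after it at least once without a right dart. This leaves at most one dart on each
side, against `three_le`. -/
lemma left_le_level (H : LayeredCubic V E en f N) {p : ℝ} {d : β × Bool}
    (hd : d ∈ leftDarts E en f N p) : f (en (opp d)) ≤ p := by
  classical
  obtain ⟨hdE, rfl, hN⟩ := mem_leftDarts.1 hd
  by_contra! h2
  have hp : ∃ z ∈ V, f z = f (en d) := ⟨_, H.end_mem d hdE, rfl⟩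
  have o1 : ¬ Odd (N d.1 (f (en d)) false) := by
    rw [H.parity d hdE]; simp only [below_false, lt_irrefl, false_iff]; push Not; exact h2.le
  have o2 : Odd (N d.1 (f (en d)) true) := by
    rw [H.parity d hdE]; simp only [below_true, le_refl, true_iff]; exact not_le.2 h2
  have e1 : ((leftDarts E en f N (f (en d))).filter (fun d' ↦ d'.1 = d.1)).card ≤ 1 := by
    rw [Finset.card_le_one]
    have : ∀ d' ∈ (leftDarts E en f N (f (en d))).filter (fun d' ↦ d'.1 = d.1), d' = d := by
      intro d' hd'
      obtain ⟨ha, hb⟩ := Finset.mem_filter.1 hd'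
      rcases eq_or_eq_opp hb with rfl | rfl
      · rfl
      · exact absurd (mem_leftDarts.1 ha).2.1 h2.ne'
    intro x hx y hy
    rw [this x hx, this y hy]
  have e2 : ((rightDarts E en f N (f (en d))).filter (fun d' ↦ d'.1 = d.1)).card = 0 := by
    rw [Finset.card_eq_zero, Finset.filter_eq_empty_iff]
    intro d' hd' h
    have := (mem_rightDarts.1 hd').2.2.1
    rw [h] at this
    exact hN this
  have := H.left_add_le (f (en d)) hdE
  have := H.right_add_le (f (en d)) hdE
  have := H.three_le hp
  have := o2.pos
  obtain ⟨k, hk⟩ := Nat.not_odd_iff_even.1 o1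
  omega

/-- By parity, an edge from `p` to a lower level covers the cut before `p`, which right darts do
not. -/
lemma right_le_level (H : LayeredCubic V E en f N) {p : ℝ} {d : β × Bool}
    (hd : d ∈ rightDarts E en f N p) : p ≤ f (en (opp d)) := by
  obtain ⟨hdE, rfl, hN, -⟩ := mem_rightDarts.1 hd
  by_contra! h2
  have o1 : Odd (N d.1 (f (en d)) false) := by
    rw [H.parity d hdE]; simp only [below_false, lt_irrefl, false_iff]; exact not_not.2 h2
  rw [hN] at o1
  exact absurd o1 (by decide)

lemma opp_mem_left {p : ℝ} {d : β × Bool} (hd : d ∈ leftDarts E en f N p)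
    (h : f (en (opp d)) = p) : opp d ∈ leftDarts E en f N p := by
  rw [mem_leftDarts] at hd ⊢
  exact ⟨hd.1, h, hd.2.2⟩

lemma opp_mem_right {p : ℝ} {d : β × Bool} (hd : d ∈ rightDarts E en f N p)
    (h : f (en (opp d)) = p) : opp d ∈ rightDarts E en f N p := by
  rw [mem_rightDarts] at hd ⊢
  exact ⟨hd.1, h, hd.2.2⟩

/-- An end of an edge whose other end is on a lower level leaves to the left. -/
lemma mem_left_of_lt (H : LayeredCubic V E en f N) {d : β × Bool} (hd : d.1 ∈ E)
    (h : f (en (opp d)) < f (en d)) : d ∈ leftDarts E en f N (f (en d)) := by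
  rw [mem_leftDarts]
  refine ⟨hd, rfl, ?_⟩
  have o1 : Odd (N d.1 (f (en d)) false) := by
    rw [H.parity d hd]; simp only [below_false, lt_irrefl, false_iff]; exact not_not.2 h
  exact o1.pos.ne'

/-- An end of an edge whose other end is on a higher level leaves to the right. -/
lemma mem_right_of_lt (H : LayeredCubic V E en f N) {d : β × Bool} (hd : d.1 ∈ E)
    (h : f (en d) < f (en (opp d))) : d ∈ rightDarts E en f N (f (en d)) := by
  rcases H.mem_some hd with h' | h' | h'
  · exact absurd (H.left_le_level h') (not_le.2 h)
  · exact h'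
  · exact absurd (H.flat_level hd (mem_flatDarts.1 h').2.2) h.ne'

end LayeredCubic
end Layered
end NodalCurve

namespace NodalCurve

/-! ### Junctions, and the decomposition of a layered graph into a sequence of them -/

section Blocks

variable {α β : Type*}

/-- A junction of a chain with its two vertices `vt`, the edge `J` between them, the kind `s` of
the junction and the darts `l`, `r` in which the strands on the left and on the right end. -/
structure Block (α β : Type*) where
  vt : Bool → α
  J : β
  s : Bool
  l : Bool → β × Bool
  r : Bool → β × Bool

/-- The incidences of a junction in the graph with edges `E` and ends `en`. -/
structure IsBlock (E : Finset β) (en : β × Bool → α) (B : Block α β) : Prop where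
  vt_ne : B.vt false ≠ B.vt true
  J_mem : B.J ∈ E
  J_end : ∃ d : β × Bool, d.1 = B.J ∧ en d = B.vt false ∧ en (opp d) = B.vt true
  l_mem : ∀ t, (B.l t).1 ∈ E
  r_mem : ∀ t, (B.r t).1 ∈ E
  l_end : ∀ t, en (B.l t) = B.vt (if B.s then t else false)
  r_end : ∀ t, en (B.r t) = B.vt (if B.s then t else true)
  r_ne : B.r false ≠ B.r true
  l_J : ∀ t, (B.l t).1 ≠ B.J
  r_J : ∀ t, (B.r t).1 ≠ B.J
  l_r : ∀ t t', B.l t ≠ B.r t'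
  all : ∀ d : β × Bool, d.1 ∈ E → (∃ t, en d = B.vt t) →
    d.1 = B.J ∨ (∃ t, d = B.l t) ∨ ∃ t, d = B.r t

lemma eq_or_eq_of_card_eq_two {γ : Type*} {S : Finset γ} (hS : S.card ≤ 2) {a b : γ} (ha : a ∈ S)
    (hb : b ∈ S) (hab : a ≠ b) {c : γ} (hc : c ∈ S) : c = a ∨ c = b := by
  classical
  have h1 : ({a, b} : Finset γ) ⊆ S := by
    intro x hx
    rcases Finset.mem_insert.1 hx with rfl | hx
    · exact ha
    · rw [Finset.mem_singleton.1 hx]; exact hb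
  have h2 := Finset.eq_of_subset_of_card_le h1 (by rw [Finset.card_pair hab]; exact hS)
  rw [← h2] at hc
  simpa using hc

namespace LayeredCubic

variable {V : Finset α} {E : Finset β} {en : β × Bool → α} {f : α → ℝ} {N : β → ℝ → Bool → ℕ}

/-- Trivalence in the form that distributes the strands over the two vertices of a level. -/
lemma not_four (H : LayeredCubic V E en f N) {a b c d : β × Bool} (ha : a.1 ∈ E) (hb : b.1 ∈ E)
    (hc : c.1 ∈ E) (hd : d.1 ∈ E) (hab : a ≠ b) (hac : a ≠ c) (had : a ≠ d) (hbc : b ≠ c)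
    (hbd : b ≠ d) (hcd : c ≠ d) (eb : en b = en a) (ec : en c = en a) (ed : en d = en a) :
    False := by
  classical
  have h3 := H.card_darts (en a) (H.end_mem a ha)
  have h4 : ({a, b, c, d} : Finset (β × Bool)).card = 4 := by
    rw [Finset.card_insert_of_notMem, Finset.card_insert_of_notMem, Finset.card_pair hcd] <;>
      simp [*]
  have h5 := Finset.card_le_card (s := {a, b, c, d})
    (t := (E ×ˢ Finset.univ).filter (fun d ↦ en d = en a)) (by
      intro x hx
      simp only [Finset.mem_insert, Finset.mem_singleton] at hx
      rcases hx with rfl | rfl | rfl | rfl <;> simp [*])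
  rw [h4] at h5
  have h6 : ((E ×ˢ Finset.univ).filter (fun d : β × Bool ↦ en d = en a)).card = 3 := by
    convert h3
  omega

lemma left_ne_right {p : ℝ} {d d' : β × Bool} (h : d ∈ leftDarts E en f N p)
    (h' : d' ∈ rightDarts E en f N p) : d ≠ d' := by
  rintro rfl
  exact (mem_leftDarts.1 h).2.2 (mem_rightDarts.1 h').2.2.1

lemma left_ne_flat {p q : ℝ} {d d' : β × Bool} (h : d ∈ leftDarts E en f N p)
    (h' : d' ∈ flatDarts E en f N q) : d.1 ≠ d'.1 := by
  intro e
  exact (mem_leftDarts.1 h).2.2 (e ▸ (mem_flatDarts.1 h').2.2 _ _)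

lemma right_ne_flat {p q : ℝ} {d d' : β × Bool} (h : d ∈ rightDarts E en f N p)
    (h' : d' ∈ flatDarts E en f N q) : d.1 ≠ d'.1 := by
  intro e
  exact (mem_rightDarts.1 h).2.2.2 (e ▸ (mem_flatDarts.1 h').2.2 _ _)

/-- The junction on a level with two vertices. -/
lemma exists_block_of_two (H : LayeredCubic V E en f N) {p : ℝ} {l : Bool → β × Bool}
    (hl : ∀ t, l t ∈ leftDarts E en f N p) (hne : l false ≠ l true)
    (h2 : (layer V f p).card = 2) (hR : (rightDarts E en f N p).card = 2)
    (hF : (flatDarts E en f N p).card = 2) :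
    ∃ B : Block α β, IsBlock E en B ∧ B.l = l ∧ (∀ t, B.vt t ∈ layer V f p) ∧
      (∀ t, B.r t ∈ rightDarts E en f N p) := by
  classical
  obtain ⟨a, b, hab, hRab⟩ := Finset.card_eq_two.1 hR
  have ha : a ∈ rightDarts E en f N p := by rw [hRab]; simp
  have hb : b ∈ rightDarts E en f N p := by rw [hRab]; simp
  obtain ⟨d, hd⟩ : (flatDarts E en f N p).Nonempty := Finset.card_pos.1 (by omega)
  have hd' := mem_flatDarts.1 hd
  have hlevel := H.flat_level hd'.1 hd'.2.2
  have hod : opp d ∈ flatDarts E en f N p :=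
    mem_flatDarts.2 ⟨hd'.1, hlevel.trans hd'.2.1, hd'.2.2⟩
  have hxy := H.flat_ne d hd'.1 hd'.2.2
  have lmem := fun t ↦ (mem_leftDarts.1 (hl t)).1
  have rmem : ∀ {c}, c ∈ rightDarts E en f N p → c.1 ∈ E := fun h ↦ (mem_rightDarts.1 h).1
  have inlay : ∀ {c : β × Bool}, c.1 ∈ E → f (en c) = p → en c = en d ∨ en c = en (opp d) := by
    intro c hc hcp
    exact eq_or_eq_of_card_eq_two h2.le (mem_layer.2 ⟨H.end_mem d hd'.1, hd'.2.1⟩)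
      (mem_layer.2 ⟨H.end_mem (opp d) hd'.1, hlevel.trans hd'.2.1⟩) hxy
      (mem_layer.2 ⟨H.end_mem c hc, hcp⟩)
  have lall : ∀ {c}, c ∈ leftDarts E en f N p → c = l false ∨ c = l true := fun hc ↦
    eq_or_eq_of_card_eq_two (H.left_le p) (hl false) (hl true) hne hc
  have allp : ∀ c : β × Bool, c.1 ∈ E → f (en c) = p →
      c.1 = d.1 ∨ (∃ t, c = l t) ∨ c = a ∨ c = b := by
    intro c hc hcp
    rcases H.mem_some hc with h | h | h <;> rw [hcp] at h
    · rcases lall h with h | h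
      · exact Or.inr (Or.inl ⟨_, h⟩)
      · exact Or.inr (Or.inl ⟨_, h⟩)
    · exact Or.inr (Or.inr (eq_or_eq_of_card_eq_two hR.le ha hb hab h))
    · rcases H.flat_subset hd h with rfl | rfl <;> simp
  -- the block with prescribed vertices
  have build : ∀ (d : β × Bool) (s : Bool) (r : Bool → β × Bool), d ∈ flatDarts E en f N p →
      opp d ∈ flatDarts E en f N p → en d ≠ en (opp d) → 
      (∀ c : β × Bool, c.1 ∈ E → f (en c) = p →
        c.1 = d.1 ∨ (∃ t, c = l t) ∨ ∃ t, c = r t) →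
      (∀ t, r t ∈ rightDarts E en f N p) → r false ≠ r true →
      (∀ t, en (l t) = (if (if s then t else false) then en (opp d) else en d)) →
      (∀ t, en (r t) = (if (if s then t else true) then en (opp d) else en d)) →
      ∃ B : Block α β, IsBlock E en B ∧ B.l = l ∧ (∀ t, B.vt t ∈ layer V f p) ∧
      (∀ t, B.r t ∈ rightDarts E en f N p) := by
    intro d s r hd hod hxy hall hr hrne hle hre
    have hd' := mem_flatDarts.1 hd
    have hod' := mem_flatDarts.1 hod
    have hlay : ∀ t : Bool, (if t then en (opp d) else en d) ∈ layer V f p := by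
      intro t
      cases t
      · exact mem_layer.2 ⟨H.end_mem d hd'.1, hd'.2.1⟩
      · exact mem_layer.2 ⟨H.end_mem (opp d) hd'.1, hod'.2.1⟩
    refine ⟨⟨fun t ↦ if t then en (opp d) else en d, d.1, s, l, r⟩, ?_, rfl, hlay, hr⟩
    exact
      { vt_ne := by simpa using hxy
        J_mem := hd'.1
        J_end := ⟨d, rfl, by simp, by simp⟩
        l_mem := lmem
        r_mem := fun t ↦ rmem (hr t)
        l_end := hle
        r_end := hre
        r_ne := hrne
        l_J := fun t ↦ left_ne_flat (hl t) hd
        r_J := fun t ↦ right_ne_flat (hr t) hd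
        l_r := fun t t' ↦ left_ne_right (hl t) (hr t')
        all := by
          rintro c hc ⟨t, ht⟩
          refine hall c hc ?_
          rw [ht]
          exact (mem_layer.1 (hlay t)).2 }
  -- Here the flat edge is oriented so that the strand `l false` ends at `en d`.
  have key : ∀ d : β × Bool, d ∈ flatDarts E en f N p → opp d ∈ flatDarts E en f N p →
      en d ≠ en (opp d) → (∀ {c : β × Bool}, c.1 ∈ E → f (en c) = p →
        en c = en d ∨ en c = en (opp d)) →
      (∀ c : β × Bool, c.1 ∈ E → f (en c) = p → c.1 = d.1 ∨ (∃ t, c = l t) ∨ c = a ∨ c = b) →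
      en (l false) = en d → ∃ B : Block α β, IsBlock E en B ∧ B.l = l ∧
        (∀ t, B.vt t ∈ layer V f p) ∧ (∀ t, B.r t ∈ rightDarts E en f N p) := by
    intro d hd hod hxy inlay allp h0
    have dE : d.1 ∈ E := (mem_flatDarts.1 hd).1
    have lr : ∀ t {c}, c ∈ rightDarts E en f N p → l t ≠ c := fun t c hc ↦ left_ne_right (hl t) hc
    have dl : ∀ t, d ≠ l t := fun t h ↦ left_ne_flat (hl t) hd (by rw [h])
    have dr : ∀ {c}, c ∈ rightDarts E en f N p → d ≠ c := fun hc h ↦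
      right_ne_flat hc hd (by rw [h])
    have odl : ∀ t, opp d ≠ l t := fun t h ↦ left_ne_flat (hl t) hod (by rw [h])
    have odr : ∀ {c}, c ∈ rightDarts E en f N p → opp d ≠ c := fun hc h ↦
      right_ne_flat hc hod (by rw [h])
    have el := fun t ↦ inlay (lmem t) (mem_leftDarts.1 (hl t)).2.1
    have er : ∀ {c}, c ∈ rightDarts E en f N p → _ := fun hc ↦
      inlay (rmem hc) (mem_rightDarts.1 hc).2.1
    have allr : ∀ r : Bool → β × Bool, (∀ c, c = a ∨ c = b → ∃ t, c = r t) →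
        ∀ c : β × Bool, c.1 ∈ E → f (en c) = p → c.1 = d.1 ∨ (∃ t, c = l t) ∨ ∃ t, c = r t :=
      fun r hr c hc hcp ↦ (allp c hc hcp).imp_right (Or.imp_right (hr c))
    rcases el true with h1 | h1
    · -- both strands end in the same vertex
      -- That vertex is full, so both right strands start at the other one and the flat edge is a
      -- bridge.
      have hnot : ∀ {c}, c ∈ rightDarts E en f N p → en c = en (opp d) := by
        intro c hc
        rcases er hc with h | h
        · exact (H.not_four dE (lmem false) (lmem true) (rmem hc) (dl _) (dl _) (dr hc) hne
            (lr _ hc) (lr _ hc) h0 h1 h).elim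
        · exact h
      refine build d false (fun t ↦ if t then b else a) hd hod hxy (allr _ ?_) ?_ ?_ ?_ ?_
      · rintro c (rfl | rfl)
        · exact ⟨false, by simp⟩
        · exact ⟨true, by simp⟩
      · intro t; cases t <;> simp [ha, hb]
      · simpa using hab
      · intro t; cases t <;> simp [h0, h1]
      · intro t; cases t <;> simp [hnot ha, hnot hb]
    -- Each vertex has one left strand and the flat edge, so there is room for exactly one right
    -- strand: the flat edge is shared. The right strands are numbered like the left ones at the
    -- same vertex.
    · have hsplit : (en a = en d ∧ en b = en (opp d)) ∨ (en b = en d ∧ en a = en (opp d)) := by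
        rcases er ha with h | h <;> rcases er hb with h' | h'
        · exact (H.not_four dE (lmem false) (rmem ha) (rmem hb) (dl _) (dr ha) (dr hb)
            (lr _ ha) (lr _ hb) hab h0 h h').elim
        · exact Or.inl ⟨h, h'⟩
        · exact Or.inr ⟨h', h⟩
        · exact (H.not_four (a := opp d) dE (lmem true) (rmem ha) (rmem hb) (odl _) (odr ha)
            (odr hb) (lr _ ha) (lr _ hb) hab h1 h h').elim
      rcases hsplit with ⟨h, h'⟩ | ⟨h, h'⟩
      · refine build d true (fun t ↦ if t then b else a) hd hod hxy (allr _ ?_) ?_ ?_ ?_ ?_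
        · rintro c (rfl | rfl)
          · exact ⟨false, by simp⟩
          · exact ⟨true, by simp⟩
        · intro t; cases t <;> simp [ha, hb]
        · simpa using hab
        · intro t; cases t <;> simp [h0, h1]
        · intro t; cases t <;> simp [h, h']
      · refine build d true (fun t ↦ if t then a else b) hd hod hxy (allr _ ?_) ?_ ?_ ?_ ?_
        · rintro c (rfl | rfl)
          · exact ⟨true, by simp⟩
          · exact ⟨false, by simp⟩
        · intro t; cases t <;> simp [ha, hb]
        · simpa using hab.symm
        · intro t; cases t <;> simp [h0, h1]
        · intro t; cases t <;> simp [h, h']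
  rcases inlay (lmem false) (mem_leftDarts.1 (hl false)).2.1 with h | h
  · exact key d hd hod hxy inlay allp h
  · refine key (opp d) hod (by simpa using hd) (by simpa using hxy.symm) ?_ ?_ h
    · intro c hc hcp
      simpa using (inlay hc hcp).symm
    · simpa using allp

/-- The junction that begins on a level with one vertex is a bridge to the next level. -/
lemma exists_block_of_one (H : LayeredCubic V E en f N) {p : ℝ} {l : Bool → β × Bool}
    (hl : ∀ t, l t ∈ leftDarts E en f N p) (hne : l false ≠ l true)
    (h1 : (layer V f p).card = 1)
    (h3 : (leftDarts E en f N p).card + (rightDarts E en f N p).card = 3) :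
    ∃ B : Block α β, IsBlock E en B ∧ B.l = l ∧ ∃ q, p < q ∧
      (∀ z ∈ V, p ≤ f z → f z ≤ q → ∃ t, B.vt t = z) ∧
      (∀ t, B.vt t ∈ V ∧ p ≤ f (B.vt t) ∧ f (B.vt t) ≤ q) ∧
      (∀ t, B.r t ∈ rightDarts E en f N q) := by
  classical
  have lmem := fun t ↦ (mem_leftDarts.1 (hl t)).1
  have lall : ∀ {c}, c ∈ leftDarts E en f N p → c = l false ∨ c = l true := fun hc ↦
    eq_or_eq_of_card_eq_two (H.left_le p) (hl false) (hl true) hne hc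
  have hL : (leftDarts E en f N p).card = 2 := by
    have h := H.left_le p
    have : ({l false, l true} : Finset (β × Bool)).card ≤ (leftDarts E en f N p).card := by
      refine Finset.card_le_card fun x hx ↦ ?_
      simp only [Finset.mem_insert, Finset.mem_singleton] at hx
      rcases hx with rfl | rfl <;> exact hl _
    rw [Finset.card_pair hne] at this
    omega
  obtain ⟨j, hj⟩ := Finset.card_eq_one.1 (show (rightDarts E en f N p).card = 1 by omega)
  obtain ⟨u, hu⟩ := Finset.card_eq_one.1 h1
  have hjR : j ∈ rightDarts E en f N p := by simp [hj]
  have hjE := (mem_rightDarts.1 hjR).1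
  have hjp := (mem_rightDarts.1 hjR).2.1
  have inlay : ∀ {z}, z ∈ V → f z = p → z = u := by
    intro z hz hzp
    have := mem_layer.2 ⟨hz, hzp⟩
    rwa [hu, Finset.mem_singleton] at this
  have hju : en j = u := inlay (H.end_mem j hjE) hjp
  have huV : u ∈ V ∧ f u = p := by
    rw [← hju]; exact ⟨H.end_mem j hjE, hjp⟩
  -- The bridge is the edge of `j`, the only right dart on level `p`. It cannot return to `p`, as
  -- its opposite dart would be a second right dart.
  set q := f (en (opp j)) with hq
  have hpq : p < q := by
    refine lt_of_le_of_ne (H.right_le_level hjR) fun h ↦ ?_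
    have := opp_mem_right hjR h.symm
    rw [hj, Finset.mem_singleton] at this
    exact opp_ne j this
  have hqV : ∃ z ∈ V, f z = q := ⟨_, H.end_mem (opp j) hjE, rfl⟩
  have hbetween : ∀ z ∈ V, p < f z → f z < q → False := by
    intro z hz hpz hzq
    have := H.not_pass ⟨z, hz, rfl⟩ hjE (by rw [hjp]; exact hpz)
    linarith
  have hojL : opp j ∈ leftDarts E en f N q :=
    H.mem_left_of_lt (d := opp j) hjE (by rw [opp_opp, hjp]; exact hpq)
  -- Another left dart on `q` would have its other end on `p`, where `j` is the only right dart, or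
  -- on `q`, and then its two darts and `opp j` would be three left darts. With only one left dart,
  -- the level `q` cannot carry two vertices.
  have honly : ∀ d ∈ leftDarts E en f N q, d = opp j := by
    intro d hd
    obtain ⟨hdE, hdq, -⟩ := mem_leftDarts.1 hd
    by_contra hdj
    rcases (H.left_le_level hd).lt_or_eq with h | h
    · have h5 : f (en (opp d)) = p := by
        rcases lt_trichotomy (f (en (opp d))) p with h' | h' | h'
        · have := H.not_pass (d := opp d) ⟨u, huV⟩ hdE h'
          rw [opp_opp, hdq] at this
          linarith
        · exact h'
        · exact (hbetween _ (H.end_mem (opp d) hdE) h' h).elim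
      have h6 := H.mem_right_of_lt (d := opp d) hdE (by rw [opp_opp, hdq]; exact h)
      rw [h5, hj, Finset.mem_singleton] at h6
      exact hdj (by rw [← h6, opp_opp])
    · have h5 := opp_mem_left hd h
      rcases eq_or_eq_of_card_eq_two (H.left_le q) hd hojL hdj h5 with h6 | h6
      · exact opp_ne d h6
      · have h7 : d = j := by rw [← opp_opp d, h6, opp_opp]
        rw [h7, hjp] at hdq
        exact hpq.ne hdq
  have hL1 : (leftDarts E en f N q).card = 1 :=
    Finset.card_eq_one.2 ⟨opp j, Finset.eq_singleton_iff_unique_mem.2 ⟨hojL, honly⟩⟩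
  rcases H.layer_cases hqV with ⟨hq1, hq3⟩ | ⟨-, hq2, -⟩
  swap
  · omega
  obtain ⟨v, hv⟩ := Finset.card_eq_one.1 hq1
  have inlayq : ∀ {z}, z ∈ V → f z = q → z = v := by
    intro z hz hzp
    have := mem_layer.2 ⟨hz, hzp⟩
    rwa [hv, Finset.mem_singleton] at this
  have hR : (rightDarts E en f N q).card = 2 := by omega
  obtain ⟨a, b, hab, hRab⟩ := Finset.card_eq_two.1 hR
  have hjv : en (opp j) = v := inlayq (H.end_mem (opp j) hjE) rfl
  have hvq : f v = q := by rw [← hjv]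
  have hvV : v ∈ V := by rw [← hjv]; exact H.end_mem (opp j) hjE
  have hr : ∀ t : Bool, (if t then b else a) ∈ rightDarts E en f N q := by
    intro t; rw [hRab]; cases t <;> simp
  refine ⟨⟨fun t ↦ if t then v else u, j.1, false, l, fun t ↦ if t then b else a⟩, ?_, rfl, q, hpq,
    ?_, ?_, hr⟩
  · exact
      { vt_ne := by
          simp only [Bool.false_eq_true, ↓reduceIte]
          intro h
          rw [h, hvq] at huV
          exact hpq.ne' huV.2
        J_mem := hjE
        J_end := ⟨j, rfl, by simp [hju], by simp [hjv]⟩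
        l_mem := lmem
        r_mem := fun t ↦ (mem_rightDarts.1 (hr t)).1
        l_end := fun t ↦ by
          simpa using inlay (H.end_mem _ (lmem t)) (mem_leftDarts.1 (hl t)).2.1
        r_end := fun t ↦ by
          simpa using inlayq (H.end_mem _ (mem_rightDarts.1 (hr t)).1)
            (mem_rightDarts.1 (hr t)).2.1
        r_ne := by simpa using hab
        l_J := by
          intro t h
          rcases eq_or_eq_opp (show (l t).1 = j.1 from h) with h' | h'
          · exact left_ne_right (hl t) hjR h'
          · have := (mem_leftDarts.1 (hl t)).2.1
            rw [h'] at this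
            exact hpq.ne' this
        r_J := by
          intro t h
          rcases eq_or_eq_opp (show (if t then b else a).1 = j.1 from h) with h' | h'
          · have := (mem_rightDarts.1 (hr t)).2.1
            rw [h', hjp] at this
            exact hpq.ne this
          · exact left_ne_right hojL (hr t) h'.symm
        l_r := by
          intro t t' h
          have h5 := (mem_leftDarts.1 (hl t)).2.1
          have h6 := (mem_rightDarts.1 (hr t')).2.1
          simp only at h
          rw [h, h6] at h5
          exact hpq.ne' h5
        all := by
          rintro c hc ⟨t, ht⟩
          have hflat : ∀ {p}, (layer V f p).card = 1 → c ∉ flatDarts E en f N p := by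
            intro p hp hcf
            have := H.flat_card p hp.le
            rw [Finset.card_eq_zero] at this
            simp [this] at hcf
          cases t
          · simp only [Bool.false_eq_true, ↓reduceIte] at ht
            have hcp : f (en c) = p := by rw [ht, huV.2]
            rcases H.mem_some hc with h | h | h <;> rw [hcp] at h
            · rcases lall h with h | h
              · exact Or.inr (Or.inl ⟨_, h⟩)
              · exact Or.inr (Or.inl ⟨_, h⟩)
            · rw [hj, Finset.mem_singleton] at h
              exact Or.inl (by rw [h])
            · exact (hflat h1 h).elim
          · simp only [↓reduceIte] at ht
            have hcp : f (en c) = q := by rw [ht, hvq]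
            rcases H.mem_some hc with h | h | h <;> rw [hcp] at h
            · exact Or.inl (by rw [honly c h]; rfl)
            · rw [hRab] at h
              simp only [Finset.mem_insert, Finset.mem_singleton] at h
              rcases h with h | h
              · exact Or.inr (Or.inr ⟨false, by simp [h]⟩)
              · exact Or.inr (Or.inr ⟨true, by simp [h]⟩)
            · exact (hflat hq1 h).elim }
  · intro z hz hpz hzq
    rcases hpz.lt_or_eq with h | h
    · rcases hzq.lt_or_eq with h' | h'
      · exact (hbetween z hz h h').elim
      · exact ⟨true, by simp [inlayq hz h']⟩
    · exact ⟨false, by simp [inlay hz h.symm]⟩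
  · intro t
    cases t
    · simpa [huV] using hpq.le
    · simpa [hvV, hvq] using hpq.le

lemma exists_block (H : LayeredCubic V E en f N) {p : ℝ} {l : Bool → β × Bool}
    (hl : ∀ t, l t ∈ leftDarts E en f N p) (hne : l false ≠ l true) :
    ∃ B : Block α β, IsBlock E en B ∧ B.l = l ∧ ∃ q, p ≤ q ∧
      (∀ z ∈ V, p ≤ f z → f z ≤ q → ∃ t, B.vt t = z) ∧
      (∀ t, B.vt t ∈ V ∧ p ≤ f (B.vt t) ∧ f (B.vt t) ≤ q) ∧
      (∀ t, B.r t ∈ rightDarts E en f N q) := by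
  have hp : ∃ z ∈ V, f z = p := ⟨_, H.end_mem _ (mem_leftDarts.1 (hl true)).1,
    (mem_leftDarts.1 (hl true)).2.1⟩
  rcases H.layer_cases hp with ⟨h1, h3⟩ | ⟨h2, -, hR, hF⟩
  · obtain ⟨B, hB, hBl, q, hpq, h⟩ := H.exists_block_of_one hl hne h1 h3
    exact ⟨B, hB, hBl, q, hpq.le, h⟩
  · obtain ⟨B, hB, hBl, hv, hr⟩ := H.exists_block_of_two hl hne h2 hR hF
    refine ⟨B, hB, hBl, p, le_rfl, ?_, ?_, hr⟩
    · intro z hz h1 h2'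
      rcases eq_or_eq_of_card_eq_two h2.le (hv false) (hv true) hB.vt_ne
        (mem_layer.2 ⟨hz, le_antisymm h2' h1⟩) with h | h <;> exact ⟨_, h.symm⟩
    · intro t
      have := mem_layer.1 (hv t)
      exact ⟨this.1, this.2.ge, this.2.le⟩

/-- The two strands leaving a level to the right either are the two ends of one edge, and this is
the last level, or both end on the next level. -/
lemma right_cases (H : LayeredCubic V E en f N) {q : ℝ} {r : Bool → β × Bool}
    (hr : ∀ t, r t ∈ rightDarts E en f N q) (hne : r false ≠ r true) :
    ((∀ z ∈ V, f z ≤ q) ∧ opp (r false) = r true) ∨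
    ∃ p, q < p ∧ (∀ z ∈ V, q < f z → p ≤ f z) ∧ ∀ t, opp (r t) ∈ leftDarts E en f N p := by
  classical
  have rmem := fun t ↦ (mem_rightDarts.1 (hr t)).1
  have rq := fun t ↦ (mem_rightDarts.1 (hr t)).2.1
  have rall : ∀ {c}, c ∈ rightDarts E en f N q → c = r false ∨ c = r true := fun hc ↦
    eq_or_eq_of_card_eq_two (H.right_le q) (hr false) (hr true) hne hc
  have hqV : ∃ z ∈ V, f z = q := ⟨_, H.end_mem _ (rmem true), rq true⟩
  by_cases hlast : ∀ z ∈ V, f z ≤ q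
  · left
    refine ⟨hlast, ?_⟩
    have h1 := opp_mem_right (hr false)
      (le_antisymm (hlast _ (H.end_mem _ (rmem false))) (H.right_le_level (hr false)))
    exact (rall h1).resolve_left (opp_ne _)
  · right
    push Not at hlast
    obtain ⟨z₀, hz₀, hqz₀⟩ := hlast
    -- Connectedness supplies an edge across the cut after `q`. Since no edge passes over `q`, it
    -- starts on that level and is one of the two strands.
    obtain ⟨d, hdE, hd1, hd2⟩ := H.cut q true ⟨_, hqV.choose_spec.1, by
      simpa using hqV.choose_spec.2.le⟩ ⟨z₀, hz₀, by simpa using hqz₀⟩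
    simp only [below_true, not_le] at hd1 hd2
    have hdq : f (en d) = q := by
      rcases hd1.lt_or_eq with h | h
      · linarith [H.not_pass hqV hdE h]
      · exact h
    have hdR := H.mem_right_of_lt hdE (by rw [hdq]; exact hd2)
    rw [hdq] at hdR
    -- If the other strand returned to level `q`, its opposite dart would again be a right dart,
    -- hence the crossing strand, whose far end would then be on level `q`.
    have hcross : ∀ t, q < f (en (opp (r t))) := by
      obtain ⟨t₀, ht₀⟩ : ∃ t, d = r t := by
        rcases rall hdR with h | h <;> exact ⟨_, h⟩
      rw [ht₀] at hd2
      intro t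
      by_cases htt : t = t₀
      · rw [htt]; exact hd2
      refine lt_of_le_of_ne (H.right_le_level (hr t)) fun h ↦ ?_
      have h1 := opp_mem_right (hr t) h.symm
      have h2 : opp (r t) = r t ∨ opp (r t) = r t₀ := by
        have := rall h1
        cases t <;> cases t₀ <;> simp at htt <;> tauto
      rcases h2 with h2 | h2
      · exact opp_ne _ h2
      · rw [← h2, opp_opp, rq] at hd2
        exact lt_irrefl _ hd2
    -- Neither strand passes over a vertex beyond `q`, so both end on the lowest level beyond `q`.
    have hmin : ∀ t, ∀ z ∈ V, q < f z → f (en (opp (r t))) ≤ f z := by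
      intro t z hz hqz
      exact H.not_pass ⟨z, hz, rfl⟩ (rmem t) (by rw [rq]; exact hqz)
    have hsame : ∀ t, f (en (opp (r t))) = f (en (opp (r false))) := fun t ↦ le_antisymm
      (hmin t _ (H.end_mem (opp (r false)) (rmem false)) (hcross false))
      (hmin false _ (H.end_mem (opp (r t)) (rmem t)) (hcross t))
    refine ⟨f (en (opp (r false))), hcross false, hmin false, fun t ↦ ?_⟩
    rw [← hsame t]
    exact H.mem_left_of_lt (d := opp (r t)) (rmem t) (by rw [opp_opp, rq]; exact hcross t)

/-- The two darts leaving the first level to the left are the two ends of one edge. -/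
lemma exists_first (H : LayeredCubic V E en f N) (hV : V.Nonempty) :
    ∃ (p : ℝ) (l : Bool → β × Bool), (∀ z ∈ V, p ≤ f z) ∧
      (∀ t, l t ∈ leftDarts E en f N p) ∧ l false ≠ l true ∧ opp (l false) = l true := by
  classical
  obtain ⟨z, hz, hmin⟩ := Finset.exists_min_image V f hV
  have hopp : ∀ {d}, d ∈ leftDarts E en f N (f z) → opp d ∈ leftDarts E en f N (f z) := by
    intro d hd
    exact opp_mem_left hd (le_antisymm (H.left_le_level hd)
      (hmin _ (H.end_mem (opp d) (mem_leftDarts.1 hd).1)))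
  -- Of the at least three darts that leave the level sideways, at most two leave to the right.
  obtain ⟨d, hd⟩ : (leftDarts E en f N (f z)).Nonempty := by
    rw [← Finset.card_pos]
    have := H.right_le (f z)
    have := H.three_le ⟨z, hz, rfl⟩
    omega
  refine ⟨f z, fun t ↦ if t then opp d else d, hmin, ?_, ?_, ?_⟩
  · intro t; cases t <;> simp [hd, hopp hd]
  · simpa using (opp_ne d).symm
  · simp

/-- The part of the graph from some level on is a sequence of junctions. -/
structure IsBlockChain (E : Finset β) (en : β × Bool → α) (k : ℕ) (B : ℕ → Block α β) : Prop where
  block : ∀ i ≤ k, IsBlock E en (B i)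
  next : ∀ i < k, ∀ t, (B (i + 1)).l t = opp ((B i).r t)
  last : opp ((B k).r false) = (B k).r true
  inj : ∀ i ≤ k, ∀ j ≤ k, ∀ t t', (B i).vt t = (B j).vt t' → i = j

/-- Induction on the number of vertices from level `p` on. The junction that begins at `p` is split
off; by `right_cases` its right strands either close up or are the left strands of the rest. -/
lemma exists_chain (H : LayeredCubic V E en f N) (n : ℕ) : ∀ {p : ℝ} {l : Bool → β × Bool},
    (V.filter (fun z ↦ p ≤ f z)).card ≤ n → (∀ t, l t ∈ leftDarts E en f N p) →
    l false ≠ l true → ∃ k B, IsBlockChain E en k B ∧ (B 0).l = l ∧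
      (∀ i ≤ k, ∀ t, (B i).vt t ∈ V ∧ p ≤ f ((B i).vt t)) ∧
      ∀ z ∈ V, p ≤ f z → ∃ i ≤ k, ∃ t, (B i).vt t = z := by
  induction n with
  | zero =>
    intro p l hn hl hne
    exfalso
    have : en (l true) ∈ V.filter (fun z ↦ p ≤ f z) :=
      Finset.mem_filter.2 ⟨H.end_mem _ (mem_leftDarts.1 (hl true)).1,
        (mem_leftDarts.1 (hl true)).2.1.ge⟩
    rw [Nat.le_zero, Finset.card_eq_zero] at hn
    simp [hn] at this
  | succ n ih =>
    intro p l hn hl hne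
    obtain ⟨B, hB, hBl, q, hpq, hcov, hvt, hr⟩ := H.exists_block hl hne
    rcases H.right_cases hr hB.r_ne with ⟨hlast, hopp⟩ | ⟨p', hqp', hmin, hl'⟩
    · refine ⟨0, fun _ ↦ B, ⟨fun _ _ ↦ hB, by simp, hopp, ?_⟩, hBl, ?_, ?_⟩
      · intro i hi j hj _ _ _; omega
      · exact fun i _ t ↦ ⟨(hvt t).1, (hvt t).2.1⟩
      · intro z hz hpz
        exact ⟨0, le_rfl, hcov z hz hpz (hlast z hz)⟩
    · have hlt : (V.filter (fun z ↦ p' ≤ f z)).card < (V.filter (fun z ↦ p ≤ f z)).card := by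
        refine Finset.card_lt_card (Finset.ssubset_iff_of_subset ?_ |>.2 ⟨B.vt true, ?_, ?_⟩)
        · intro z hz
          rw [Finset.mem_filter] at hz ⊢
          exact ⟨hz.1, by linarith [hz.2]⟩
        · exact Finset.mem_filter.2 ⟨(hvt true).1, (hvt true).2.1⟩
        · rw [Finset.mem_filter]
          intro h
          linarith [h.2, (hvt true).2.2]
      obtain ⟨k, C, hC, hCl, hCv, hCcov⟩ := ih (p := p') (l := fun t ↦ opp (B.r t)) (by omega) hl'
        (fun h ↦ hB.r_ne (by rw [← opp_opp (B.r false), h, opp_opp]))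
      refine ⟨k + 1, fun i ↦ Nat.casesOn i B C, ⟨?_, ?_, hC.last, ?_⟩, hBl, ?_, ?_⟩
      · rintro (_ | i) hi
        · exact hB
        · exact hC.block i (by omega)
      · rintro (_ | i) hi t
        · exact congrFun hCl t
        · exact hC.next i (by omega) t
      · have hsep : ∀ i ≤ k, ∀ t t', B.vt t ≠ (C i).vt t' := by
          intro i hi t t' h
          have h1 := (hvt t).2.2
          have h2 := (hCv i hi t').2
          rw [h] at h1
          linarith
        rintro (_ | i) hi (_ | j) hj t t' h
        · rfl
        · exact (hsep j (by omega) t t' h).elim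
        · exact (hsep i (by omega) t' t h.symm).elim
        · rw [hC.inj i (by omega) j (by omega) t t' h]
      · rintro (_ | i) hi t
        · exact ⟨(hvt t).1, (hvt t).2.1⟩
        · have := hCv i (by omega) t
          exact ⟨this.1, by linarith [this.2]⟩
      · intro z hz hpz
        rcases le_or_gt (f z) q with h | h
        · exact ⟨0, by omega, hcov z hz hpz h⟩
        · obtain ⟨i, hi, t, ht⟩ := hCcov z hz (hmin z hz h)
          exact ⟨i + 1, by omega, t, ht⟩

end LayeredCubic
end Blocks
end NodalCurve

namespace NodalCurve

/-! ### Identification of a sequence of junctions with a chain -/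

section Recognition

variable {α β : Type*}

/-- A bijective relabelling of the edges and vertices of a chain gives a chain. -/
lemma isChain_of_labelling {K : Graph α β} {k : ℕ} (s : Fin (k + 1) → Bool)
    (F : Fin (k + 1) × Bool → α) (Ψ : ChainEdge k → β) (hF : Function.Injective F)
    (hΨ : Function.Injective Ψ) (hFr : ∀ z, z ∈ V(K) ↔ ∃ x, F x = z)
    (hΨr : ∀ e ∈ E(K), ∃ c, Ψ c = e)
    (hlink : ∀ c, ∃ x y, chainEnds s c = s(x, y) ∧ K.IsLink (Ψ c) (F x) (F y)) :
    IsChain K := by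
  have hΨm : ∀ c, Ψ c ∈ E(K) := fun c ↦ by
    obtain ⟨x, y, -, h⟩ := hlink c
    exact h.edge_mem
  have hcE : ∀ c : ChainEdge k, c ∈ E(chainGraph s) := fun c ↦ by
    obtain ⟨x, y, h, -⟩ := hlink c
    exact Graph.IsLink.edge_mem (show (chainGraph s).IsLink c x y from h)
  let φ : V(chainGraph s) ≃ V(K) := Equiv.ofBijective (fun x ↦ ⟨F x.1, (hFr _).2 ⟨_, rfl⟩⟩)
    ⟨fun x y h ↦ Subtype.ext (hF (congrArg Subtype.val h)), fun z ↦ by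
      obtain ⟨x, hx⟩ := (hFr z.1).1 z.2
      exact ⟨⟨x, Set.mem_univ x⟩, Subtype.ext hx⟩⟩
  let ψ : E(chainGraph s) ≃ E(K) := Equiv.ofBijective (fun c ↦ ⟨Ψ c.1, hΨm _⟩)
    ⟨fun x y h ↦ Subtype.ext (hΨ (congrArg Subtype.val h)), fun e ↦ by
      obtain ⟨c, hc⟩ := hΨr e.1 e.2
      exact ⟨⟨c, hcE c⟩, Subtype.ext hc⟩⟩
  refine ⟨k, s, φ.symm, ψ.symm, ?_⟩
  have main : ∀ (c : E(chainGraph s)) (x y : V(chainGraph s)),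
      K.IsLink (ψ c : β) (φ x : α) (φ y : α) ↔ (chainGraph s).IsLink c.1 x.1 y.1 := by
    rintro ⟨c, hc⟩ ⟨x, hx⟩ ⟨y, hy⟩
    obtain ⟨x', y', he, hl⟩ := hlink c
    change K.IsLink (Ψ c) (F x) (F y) ↔ chainEnds s c = s(x, y)
    rw [hl.isLink_iff, he, Sym2.eq_iff]
    simp [hF.eq_iff]
  intro e x y
  have := main (ψ.symm e) (φ.symm x) (φ.symm y)
  simpa using this

namespace LayeredCubic

variable {V : Finset α} {E : Finset β} {en : β × Bool → α} {f : α → ℝ} {N : β → ℝ → Bool → ℕ}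

/-- A layered trivalent graph is a chain. -/
theorem isChain (H : LayeredCubic V E en f N) (hV : V.Nonempty) {K : Graph α β}
    (hVK : ∀ z, z ∈ V(K) ↔ z ∈ V) (hEK : ∀ e, e ∈ E(K) ↔ e ∈ E)
    (hen : ∀ d : β × Bool, d.1 ∈ E → K.IsLink d.1 (en d) (en (opp d))) : IsChain K := by
  obtain ⟨p, l, hp, hl, hne, hopp⟩ := H.exists_first hV
  obtain ⟨k, B, hB, hl0, hBV, hcov⟩ := H.exists_chain _ le_rfl hl hne
  subst hl0
  have hblk := fun i : Fin (k + 1) ↦ hB.block i (by omega)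
  set s : Fin (k + 1) → Bool := fun i ↦ (B i).s with hs
  set F : Fin (k + 1) × Bool → α := fun x ↦ (B x.1).vt x.2 with hFdef
  set Ψ : ChainEdge k → β := fun c ↦ match c with
    | .junction i => (B i).J
    | .mid i t => ((B i).r t).1
    | .first => ((B 0).l false).1
    | .last => ((B k).r false).1 with hΨdef
  have hF : Function.Injective F := by
    rintro ⟨i, t⟩ ⟨j, t'⟩ h
    have hij : i = j := Fin.ext (hB.inj i (by omega) j (by omega) t t' h)
    subst hij
    have hne := (hblk i).vt_ne
    cases t <;> cases t' <;> simp_all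
  have r_end : ∀ (i : Fin (k + 1)) t, en ((B i).r t) = F (chainAfter s i t) :=
    fun i t ↦ (hblk i).r_end t
  have l_end : ∀ (i : Fin (k + 1)) t, en ((B i).l t) = F (chainBefore s i t) :=
    fun i t ↦ (hblk i).l_end t
  have hnext : ∀ (i : Fin k) t, opp ((B i).r t) = (B (i + 1)).l t :=
    fun i t ↦ (hB.next i (by omega) t).symm
  have linkJ : ∀ i : Fin (k + 1), K.IsLink (B i).J (F (i, false)) (F (i, true)) := by
    intro i
    obtain ⟨d, hd, h1, h2⟩ := (hblk i).J_end
    have := hen d (hd ▸ (hblk i).J_mem)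
    rw [hd, h1, h2] at this
    exact this
  have linkM : ∀ (i : Fin k) t, K.IsLink ((B i).r t).1 (F (chainAfter s i.castSucc t))
      (F (chainBefore s i.succ t)) := by
    intro i t
    have h0 : ((B i).r t).1 ∈ E := (hblk i.castSucc).r_mem t
    have h1 : en ((B i).r t) = F (chainAfter s i.castSucc t) := r_end i.castSucc t
    have h2 : en ((B (i + 1)).l t) = F (chainBefore s i.succ t) := l_end i.succ t
    rw [← h1, ← h2, ← hnext]
    exact hen _ h0
  have linkF : K.IsLink ((B 0).l false).1 (F (chainBefore s 0 false))
      (F (chainBefore s 0 true)) := by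
    have h0 : ((B 0).l false).1 ∈ E := (hblk 0).l_mem false
    have h1 : ∀ t, en ((B 0).l t) = F (chainBefore s 0 t) := l_end 0
    rw [← h1, ← h1, ← hopp]
    exact hen _ h0
  have linkL : K.IsLink ((B k).r false).1 (F (chainAfter s (Fin.last k) false))
      (F (chainAfter s (Fin.last k) true)) := by
    have h0 : ((B k).r false).1 ∈ E := (hblk (Fin.last k)).r_mem false
    have h1 : ∀ t, en ((B k).r t) = F (chainAfter s (Fin.last k) t) := r_end (Fin.last k)
    rw [← h1, ← h1, ← hB.last]
    exact hen _ h0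
  have hlink : ∀ c, ∃ x y, chainEnds s c = s(x, y) ∧ K.IsLink (Ψ c) (F x) (F y) := by
    rintro (i | ⟨i, t⟩ | _ | _)
    · exact ⟨_, _, rfl, linkJ i⟩
    · exact ⟨_, _, rfl, linkM i t⟩
    · exact ⟨_, _, rfl, linkF⟩
    · exact ⟨_, _, rfl, linkL⟩
  refine isChain_of_labelling s F Ψ hF ?_ ?_ ?_ hlink
  -- Edges with the same image have the same ends, as `F` is injective. Only edges of the chain that
  -- are parallel remain to be separated, which is done locally by `n1` to `n4`.
  · intro c c' h
    have hends : chainEnds s c = chainEnds s c' := by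
      obtain ⟨x, y, h1, h2⟩ := hlink c
      obtain ⟨x', y', h3, h4⟩ := hlink c'
      rw [h] at h2
      rw [h1, h3, Sym2.eq_iff]
      simpa [hF.eq_iff] using h2.eq_and_eq_or_eq_and_eq h4
    -- edges at one junction
    have n1 : ∀ i, ((B 0).l false).1 ≠ (B (i : Fin (k + 1))).J ∨ i ≠ 0 := by
      intro i
      by_cases hi : i = 0
      · subst hi; exact Or.inl ((hblk 0).l_J false)
      · exact Or.inr hi
    have n2 : ∀ i, ((B k).r false).1 ≠ (B (i : Fin (k + 1))).J ∨ i ≠ Fin.last k := by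
      intro i
      by_cases hi : i = Fin.last k
      · subst hi; exact Or.inl ((hblk (Fin.last k)).r_J false)
      · exact Or.inr hi
    -- If the two strands were the two ends of one edge, a vertex of junction `i` would be a vertex
    -- of junction `i + 1`.
    have n3 : ∀ i : Fin k, ((B i).r false).1 ≠ ((B i).r true).1 := by
      intro i h0
      have hr := (hblk i.castSucc).r_ne
      rcases eq_or_eq_opp h0 with h1 | h1
      · exact hr h1
      · have h2 : en ((B i).r false) = F (chainBefore s i.succ true) := by
          rw [h1, hnext]; exact l_end i.succ true
        have h3 := r_end i.castSucc false
        have h4 := hF (h3.symm.trans h2)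
        have h5 := congrArg Prod.fst h4
        simp only [chainAfter, chainBefore] at h5
        exact absurd h5 i.castSucc_lt_succ.ne
    have n4 : ((B 0).l false).1 ≠ ((B k).r false).1 ∨ k ≠ 0 := by
      by_cases hk : k = 0
      · subst hk
        left
        intro h0
        rcases eq_or_eq_opp h0.symm with h1 | h1
        · exact (hblk 0).l_r _ _ h1.symm
        · rw [hopp] at h1
          exact (hblk 0).l_r _ _ h1.symm
      · exact Or.inr hk
    have cs : ∀ i : Fin k, i.castSucc ≠ i.succ := fun i ↦ i.castSucc_lt_succ.ne
    rcases c with i | ⟨i, t⟩ | _ | _ <;> rcases c' with j | ⟨j, t'⟩ | _ | _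
    · simp only [chainEnds, Sym2.eq_iff, Prod.mk.injEq] at hends
      simp only [and_true, and_false, or_false, Bool.false_eq_true,
        Bool.true_eq_false] at hends
      rw [hends.1]
    · simp only [chainEnds, chainAfter, chainBefore, Sym2.eq_iff, Prod.mk.injEq] at hends
      rcases hends with ⟨⟨h1, -⟩, h2, -⟩ | ⟨⟨h1, -⟩, h2, -⟩
      · exact (cs j (h1.symm.trans h2)).elim
      · exact (cs j (h2.symm.trans h1)).elim
    · simp only [chainEnds, chainBefore, Sym2.eq_iff, Prod.mk.injEq] at hends
      have hi : i = 0 := by rcases hends with ⟨⟨h1, -⟩, -⟩ | ⟨⟨h1, -⟩, -⟩ <;> exact h1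
      rcases n1 i with h1 | h1
      · exact (h1 h.symm).elim
      · exact (h1 hi).elim
    · simp only [chainEnds, chainAfter, Sym2.eq_iff, Prod.mk.injEq] at hends
      have hi : i = Fin.last k := by rcases hends with ⟨⟨h1, -⟩, -⟩ | ⟨⟨h1, -⟩, -⟩ <;> exact h1
      rcases n2 i with h1 | h1
      · exact (h1 h.symm).elim
      · exact (h1 hi).elim
    · simp only [chainEnds, chainAfter, chainBefore, Sym2.eq_iff, Prod.mk.injEq] at hends
      rcases hends with ⟨⟨h1, -⟩, h2, -⟩ | ⟨⟨h1, -⟩, h2, -⟩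
      · exact (cs i (h1.trans h2.symm)).elim
      · exact (cs i (h1.trans h2.symm)).elim
    · simp only [chainEnds, chainAfter, chainBefore, Sym2.eq_iff, Prod.mk.injEq] at hends
      have hij : i = j := by
        rcases hends with ⟨⟨h1, -⟩, h2, -⟩ | ⟨⟨h1, -⟩, h2, -⟩
        · exact Fin.castSucc_injective k h1
        · have h1' := congrArg Fin.val h1
          have h2' := congrArg Fin.val h2
          simp only [Fin.val_castSucc, Fin.val_succ] at h1' h2'
          omega
      subst hij
      have := n3 i
      cases t <;> cases t' <;> first | rfl | exact (this h).elim | exact (this h.symm).elim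
    · simp only [chainEnds, chainAfter, chainBefore, Sym2.eq_iff, Prod.mk.injEq] at hends
      rcases hends with ⟨⟨h1, -⟩, h2, -⟩ | ⟨⟨h1, -⟩, h2, -⟩ <;>
        exact (cs i (h1.trans h2.symm)).elim
    · simp only [chainEnds, chainAfter, chainBefore, Sym2.eq_iff, Prod.mk.injEq] at hends
      rcases hends with ⟨⟨h1, -⟩, h2, -⟩ | ⟨⟨h1, -⟩, h2, -⟩ <;>
        exact (cs i (h1.trans h2.symm)).elim
    · simp only [chainEnds, chainBefore, Sym2.eq_iff, Prod.mk.injEq] at hends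
      have hi : j = 0 := by rcases hends with ⟨⟨h1, -⟩, -⟩ | ⟨⟨h1, -⟩, h2, -⟩ <;> simp_all
      rcases n1 j with h1 | h1
      · exact (h1 h).elim
      · exact (h1 hi).elim
    · simp only [chainEnds, chainAfter, chainBefore, Sym2.eq_iff, Prod.mk.injEq] at hends
      rcases hends with ⟨⟨h1, -⟩, h2, -⟩ | ⟨⟨h1, -⟩, h2, -⟩
      · exact (cs j (h1.symm.trans h2)).elim
      · exact (cs j (h2.symm.trans h1)).elim
    · rfl
    · simp only [chainEnds, chainAfter, chainBefore, Sym2.eq_iff, Prod.mk.injEq] at hends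
      have hk : (0 : Fin (k + 1)) = Fin.last k := by
        rcases hends with ⟨⟨h1, -⟩, -⟩ | ⟨⟨h1, -⟩, -⟩ <;> exact h1
      rcases n4 with h1 | h1
      · exact (h1 h).elim
      · exact (h1 (congrArg Fin.val hk).symm).elim
    · simp only [chainEnds, chainAfter, Sym2.eq_iff, Prod.mk.injEq] at hends
      have hi : j = Fin.last k := by
        rcases hends with ⟨⟨h1, -⟩, -⟩ | ⟨⟨h1, -⟩, h2, -⟩ <;> exact Eq.symm (by assumption)
      rcases n2 j with h1 | h1
      · exact (h1 h).elim
      · exact (h1 hi).elim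
    · simp only [chainEnds, chainAfter, chainBefore, Sym2.eq_iff, Prod.mk.injEq] at hends
      rcases hends with ⟨⟨h1, -⟩, h2, -⟩ | ⟨⟨h1, -⟩, h2, -⟩
      · exact (cs j (h1.symm.trans h2)).elim
      · exact (cs j (h2.symm.trans h1)).elim
    · simp only [chainEnds, chainAfter, chainBefore, Sym2.eq_iff, Prod.mk.injEq] at hends
      have hk : (0 : Fin (k + 1)) = Fin.last k := by
        rcases hends with ⟨⟨h1, -⟩, -⟩ | ⟨⟨h1, -⟩, -⟩ <;> exact h1.symm
      rcases n4 with h1 | h1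
      · exact (h1 h.symm).elim
      · exact (h1 (congrArg Fin.val hk).symm).elim
    · rfl
  · intro z
    rw [hVK]
    constructor
    · intro hz
      obtain ⟨i, hi, t, ht⟩ := hcov z hz (hp z hz)
      exact ⟨(⟨i, by omega⟩, t), ht⟩
    · rintro ⟨⟨i, t⟩, rfl⟩
      exact (hBV i (by omega) t).1
  · intro e he
    rw [hEK] at he
    obtain ⟨i, hi, t, ht⟩ := hcov _ (H.end_mem (e, false) he) (hp _ (H.end_mem (e, false) he))
    have hr : ∀ i ≤ k, ∀ t, ∃ c, Ψ c = ((B i).r t).1 := by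
      intro i hi t
      rcases hi.lt_or_eq with h | rfl
      · exact ⟨.mid ⟨i, h⟩ t, rfl⟩
      · refine ⟨.last, ?_⟩
        cases t
        · rfl
        · change ((B i).r false).1 = _
          rw [← hB.last, opp_fst]
    -- A left strand at a later junction is a right strand of the preceding one, and the two left
    -- strands at the first junction belong to one edge.
    rcases (hB.block i hi).all (e, false) he ⟨t, ht.symm⟩ with h | ⟨t', h⟩ | ⟨t', h⟩
    · exact ⟨.junction ⟨i, by omega⟩, h.symm⟩
    · rcases i with _ | i
      · refine ⟨.first, ?_⟩
        cases t'
        · exact (congrArg Prod.fst h).symm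
        · change ((B 0).l false).1 = _
          rw [← opp_fst, hopp]
          exact (congrArg Prod.fst h).symm
      · obtain ⟨c, hc⟩ := hr i (by omega) t'
        refine ⟨c, hc.trans ?_⟩
        rw [← opp_fst, ← hB.next i (by omega)]
        exact (congrArg Prod.fst h).symm
    · obtain ⟨c, hc⟩ := hr i hi t'
      exact ⟨c, hc.trans (congrArg Prod.fst h).symm⟩

end LayeredCubic
end Recognition
end NodalCurve

namespace NodalCurve

/-! ### Invariants under leaf removal and smoothing, and the shape of the skeleton -/

section Invariants

variable {α β : Type*}

/-- `N` records how often the edges of `G`, which are thought of as curves, cover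
each cut of the line by a level function `f`. -/
structure Covering (G : Graph α β) (f : α → ℝ) (N : β → ℝ → Bool → ℕ) : Prop where
  parity : ∀ e x y, G.IsLink e x y → ∀ p b,
    (Odd (N e p b) ↔ ¬ (Below f p b x ↔ Below f p b y))
  sum_le : ∀ p b (s : Finset β), ↑s ⊆ E(G) → ∑ e ∈ s, N e p b ≤ 2
  adjacent : ∀ e x y, G.IsLink e x y →
    Flat N e ∨ N e (f x) false ≠ 0 ∨ N e (f x) true ≠ 0
  flat_unique : ∀ e e' x y x' y', G.IsLink e x y → G.IsLink e' x' y' → Flat N e → Flat N e' →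
    f x = f x' → e = e'
  flat_ne : ∀ e x, G.IsLink e x x → ¬ Flat N e

open Classical in
/-- The number of ends of `e` at `z`. -/
noncomputable def incidence (G : Graph α β) (e : β) (z : α) : ℕ :=
  if G.IsLoopAt e z then 2 else if G.Inc e z then 1 else 0

lemma incidence_of_isLoopAt {G : Graph α β} {e : β} {z : α} (h : G.IsLoopAt e z) :
    incidence G e z = 2 := if_pos h

lemma incidence_of_inc {G : Graph α β} {e : β} {z : α} (h : G.Inc e z) (h' : ¬ G.IsLoopAt e z) :
    incidence G e z = 1 := by rw [incidence, if_neg h', if_pos h]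

lemma incidence_of_not_inc {G : Graph α β} {e : β} {z : α} (h : ¬ G.Inc e z) :
    incidence G e z = 0 := by rw [incidence, if_neg fun h' ↦ h h'.inc, if_neg h]

lemma one_le_incidence {G : Graph α β} {e : β} {z : α} (h : G.Inc e z) :
    1 ≤ incidence G e z := by
  by_cases h' : G.IsLoopAt e z
  · rw [incidence_of_isLoopAt h']; omega
  · rw [incidence_of_inc h h']

/-- On a path from `B` through `A` to `C`, a cut separates the ends exactly when it separates one of
the two steps and not the other. -/
lemma not_iff_xor_aux (A B C : Prop) :
    (¬ (A ↔ B) ↔ ¬ ¬ (A ↔ C)) ↔ ¬ (B ↔ C) := by tauto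

/-- The properties of the bounded part of the curve that are inherited by its skeleton. -/
structure Tame (G : Graph α β) (f : α → ℝ) : Prop where
  finV : V(G).Finite
  finE : E(G).Finite
  card : V(G).ncard + 1 ≤ E(G).ncard
  deg : ∀ z, ∀ s : Finset β, ↑s ⊆ E(G) → ∑ e ∈ s, incidence G e z ≤ 3
  covering : ∃ N, Covering G f N

/-- `f` is merged into `e`. A set that contains `e` and not `f` is compared with the old set
enlarged by `f`. This serves both for degrees and for covering numbers. -/
lemma sum_merge_le {n n' : β → ℕ} {e f : β} {A : Set β} {m : ℕ} (hf : f ∈ A)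
    (hn : ∀ g, g ≠ e → g ≠ f → n' g ≤ n g) (hne : n' e ≤ n e + n f)
    (hA : ∀ s : Finset β, ↑s ⊆ A → ∑ g ∈ s, n g ≤ m) {s : Finset β} (hs : ↑s ⊆ A)
    (hfs : f ∉ s) : ∑ g ∈ s, n' g ≤ m := by
  classical
  by_cases he : e ∈ s
  · refine le_trans ?_ (hA (insert f s) (by
      rw [Finset.coe_insert]; exact Set.insert_subset hf hs))
    rw [Finset.sum_insert hfs, ← Finset.add_sum_erase _ _ he, ← Finset.add_sum_erase _ n he]
    have : ∑ g ∈ s.erase e, n' g ≤ ∑ g ∈ s.erase e, n g := Finset.sum_le_sum fun g hg ↦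
      hn g (Finset.ne_of_mem_erase hg) fun h ↦ hfs (h ▸ Finset.mem_of_mem_erase hg)
    omega
  · exact (Finset.sum_le_sum fun g hg ↦ hn g (fun h ↦ he (h ▸ hg)) fun h ↦ hfs (h ▸ hg)).trans
      (hA s hs)

/-- Vertices and edges decrease by one each; the other properties pass to subgraphs. -/
lemma Tame.of_leafRemoval {G H : Graph α β} {f : α → ℝ} (hG : Tame G f) (h : LeafRemoval G H) :
    Tame H f := by
  classical
  obtain ⟨v, ⟨e, he, hv⟩, rfl⟩ := h
  have hlink : ∀ {g x y}, (G.deleteVerts {v}).IsLink g x y → G.IsLink g x y := fun h ↦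
    ((Graph.deleteVerts_isLink G {v}).1 h).1
  have hE : E(G.deleteVerts {v}) = E(G) \ {e} := by
    ext g
    rw [Graph.edgeSet_deleteVerts]
    constructor
    · rintro ⟨x, y, hg, hx, hy⟩
      refine ⟨hg.edge_mem, ?_⟩
      rintro rfl
      rcases (he.inc).eq_or_eq_of_isLink hg with h | h
      · exact hx h.symm
      · exact hy h.symm
    · rintro ⟨hg, hge⟩
      obtain ⟨x, y, hxy⟩ := Graph.exists_isLink_of_mem_edgeSet hg
      refine ⟨x, y, hxy, ?_, ?_⟩
      · rintro rfl; exact hge (hv g hxy.inc_left)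
      · rintro rfl; exact hge (hv g hxy.inc_right)
  have hEsub : E(G.deleteVerts {v}) ⊆ E(G) := by rw [hE]; exact Set.sdiff_subset
  obtain ⟨N, hN⟩ := hG.covering
  refine ⟨?_, hG.finE.subset hEsub, ?_, ?_, N, ?_⟩
  · rw [Graph.vertexSet_deleteVerts]; exact hG.finV.subset Set.sdiff_subset
  · rw [hE, Graph.vertexSet_deleteVerts]
    have h1 := Set.ncard_sdiff_singleton_add_one he.edge_mem hG.finE
    have h2 := Set.ncard_sdiff_singleton_add_one he.vertex_mem hG.finV
    have := hG.card
    omega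
  · intro z s hs
    refine (Finset.sum_le_sum fun g hg ↦ ?_).trans (hG.deg z s (hs.trans hEsub))
    by_cases h1 : (G.deleteVerts {v}).IsLoopAt g z
    · rw [incidence_of_isLoopAt h1, incidence_of_isLoopAt (hlink h1)]
    · by_cases h2 : (G.deleteVerts {v}).Inc g z
      · rw [incidence_of_inc h2 h1]
        exact one_le_incidence ⟨_, hlink h2.choose_spec⟩
      · rw [incidence_of_not_inc h2]
        exact Nat.zero_le _
  · exact
      { parity := fun e x y h ↦ hN.parity e x y (hlink h)
        sum_le := fun p b s hs ↦ hN.sum_le p b s (hs.trans hEsub)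
        adjacent := fun e x y h ↦ hN.adjacent e x y (hlink h)
        flat_unique := fun e e' x y x' y' h h' ↦ hN.flat_unique e e' x y x' y' (hlink h) (hlink h')
        flat_ne := fun e x h ↦ hN.flat_ne e x (hlink h) }

lemma Smoothing.edgeSet_eq {G H : Graph α β} {v x y : α} {e f : β}
    (hef : e ≠ f) (hex : G.IsLink e v x) (hH : H.IsLink e x y)
    (hg : ∀ g, g ≠ e → ∀ a b, H.IsLink g a b ↔ g ≠ f ∧ G.IsLink g a b) :
    E(H) = E(G) \ {f} := by
  ext g
  by_cases h : g = e
  · subst h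
    exact ⟨fun _ ↦ ⟨hex.edge_mem, hef⟩, fun _ ↦ hH.edge_mem⟩
  constructor
  · intro hgH
    obtain ⟨a, b, hab⟩ := Graph.exists_isLink_of_mem_edgeSet hgH
    have := (hg g h a b).1 hab
    exact ⟨this.2.edge_mem, this.1⟩
  · rintro ⟨hgG, hgf⟩
    obtain ⟨a, b, hab⟩ := Graph.exists_isLink_of_mem_edgeSet hgG
    exact ((hg g h a b).2 ⟨hgf, hab⟩).edge_mem

/-- The merged edge covers each cut as often as its two parts together, so parities add up. It is
never flat, because two flat edges at `v` would coincide; the conditions on flat edges therefore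
only concern old edges. -/
lemma Tame.of_smoothing {G H : Graph α β} {φ : α → ℝ} (hG : Tame G φ) (h : Smoothing G H) :
    Tame H φ := by
  classical
  obtain ⟨v, e, f, x, y, ⟨hef, hev, hfv, -⟩, hex, hfy, hV, hH, hg⟩ := h
  have hE := Smoothing.edgeSet_eq hef hex hH hg
  have hEsub : E(H) ⊆ E(G) := by rw [hE]; exact Set.sdiff_subset
  have hfH : ∀ {s : Finset β}, ↑s ⊆ E(H) → f ∉ s := fun hs hfs ↦ by
    have := hs hfs
    rw [hE] at this
    exact this.2 rfl
  obtain ⟨N, hN⟩ := hG.covering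
  have hcases : ∀ {g a b}, H.IsLink g a b → (g = e ∧ (a = x ∧ b = y ∨ a = y ∧ b = x)) ∨
      (g ≠ e ∧ g ≠ f ∧ G.IsLink g a b) := by
    intro g a b hab
    by_cases h : g = e
    · subst h
      exact Or.inl ⟨rfl, hab.eq_and_eq_or_eq_and_eq hH⟩
    · exact Or.inr ⟨h, (hg g h a b).1 hab⟩
  set N' : β → ℝ → Bool → ℕ := fun g p b ↦ if g = e then N e p b + N f p b else N g p b with hN'
  have hN'e : ∀ p b, N' e p b = N e p b + N f p b := fun p b ↦ by simp [hN']
  have hN'g : ∀ {g}, g ≠ e → N' g = N g := fun h ↦ by funext p b; simp [hN', h]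
  have flat_e : ¬ Flat N' e := by
    intro h
    have h1 : Flat N e := fun p b ↦ by have := h p b; rw [hN'e] at this; omega
    have h2 : Flat N f := fun p b ↦ by have := h p b; rw [hN'e] at this; omega
    exact hef (hN.flat_unique e f v x v y hex hfy h1 h2 rfl)
  have flat_g : ∀ {g}, g ≠ e → Flat N' g → Flat N g := fun h h' ↦ by
    rw [Flat, hN'g h] at h'; exact h'
  -- an edge from `v` to `a` covers a side of `a`, or it is flat and the other edge does
  have adj : ∀ {g g' a b}, G.IsLink g v a → G.IsLink g' v b → ¬ (Flat N g ∧ Flat N g') →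
      N g (φ a) false + N g' (φ a) false ≠ 0 ∨ N g (φ a) true + N g' (φ a) true ≠ 0 := by
    intro g g' a b h h' hnot
    rcases hN.adjacent g a v h.symm with h1 | h1 | h1
    · have hlev : φ v = φ a := by
        have p1 := hN.parity g v a h (φ v) true
        have p2 := hN.parity g v a h (φ a) true
        simp only [h1 _ _, below_true, le_refl, true_iff, iff_true] at p1 p2
        have h3 : ¬ Odd 0 := by decide
        exact le_antisymm (not_not.1 (fun h ↦ h3 (p2.2 h))) (not_not.1 (fun h ↦ h3 (p1.2 h)))
      rcases hN.adjacent g' v b h' with h2 | h2 | h2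
      · exact (hnot ⟨h1, h2⟩).elim
      · left; rw [← hlev]; omega
      · right; rw [← hlev]; omega
    · left; omega
    · right; omega
  have notboth : ¬ (Flat N e ∧ Flat N f) := fun h ↦
    hef (hN.flat_unique e f v x v y hex hfy h.1 h.2 rfl)
  refine ⟨?_, hG.finE.subset hEsub, ?_, ?_, N', ?_⟩
  · rw [hV]; exact hG.finV.subset Set.sdiff_subset
  · rw [hE, hV]
    have h1 := Set.ncard_sdiff_singleton_add_one hfy.edge_mem hG.finE
    have h2 := Set.ncard_sdiff_singleton_add_one hfy.left_mem hG.finV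
    have := hG.card
    omega
  · intro z s hs
    refine sum_merge_le (n := fun g ↦ incidence G g z) (e := e) hfy.edge_mem ?_ ?_ (hG.deg z)
      (hs.trans hEsub) (hfH hs)
    · intro g hge hgf
      have : ∀ a b, H.IsLink g a b ↔ G.IsLink g a b := fun a b ↦ by rw [hg g hge]; simp [hgf]
      simp only [incidence, Graph.IsLoopAt, Graph.Inc, this]
      exact le_rfl
    · by_cases h1 : H.IsLoopAt e z
      · obtain ⟨hzx, hzy⟩ : z = x ∧ z = y := by
          rcases hcases h1 with ⟨-, h⟩ | h
          · tauto
          · exact absurd rfl h.1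
        have h2 := one_le_incidence (hzx ▸ hex.inc_right : G.Inc e z)
        have h3 := one_le_incidence (hzy ▸ hfy.inc_right : G.Inc f z)
        rw [incidence_of_isLoopAt h1]
        omega
      · by_cases h2 : H.Inc e z
        · rw [incidence_of_inc h2 h1]
          rcases h2.eq_or_eq_of_isLink hH with h | h
          · have := one_le_incidence (h ▸ hex.inc_right : G.Inc e z); omega
          · have := one_le_incidence (h ▸ hfy.inc_right : G.Inc f z); omega
        · rw [incidence_of_not_inc h2]
          exact Nat.zero_le _
  · refine ⟨?_, ?_, ?_, ?_, ?_⟩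
    · intro g a b hab p c
      rcases hcases hab with ⟨rfl, h⟩ | ⟨h, -, h'⟩
      · have p1 := hN.parity g v x hex p c
        have p2 := hN.parity f v y hfy p c
        rw [hN'e, Nat.odd_add, ← Nat.not_odd_iff_even, p1, p2, not_iff_xor_aux]
        rcases h with ⟨rfl, rfl⟩ | ⟨rfl, rfl⟩
        · exact Iff.rfl
        · rw [iff_comm (a := Below φ p c b)]
      · rw [hN'g h]; exact hN.parity g a b h' p c
    · intro p b s hs
      refine sum_merge_le (n := fun g ↦ N g p b) (e := e) hfy.edge_mem ?_ ?_ (hN.sum_le p b)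
        (hs.trans hEsub) (hfH hs)
      · intro g h _; rw [hN'g h]
      · rw [hN'e]
    · intro g a b hab
      rcases hcases hab with ⟨rfl, h⟩ | ⟨h, -, h'⟩
      · right
        rcases h with ⟨rfl, rfl⟩ | ⟨rfl, rfl⟩
        · rw [hN'e, hN'e]; exact adj hex hfy notboth
        · rw [hN'e, hN'e, add_comm, add_comm (N g _ true)]
          exact adj hfy hex (fun h ↦ notboth h.symm)
      · rw [Flat, hN'g h]; exact hN.adjacent g a b h'
    · intro g g' a b a' b' h h' hf hf' hlev
      rcases hcases h with ⟨rfl, -⟩ | ⟨h1, -, h2⟩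
      · exact (flat_e hf).elim
      rcases hcases h' with ⟨rfl, -⟩ | ⟨h1', -, h2'⟩
      · exact (flat_e hf').elim
      exact hN.flat_unique g g' a b a' b' h2 h2' (flat_g h1 hf) (flat_g h1' hf') hlev
    · intro g a h hf
      rcases hcases h with ⟨rfl, -⟩ | ⟨h1, -, h2⟩
      · exact flat_e hf
      · exact hN.flat_ne g a h2 (flat_g h1 hf)

/-- Smoothing does not create vertices of degree one. -/
lemma not_isLeaf_of_smoothing {G H : Graph α β} (hG : ∀ v, ¬ IsLeaf G v) (h : Smoothing G H) :
    ∀ v, ¬ IsLeaf H v := by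
  obtain ⟨v, e, f, x, y, ⟨hef, hev, hfv, hall⟩, hex, hfy, hV, hH, hg⟩ := h
  rintro z ⟨g, ⟨w, hwz, hzw⟩, hz⟩
  have hxv : x ≠ v := by
    rintro rfl
    exact hev.not_isLoopAt _ hex
  have hyv : y ≠ v := by
    rintro rfl
    exact hfv.not_isLoopAt _ hfy
  have other : ∀ {g' a}, g' ≠ e → g' ≠ f → G.Inc g' a → H.Inc g' a := by
    rintro g' a h1 h2 ⟨b, hb⟩
    exact ⟨b, (hg g' h1 a b).2 ⟨h2, hb⟩⟩
  by_cases hge : g = e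
  · subst hge
    rcases hzw.eq_and_eq_or_eq_and_eq hH with ⟨rfl, rfl⟩ | ⟨rfl, rfl⟩
    · refine hG z ⟨g, ⟨v, hxv.symm, hex.symm⟩, fun g' hg' ↦ ?_⟩
      by_contra hne
      have hgf : g' ≠ f := by
        rintro rfl
        rcases hg'.eq_or_eq_of_isLink hfy with h | h
        · exact hxv h
        · exact hwz h.symm
      exact hne (hz g' (other hne hgf hg'))
    · refine hG z ⟨f, ⟨v, hyv.symm, hfy.symm⟩, fun g' hg' ↦ ?_⟩
      by_contra hne
      have hge : g' ≠ g := by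
        rintro rfl
        rcases hg'.eq_or_eq_of_isLink hex with h | h
        · exact hyv h
        · exact hwz h.symm
      exact hge (hz g' (other hge hne hg'))
  · have hgG := (hg g hge z w).1 hzw
    refine hG z ⟨g, ⟨w, hwz, hgG.2⟩, fun g' hg' ↦ ?_⟩
    have hzv : z ≠ v := by
      have := hzw.left_mem
      rw [hV] at this
      exact this.2
    by_contra hne
    by_cases h1 : g' = e
    · subst h1
      rcases hg'.eq_or_eq_of_isLink hex with h | rfl
      · exact hzv h
      · exact hne (hz g' hH.inc_left)
    by_cases h2 : g' = f
    · subst h2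
      rcases hg'.eq_or_eq_of_isLink hfy with h | rfl
      · exact hzv h
      · exact hge (hz e hH.inc_right).symm
    exact hne (hz g' (other h1 h2 hg'))

lemma Tame.of_leafRemovals {G H : Graph α β} {f : α → ℝ} (hG : Tame G f)
    (h : Relation.ReflTransGen LeafRemoval G H) : Tame H f := by
  induction h with
  | refl => exact hG
  | tail _ h ih => exact ih.of_leafRemoval h

lemma Tame.of_smoothings {G H : Graph α β} {f : α → ℝ} (hG : Tame G f) (hl : ∀ v, ¬ IsLeaf G v)
    (h : Relation.ReflTransGen Smoothing G H) : Tame H f ∧ ∀ v, ¬ IsLeaf H v := by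
  induction h with
  | refl => exact ⟨hG, hl⟩
  | tail _ h ih => exact ⟨ih.1.of_smoothing h, not_isLeaf_of_smoothing ih.2 h⟩

/-- A walk from `a` to `b` leaves `Q` at some step. This provides the edges across cuts and a
non-loop edge at each vertex. -/
lemma Connected.exists_crossing {K : Graph α β} (hK : Connected K) {Q : α → Prop} {a b : α}
    (ha : a ∈ V(K)) (hb : b ∈ V(K)) (hQa : Q a) (hQb : ¬ Q b) :
    ∃ e x y, K.IsLink e x y ∧ Q x ∧ ¬ Q y := by
  have h := hK.2 a ha b hb
  clear hb
  induction h with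
  | refl => exact (hQb hQa).elim
  | @tail c d _ hcd ih =>
    by_cases hc : Q c
    · obtain ⟨e, he⟩ := hcd
      exact ⟨e, c, d, he, hc, hQb⟩
    · exact ih hc

/-- A connected tame multigraph without vertices of degree one or two is a chain. -/
theorem Tame.isChain {K : Graph α β} {f : α → ℝ} (hK : Tame K f) (hc : Connected K)
    (hleaf : ∀ v, ¬ IsLeaf K v) (htwo : ∀ v e f, ¬ IsTwoValent K v e f) : IsChain K := by
  classical
  obtain ⟨N, hN⟩ := hK.covering
  obtain ⟨z₀, hz₀⟩ := hc.1
  set V := hK.finV.toFinset with hVdef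
  set E := hK.finE.toFinset with hEdef
  have hV : ∀ z, z ∈ V(K) ↔ z ∈ V := fun z ↦ by simp [hVdef]
  have hE : ∀ e, e ∈ E(K) ↔ e ∈ E := fun z ↦ by simp [hEdef]
  have hsub : ∀ {s : Finset β}, (∀ e ∈ s, e ∈ E(K)) → (↑s : Set β) ⊆ E(K) := fun h e he ↦
    h e (Finset.mem_coe.1 he)
  have hends : ∀ e, ∃ q : α × α, e ∈ E → K.IsLink e q.1 q.2 := by
    intro e
    by_cases he : e ∈ E
    · obtain ⟨x, y, h⟩ := Graph.exists_isLink_of_mem_edgeSet ((hE e).2 he)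
      exact ⟨(x, y), fun _ ↦ h⟩
    · exact ⟨(z₀, z₀), fun h ↦ (he h).elim⟩
  choose q hq using hends
  set en : β × Bool → α := fun d ↦ if d.2 then (q d.1).2 else (q d.1).1 with hen
  have hlink : ∀ d : β × Bool, d.1 ∈ E → K.IsLink d.1 (en d) (en (opp d)) := by
    rintro ⟨e, b⟩ he
    cases b
    · simpa [hen, opp] using hq e he
    · simpa [hen, opp] using (hq e he).symm
  have hdart : ∀ {e x y}, K.IsLink e x y → ∃ d : β × Bool, d.1 = e ∧ en d = x ∧
      en (opp d) = y := by
    intro e x y h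
    have h' := hlink (e, false) ((hE e).1 h.edge_mem)
    rcases h.eq_and_eq_or_eq_and_eq h' with ⟨h1, h2⟩ | ⟨h1, h2⟩
    · exact ⟨(e, false), rfl, h1.symm, h2.symm⟩
    · exact ⟨opp (e, false), rfl, h1.symm, by rw [opp_opp]; exact h2.symm⟩
  -- there are at least two vertices
  have htwoV : ∀ z ∈ V(K), ∃ z' ∈ V(K), z' ≠ z := by
    intro z hz
    -- With a single vertex all edges are loops there. By `Tame.card` there are at least two, so the
    -- degree would be at least four.
    by_contra! hall
    have hloop : ∀ e ∈ E(K), K.IsLink e z z := by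
      intro e he
      obtain ⟨x, y, h⟩ := Graph.exists_isLink_of_mem_edgeSet he
      rwa [hall x h.left_mem, hall y h.right_mem] at h
    have h1 := hK.deg z E (hsub fun e he ↦ (hE e).2 he)
    have h2 : ∑ e ∈ E, incidence K e z = E.card * 2 := by
      rw [Finset.sum_const_nat]
      intro e he
      exact incidence_of_isLoopAt (hloop e ((hE e).2 he))
    have h3 := hK.card
    rw [Set.ncard_eq_toFinset_card _ hK.finE, Set.ncard_eq_toFinset_card _ hK.finV, ← hVdef,
      ← hEdef] at h3
    have h4 : 0 < V.card := Finset.card_pos.2 ⟨z, (hV z).1 hz⟩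
    omega
  -- Connectedness gives a non-loop edge at the vertex, and there is a second edge because it is not
  -- a leaf. If this one is a loop it counts twice; otherwise there is a third edge because the
  -- vertex is not 2-valent.
  have hdeg : ∀ z ∈ V, 3 ≤ ∑ e ∈ E, incidence K e z := by
    intro z hz
    have hsum : ∀ s : Finset β, (∀ e ∈ s, K.Inc e z) →
        ∑ e ∈ s, incidence K e z ≤ ∑ e ∈ E, incidence K e z := fun s hs ↦
      Finset.sum_le_sum_of_subset fun e he ↦ (hE e).1 (hs e he).edge_mem
    have one : ∀ {e}, K.Inc e z → 1 ≤ incidence K e z := one_le_incidence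
    obtain ⟨z', hz', hne⟩ := htwoV z ((hV z).2 hz)
    obtain ⟨e, x, y, hxy, rfl, hy⟩ := hc.exists_crossing (Q := fun w ↦ w = z) ((hV z).2 hz) hz'
      rfl hne
    have he : K.IsNonloopAt e x := ⟨y, hy, hxy⟩
    have h1 := hleaf x
    rw [IsLeaf] at h1
    push Not at h1
    obtain ⟨e₂, h2, hne2⟩ := h1 e he
    by_cases hl : K.IsLink e₂ x x
    · have h3 := hsum {e, e₂} (by
        intro g hg
        simp only [Finset.mem_insert, Finset.mem_singleton] at hg
        rcases hg with rfl | rfl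
        · exact he.inc
        · exact h2)
      rw [Finset.sum_pair hne2.symm] at h3
      have h4 : incidence K e₂ x = 2 := incidence_of_isLoopAt hl
      have := one he.inc
      omega
    · have hn2 : K.IsNonloopAt e₂ x := (h2.isLoopAt_or_isNonloopAt).resolve_left hl
      have h3 := htwo x e e₂
      rw [IsTwoValent] at h3
      push Not at h3
      obtain ⟨e₃, h4, h5, h6⟩ := h3 hne2.symm he hn2
      have h7 := hsum {e, e₂, e₃} (by
        intro g hg
        simp only [Finset.mem_insert, Finset.mem_singleton] at hg
        rcases hg with rfl | rfl | rfl
        · exact he.inc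
        · exact h2
        · exact h4)
      rw [Finset.sum_insert (by simp [hne2.symm, h5.symm]), Finset.sum_pair h6.symm] at h7
      have := one he.inc
      have := one h2
      have := one h4
      omega
  have hL : LayeredCubic V E en f N :=
    { end_mem := fun d hd ↦ (hV _).1 (hlink d hd).left_mem
      card_darts := by
        intro z hz
        have hle := hK.deg z E (hsub fun e he ↦ (hE e).2 he)
        have hge := hdeg z hz
        refine Eq.trans ?_ (le_antisymm hle hge)
        rw [Finset.card_filter, Finset.sum_product]
        refine Finset.sum_congr rfl fun e he ↦ ?_
        rw [Fintype.sum_bool]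
        have hl := hlink (e, false) he
        have ho : opp (e, false) = (e, true) := rfl
        rw [ho] at hl
        change K.IsLink e _ _ at hl
        by_cases h1 : en (e, false) = z <;> by_cases h2 : en (e, true) = z
        · rw [h1, h2] at hl; simp [h1, h2, incidence_of_isLoopAt hl]
        · have h3 : ¬ K.IsLoopAt e z := fun h ↦ h2 (h.eq_of_inc hl.inc_right).symm
          have h4 : K.Inc e z := h1 ▸ hl.inc_left
          simp [h1, h2, incidence_of_inc h4 h3]
        · have h3 : ¬ K.IsLoopAt e z := fun h ↦ h1 (h.eq_of_inc hl.inc_left).symm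
          have h4 : K.Inc e z := h2 ▸ hl.inc_right
          simp [h1, h2, incidence_of_inc h4 h3]
        · have h4 : ¬ K.Inc e z := fun h ↦ by
            rcases h.eq_or_eq_of_isLink hl with h' | h'
            · exact h1 h'.symm
            · exact h2 h'.symm
          simp [h1, h2, incidence_of_not_inc h4]
      parity := fun d hd ↦ hN.parity _ _ _ (hlink d hd)
      cover_le := fun p b ↦ hN.sum_le p b E (hsub fun e he ↦ (hE e).2 he)
      adjacent := fun d hd ↦ hN.adjacent _ _ _ (hlink d hd)
      flat_unique := fun d d' hd hd' ↦ hN.flat_unique _ _ _ _ _ _ (hlink d hd) (hlink d' hd')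
      flat_ne := fun d hd hf h ↦ by
        have := hlink d hd
        rw [← h] at this
        exact hN.flat_ne _ _ this hf
      cut := by
        rintro p b ⟨z, hz, hbz⟩ ⟨z', hz', hbz'⟩
        obtain ⟨e, x, y, hxy, hx, hy⟩ := hc.exists_crossing ((hV z).2 hz) ((hV z').2 hz') hbz hbz'
        obtain ⟨d, rfl, rfl, rfl⟩ := hdart hxy
        exact ⟨d, (hE _).1 hxy.edge_mem, hx, hy⟩ }
  exact hL.isChain ⟨z₀, (hV z₀).1 hz₀⟩ hV hE hlink

/-- A connected skeleton of a tame multigraph is a chain. -/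
theorem Tame.isChain_of_isSkeleton {G K : Graph α β} {f : α → ℝ} (hG : Tame G f)
    (hK : IsSkeleton G K) (hc : Connected K) : IsChain K := by
  obtain ⟨C, hGC, hC, hCK, htwo⟩ := hK
  obtain ⟨hT, hl⟩ := (hG.of_leafRemovals hGC).of_smoothings hC hCK
  exact hT.isChain hc hl htwo

end Invariants
end NodalCurve

namespace NodalCurve

/-! ### Coordinates in which a hyperelliptic polygon is a strip -/

/-- Coordinates `(c, ρ)` on the lattice and dual coordinates `(X, Y)` on the plane such that the
interior lattice points of `P` lie in the row `ρ = 0` and all lattice points in the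
rows `-1`, `0`, `1`. -/
structure Strip (P : Set (ℝ × ℝ)) (h : ℤ × ℤ → ℝ) where
  c : ℤ × ℤ → ℤ
  ρ : ℤ × ℤ → ℤ
  X : ℝ × ℝ → ℝ
  Y : ℝ × ℝ → ℝ
  W : ℝ → ℝ → ℝ × ℝ
  X_W : ∀ t y, X (W t y) = t
  Y_W : ∀ t y, Y (W t y) = y
  W_XY : ∀ w, W (X w) (Y w) = w
  mem_cell : ∀ a w, a ∈ cell P h w ↔ a ∈ latticePoints P ∧ ∀ b ∈ latticePoints P,
    h b + c b * X w + ρ b * Y w ≤ h a + c a * X w + ρ a * Y w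
  c_add : ∀ p u v, c (p + u + v) = c (p + u) + c (p + v) - c p
  ρ_add : ∀ p u v, ρ (p + u + v) = ρ (p + u) + ρ (p + v) - ρ p
  inj : ∀ a b, c a = c b → ρ a = ρ b → a = b
  det_eq : ∀ p u v, det u v = (c (p + u) - c p) * (ρ (p + v) - ρ p) -
    (ρ (p + u) - ρ p) * (c (p + v) - c p)
  row : ∀ a ∈ latticePoints P, -1 ≤ ρ a ∧ ρ a ≤ 1
  fin : (latticePoints P).Finite
  int_row : ∀ i ∈ interiorLatticePoints P, ρ i = 0
  int_beyond : ∀ i ∈ interiorLatticePoints P, ∀ α β : ℝ, α ≠ 0 ∨ β ≠ 0 →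
    ∃ a ∈ latticePoints P, α * (c a - c i) + β * (ρ a - ρ i) < 0

section Polygon

variable {P : Set (ℝ × ℝ)}

lemma IsLatticePolygon.convex (hP : IsLatticePolygon P) : Convex ℝ P := by
  obtain ⟨⟨S, -, rfl⟩, -⟩ := hP
  exact convex_convexHull ℝ _

lemma IsLatticePolygon.finite_latticePoints (hP : IsLatticePolygon P) :
    (latticePoints P).Finite := by
  obtain ⟨⟨S, hS, rfl⟩, -⟩ := hP
  obtain ⟨R, hR⟩ := ((hS.image toPlane).isCompact_convexHull (𝕜 := ℝ)).isBounded.exists_norm_le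
  refine ((Set.finite_Icc (-⌈R⌉) ⌈R⌉).prod (Set.finite_Icc (-⌈R⌉) ⌈R⌉)).subset ?_
  intro a ha
  have h1 := hR _ ha
  rw [Prod.norm_def, max_le_iff, Real.norm_eq_abs, Real.norm_eq_abs, abs_le, abs_le] at h1
  have h2 := Int.le_ceil R
  simp only [toPlane] at h1
  refine ⟨⟨?_, ?_⟩, ⟨?_, ?_⟩⟩ <;> rify <;> linarith

/-- A functional that is minimal at `i` among the lattice points is minimal there on all of `P`,
which they span; a small step from `i` in the direction `-(α, β)` would then leave `P`, although `i`
is interior. -/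
lemma IsLatticePolygon.exists_lt (hP : IsLatticePolygon P) {i : ℤ × ℤ}
    (hi : i ∈ interiorLatticePoints P) {α β : ℝ} (hαβ : α ≠ 0 ∨ β ≠ 0) :
    ∃ a ∈ latticePoints P, α * a.1 + β * a.2 < α * i.1 + β * i.2 := by
  by_contra! hcon
  have hsub : P ⊆ {x : ℝ × ℝ | α * i.1 + β * i.2 ≤ α * x.1 + β * x.2} := by
    obtain ⟨⟨S, -, rfl⟩, -⟩ := hP
    refine convexHull_min ?_ ?_
    · rintro _ ⟨a, ha, rfl⟩
      exact hcon a (subset_convexHull ℝ _ ⟨a, ha, rfl⟩)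
    · intro x hx y hy s t hs ht hst
      simp only [Set.mem_ofPred_eq, Prod.fst_add, Prod.snd_add, Prod.smul_fst, Prod.smul_snd,
        smul_eq_mul] at *
      have h1 := mul_le_mul_of_nonneg_left hx hs
      have h2 := mul_le_mul_of_nonneg_left hy ht
      have h3 : (s + t) * (α * i.1 + β * i.2) = α * i.1 + β * i.2 := by rw [hst, one_mul]
      linarith
  have hcont : Filter.Tendsto (fun ε : ℝ ↦ ((i.1 : ℝ) - ε * α, (i.2 : ℝ) - ε * β))
      (nhds 0) (nhds (toPlane i)) := by
    have : Continuous (fun ε : ℝ ↦ ((i.1 : ℝ) - ε * α, (i.2 : ℝ) - ε * β)) := by fun_prop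
    have h := this.tendsto 0
    simpa [toPlane] using h
  have hev := hcont (isOpen_interior.mem_nhds hi)
  obtain ⟨δ, hδ, hball⟩ := Metric.mem_nhds_iff.1 hev
  have hmem : (δ / 2) ∈ Metric.ball (0 : ℝ) δ := by
    rw [Metric.mem_ball, Real.dist_eq, sub_zero, abs_of_pos (by linarith)]; linarith
  have h1 := hsub (interior_subset (hball hmem))
  simp only [Set.mem_ofPred_eq] at h1
  have h2 : 0 < α ^ 2 + β ^ 2 := by rcases hαβ with h | h <;> positivity
  nlinarith [mul_pos (half_pos hδ) h2]

/-- `d` is the primitive vector in the direction of `v`, completed to a lattice basis by Bézout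
coefficients. -/
lemma exists_basis {v : ℤ × ℤ} (hv : v ≠ 0) : ∃ d e : ℤ × ℤ, det d e = 1 ∧
    ∀ x : ℤ × ℤ, det v x = 0 → det d x = 0 := by
  have hg : 0 < Int.gcd v.1 v.2 := by
    rw [Int.gcd_pos_iff]
    by_contra! h
    exact hv (Prod.ext h.1 h.2)
  obtain ⟨d₁, h1⟩ := Int.gcd_dvd_left v.1 v.2
  obtain ⟨d₂, h2⟩ := Int.gcd_dvd_right v.1 v.2
  have hb := Int.gcd_eq_gcd_ab v.1 v.2
  set g : ℤ := (Int.gcd v.1 v.2 : ℤ) with hgdef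
  have hg' : g ≠ 0 := by positivity
  refine ⟨(d₁, d₂), (-(v.1.gcdB v.2), v.1.gcdA v.2), ?_, ?_⟩
  · have : g * (det (d₁, d₂) (-(v.1.gcdB v.2), v.1.gcdA v.2)) = g * 1 := by
      simp only [det]
      linear_combination -hb - v.1.gcdA v.2 * h1 - v.1.gcdB v.2 * h2
    exact mul_left_cancel₀ hg' this
  · intro x hx
    have : g * det (d₁, d₂) x = g * 0 := by
      simp only [det] at *
      linear_combination hx - x.2 * h1 + x.1 * h2
    exact mul_left_cancel₀ hg' this

lemma det_eq_zero_of_collinear {s : Set (ℤ × ℤ)} (hs : Collinear ℝ (toPlane '' s))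
    {a b x : ℤ × ℤ} (ha : a ∈ s) (hb : b ∈ s) (hx : x ∈ s) : det (b - a) (x - a) = 0 := by
  obtain ⟨v, hv⟩ := (collinear_iff_of_mem (Set.mem_image_of_mem toPlane ha)).1 hs
  obtain ⟨r, hr⟩ := hv _ (Set.mem_image_of_mem toPlane hb)
  obtain ⟨r', hr'⟩ := hv _ (Set.mem_image_of_mem toPlane hx)
  simp only [toPlane, vadd_eq_add, Prod.ext_iff, Prod.fst_add, Prod.snd_add, Prod.smul_fst,
    Prod.smul_snd, smul_eq_mul] at hr hr'
  have : ((det (b - a) (x - a) : ℤ) : ℝ) = 0 := by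
    simp only [det, Prod.fst_sub, Prod.snd_sub]
    push_cast
    rw [hr.1, hr.2, hr'.1, hr'.2]
    ring
  exact_mod_cast this

/-- With at least three interior lattice points on a line, no lattice point is more than one row
away from the line. -/
lemma row_bound (hP : IsLatticePolygon P) {d e : ℤ × ℤ} (hde : det d e = 1) {r₀ : ℤ}
    (hrow : ∀ i ∈ interiorLatticePoints P, det d i = r₀) {i j : ℤ × ℤ}
    (hi : i ∈ interiorLatticePoints P) (hj : j ∈ interiorLatticePoints P)
    (hij : det i e + 2 ≤ det j e) {a : ℤ × ℤ} (ha : a ∈ latticePoints P) (σ : ℤ)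
    (hσ : σ ≠ 0) (k : ℤ) (hk : 2 ≤ k) (hak : det d a = r₀ + σ * k) : False := by
  have hk0 : (0 : ℝ) < k := by exact_mod_cast (by omega : 0 < k)
  have hk2 : (2 : ℝ) ≤ k := by exact_mod_cast hk
  -- The triangle with base `i j` and apex `a` is cut by the row `r₀ + σ`, where the apex has weight
  -- `s = 1 / k`. The slice starts at `lo` and has length `(1 - s) * Δ ≥ 1 / 2 * 2`, so it contains
  -- the lattice point with coordinate `⌈lo⌉`.
  set s : ℝ := 1 / k with hs
  have hs0 : 0 < s := by positivity
  have hs1 : s ≤ 1 / 2 := one_div_le_one_div_of_le (by norm_num) hk2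
  have hsk : s * k = 1 := by rw [hs]; field_simp
  set lo : ℝ := s * (det a e : ℤ) + (1 - s) * (det i e : ℤ) with hlo
  set n : ℤ := ⌈lo⌉ with hn
  have hn1 : lo ≤ n := Int.le_ceil lo
  have hn2 : (n : ℝ) < lo + 1 := Int.ceil_lt_add_one lo
  set Δ : ℝ := (det j e : ℤ) - (det i e : ℤ) with hΔ
  have hΔ2 : 2 ≤ Δ := by
    have : ((det i e + 2 : ℤ) : ℝ) ≤ (det j e : ℤ) := by exact_mod_cast hij
    push_cast at this
    linarith
  have hlen : 1 ≤ (1 - s) * Δ := by nlinarith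
  set τ : ℝ := (n - lo) / ((1 - s) * Δ) with hτ
  have hτ0 : 0 ≤ τ := div_nonneg (by linarith) (by linarith)
  have hτ1 : τ ≤ 1 := (div_le_one (by linarith)).2 (by linarith)
  have hτm : τ * ((1 - s) * Δ) = n - lo := div_mul_cancel₀ _ (by linarith)
  have hconv := hP.convex
  have hq : (1 - τ) • toPlane i + τ • toPlane j ∈ interior P :=
    hconv.interior hi hj (by linarith) hτ0 (by ring)
  -- `a` may be a boundary point, but the interior point of the base has positive weight, so the
  -- lattice point found is interior and off the row.
  have hmem := hconv.combo_interior_self_mem_interior hq ha (a := 1 - s) (b := s) (by linarith)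
    hs0.le (by ring)
  set x : ℤ × ℤ := (n * d.1 + (r₀ + σ) * e.1, n * d.2 + (r₀ + σ) * e.2) with hx
  have hcoord : ∀ y : ℤ × ℤ, (y.1 : ℝ) = (det y e : ℤ) * d.1 + (det d y : ℤ) * e.1 ∧
      (y.2 : ℝ) = (det y e : ℤ) * d.2 + (det d y : ℤ) * e.2 := by
    intro y
    have h1 : y.1 = det y e * d.1 + det d y * e.1 := by
      simp only [det] at *; linear_combination -y.1 * hde
    have h2 : y.2 = det y e * d.2 + det d y * e.2 := by
      simp only [det] at *; linear_combination -y.2 * hde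
    constructor <;> exact_mod_cast (by assumption)
  have hxeq : (1 - s) • ((1 - τ) • toPlane i + τ • toPlane j) + s • toPlane a = toPlane x := by
    have ci := hcoord i
    have cj := hcoord j
    have ca := hcoord a
    rw [hrow i hi] at ci
    rw [hrow j hj] at cj
    rw [hak] at ca
    push_cast at ca
    refine Prod.ext ?_ ?_
    · simp only [toPlane, Prod.fst_add, Prod.smul_fst, smul_eq_mul, hx]
      rw [ci.1, cj.1, ca.1]
      push_cast
      simp only [hlo, hΔ] at hτm
      linear_combination (d.1 : ℝ) * hτm + σ * e.1 * hsk
    · simp only [toPlane, Prod.snd_add, Prod.smul_snd, smul_eq_mul, hx]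
      rw [ci.2, cj.2, ca.2]
      push_cast
      simp only [hlo, hΔ] at hτm
      linear_combination (d.2 : ℝ) * hτm + σ * e.2 * hsk
  rw [hxeq] at hmem
  have h1 := hrow x hmem
  have h2 : det d x = r₀ + σ := by
    simp only [det, hx] at *
    linear_combination (r₀ + σ) * hde
  omega

/-- The rows are parallel to the line of the interior lattice points. Three such points cannot fit
into two consecutive values of `c`, which gives the base of length two that `row_bound` needs. -/
lemma exists_strip (hP : IsLatticePolygon P) (hg : 3 ≤ genus P) (hhyp : IsHyperelliptic P)
    (h : ℤ × ℤ → ℝ) : Nonempty (Strip P h) := by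
  have hfin := hP.finite_latticePoints
  have hIfin : (interiorLatticePoints P).Finite := 
    hfin.subset fun a ha ↦ show toPlane a ∈ P from interior_subset ha
  obtain ⟨a₀, ha₀, b₀, hb₀, hab⟩ := (Set.one_lt_ncard hIfin).1
    (show 1 < (interiorLatticePoints P).ncard from lt_of_lt_of_le (by norm_num) hg)
  obtain ⟨d, e, hde, hd⟩ := exists_basis (sub_ne_zero.2 hab.symm)
  have hrow : ∀ i ∈ interiorLatticePoints P, det d i = det d a₀ := by
    intro i hi
    have := hd _ (det_eq_zero_of_collinear hhyp ha₀ hb₀ hi)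
    simp only [det, Prod.fst_sub, Prod.snd_sub] at *
    linarith
  have hinj : ∀ a b : ℤ × ℤ, det a e = det b e → det d a = det d b → a = b := by
    intro a b h1 h2
    simp only [det] at *
    refine Prod.ext ?_ ?_
    · linear_combination d.1 * h1 + e.1 * h2 - (a.1 - b.1) * hde
    · linear_combination d.2 * h1 + e.2 * h2 - (a.2 - b.2) * hde
  obtain ⟨i, hi, j, hj, hij⟩ : ∃ i ∈ interiorLatticePoints P, ∃ j ∈ interiorLatticePoints P,
      det i e + 2 ≤ det j e := by
    by_contra! hcon
    obtain ⟨m, hm, hmin⟩ := Set.exists_min_image (interiorLatticePoints P) (fun x ↦ det x e)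
      hIfin ⟨a₀, ha₀⟩
    have hle : (interiorLatticePoints P).ncard ≤ (Set.Icc (det m e) (det m e + 1)).ncard := by
      refine Set.ncard_le_ncard_of_injOn (fun x ↦ det x e) ?_ ?_ (Set.finite_Icc _ _)
      · intro x hx
        exact ⟨hmin x hx, by have := hcon m hm x hx; omega⟩
      · intro x hx y hy hxy
        exact hinj x y hxy ((hrow x hx).trans (hrow y hy).symm)
    rw [← Finset.coe_Icc, Set.ncard_coe_finset, Int.card_Icc] at hle
    have : 3 ≤ (interiorLatticePoints P).ncard := hg
    have h2 : (det m e + 1 + 1 - det m e).toNat = 2 := by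
      rw [show det m e + 1 + 1 - det m e = 2 by ring]; rfl
    omega
  have hdeR : (d.1 : ℝ) * e.2 - d.2 * e.1 = 1 := by
    have := congrArg (Int.cast (R := ℝ)) hde
    simpa [det] using this
  refine ⟨{
    c := fun a ↦ det a e
    ρ := fun a ↦ det d a - det d a₀
    X := fun w ↦ d.1 * w.1 + d.2 * w.2
    Y := fun w ↦ e.1 * w.1 + e.2 * w.2
    W := fun t y ↦ (e.2 * t - d.2 * y, d.1 * y - e.1 * t)
    X_W := fun t y ↦ by simp only; linear_combination t * hdeR
    Y_W := fun t y ↦ by simp only; linear_combination y * hdeR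
    W_XY := fun w ↦ by
      refine Prod.ext ?_ ?_
      · simp only; linear_combination w.1 * hdeR
      · simp only; linear_combination w.2 * hdeR
    mem_cell := ?_
    c_add := fun p u v ↦ by simp only [det, Prod.fst_add, Prod.snd_add]; ring
    ρ_add := fun p u v ↦ by simp only [det, Prod.fst_add, Prod.snd_add]; ring
    inj := fun a b h1 h2 ↦ hinj a b h1 (by linarith)
    det_eq := fun p u v ↦ by
      simp only [det, Prod.fst_add, Prod.snd_add] at *
      linear_combination -(u.1 * v.2 - u.2 * v.1) * hde
    row := ?_
    fin := hfin
    int_row := fun i hi ↦ by rw [hrow i hi, sub_self]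
    int_beyond := ?_ }⟩
  · intro a w
    -- Numbering the rows from the one of the interior points changes all monomials by the same
    -- function of `w`, which does not affect the cells.
    have hmon : ∀ b : ℤ × ℤ, monomial h b w = h b + (det b e : ℤ) * (d.1 * w.1 + d.2 * w.2) +
        ((det d b - det d a₀ : ℤ) : ℝ) * (e.1 * w.1 + e.2 * w.2) +
        (det d a₀ : ℤ) * (e.1 * w.1 + e.2 * w.2) := by
      intro b
      simp only [monomial, det]
      push_cast
      linear_combination -(b.1 * w.1 + b.2 * w.2) * hdeR
    simp only [cell, Set.mem_ofPred_eq, hmon, add_le_add_iff_right]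
  · intro a ha
    have key := row_bound hP hde hrow hi hj hij ha
    constructor
    · by_contra! hlt
      exact key (-1) (by norm_num) (det d a₀ - det d a) (by omega) (by ring)
    · by_contra! hlt
      exact key 1 (by norm_num) (det d a - det d a₀) (by omega) (by ring)
  · intro i hi α β hαβ
    obtain ⟨a, ha, hlt⟩ := hP.exists_lt hi (α := α * e.2 - β * d.2) (β := β * d.1 - α * e.1) (by
      by_contra! h0
      have h1 : α = 0 := by linear_combination (d.1 : ℝ) * h0.1 + d.2 * h0.2 - α * hdeR
      have h2 : β = 0 := by linear_combination (e.1 : ℝ) * h0.1 + e.2 * h0.2 - β * hdeR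
      rcases hαβ with h | h
      · exact h h1
      · exact h h2)
    refine ⟨a, ha, ?_⟩
    simp only [det]
    push_cast
    linarith

end Polygon
end NodalCurve

namespace NodalCurve

/-! ### Unit cells -/

/-- The vertices of one of the polygons of a nodal subdivision. -/
def IsUnitCell (σ : Set (ℤ × ℤ)) : Prop := IsUnitTriangle σ ∨ IsUnitParallelogram σ

/-- A unit cell with four lattice points is a parallelogram. -/
lemma IsUnitCell.isUnitParallelogram {σ : Set (ℤ × ℤ)} (hσ : IsUnitCell σ) {a b c d : ℤ × ℤ}
    (hab : a ≠ b) (hac : a ≠ c) (had : a ≠ d) (hbc : b ≠ c) (hbd : b ≠ d) (hcd : c ≠ d)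
    (ha : a ∈ σ) (hb : b ∈ σ) (hc : c ∈ σ) (hd : d ∈ σ) : IsUnitParallelogram σ := by
  refine hσ.resolve_left ?_
  rintro ⟨p, u, v, -, rfl⟩
  have h3 : ({p, p + u, p + v} : Set (ℤ × ℤ)).ncard ≤ 3 :=
    (Set.ncard_insert_le _ _).trans (Nat.succ_le_succ
      ((Set.ncard_insert_le _ _).trans (by simp)))
  have h4 : ({a, b, c, d} : Set (ℤ × ℤ)).ncard = 4 := by
    rw [Set.ncard_insert_of_notMem, Set.ncard_insert_of_notMem, Set.ncard_pair hcd]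
    · simp [hbc, hbd]
    · simp [hab, hac, had]
  have h5 : ({a, b, c, d} : Set (ℤ × ℤ)) ⊆ {p, p + u, p + v} := by
    rintro x (rfl | rfl | rfl | rfl) <;> assumption
  have := Set.ncard_le_ncard h5 (by simp)
  omega

lemma not_triangle_parallelogram {σ : Set (ℤ × ℤ)} (ht : IsUnitTriangle σ)
    (hp : IsUnitParallelogram σ) : False := by
  obtain ⟨p, u, v, -, rfl⟩ := ht
  obtain ⟨b, x, y, hd, hc⟩ := hp
  have hx : x ≠ 0 := by rintro rfl; simp [det] at hd
  have hy : y ≠ 0 := by rintro rfl; simp [det] at hd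
  have hxy : x ≠ y := by rintro rfl; simp [det, mul_comm] at hd
  have hxy' : x + y ≠ 0 := by
    intro h0
    rw [eq_neg_of_add_eq_zero_left h0] at hd
    simp [det, mul_comm] at hd
  have h3 : ({p, p + u, p + v} : Set (ℤ × ℤ)).ncard ≤ 3 :=
    (Set.ncard_insert_le _ _).trans (Nat.succ_le_succ
      ((Set.ncard_insert_le _ _).trans (by simp)))
  rw [hc, Set.ncard_insert_of_notMem, Set.ncard_insert_of_notMem, Set.ncard_pair] at h3
  · omega
  · simpa [add_assoc] using hx
  · simp [hxy, hy, add_assoc]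
  · simp [hx, hy, hxy', add_assoc]

/-- The cell consists of vertices of a unimodular affine image of the unit square, for which the
claim is a finite check. -/
lemma IsUnitCell.abs_det {σ : Set (ℤ × ℤ)} (hσ : IsUnitCell σ) {p q s : ℤ × ℤ} (hp : p ∈ σ)
    (hq : q ∈ σ) (hs : s ∈ σ) (hpq : p ≠ q) (hps : p ≠ s) (hqs : q ≠ s) :
    |det (q - p) (s - p)| = 1 := by
  obtain ⟨b, u, v, hd, hsub⟩ : ∃ b u v : ℤ × ℤ, |det u v| = 1 ∧
      ∀ x ∈ σ, ∃ y : Bool × Bool, x = b + (y.1.toInt • u + y.2.toInt • v) := by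
    rcases hσ with ⟨b, u, v, hd, rfl⟩ | ⟨b, u, v, hd, rfl⟩
    · refine ⟨b, u, v, hd, ?_⟩
      rintro x (rfl | rfl | rfl)
      · exact ⟨(false, false), by simp⟩
      · exact ⟨(true, false), by simp⟩
      · exact ⟨(false, true), by simp⟩
    · refine ⟨b, u, v, hd, ?_⟩
      rintro x (rfl | rfl | rfl | rfl)
      · exact ⟨(false, false), by simp⟩
      · exact ⟨(true, false), by simp⟩
      · exact ⟨(false, true), by simp⟩
      · exact ⟨(true, true), by simp [add_assoc]⟩
  obtain ⟨x, rfl⟩ := hsub p hp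
  obtain ⟨y, rfl⟩ := hsub q hq
  obtain ⟨z, rfl⟩ := hsub s hs
  have hxy : x ≠ y := fun h ↦ hpq (by rw [h])
  have hxz : x ≠ z := fun h ↦ hps (by rw [h])
  have hyz : y ≠ z := fun h ↦ hqs (by rw [h])
  have key : ∀ x y z : Bool × Bool, x ≠ y → x ≠ z → y ≠ z →
      |(y.1.toInt - x.1.toInt) * (z.2.toInt - x.2.toInt) -
        (y.2.toInt - x.2.toInt) * (z.1.toInt - x.1.toInt)| = 1 := by decide
  have h1 : det (b + (y.1.toInt • u + y.2.toInt • v) - (b + (x.1.toInt • u + x.2.toInt • v)))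
      (b + (z.1.toInt • u + z.2.toInt • v) - (b + (x.1.toInt • u + x.2.toInt • v))) =
      ((y.1.toInt - x.1.toInt) * (z.2.toInt - x.2.toInt) -
        (y.2.toInt - x.2.toInt) * (z.1.toInt - x.1.toInt)) * det u v := by
    simp only [det, Prod.fst_sub, Prod.snd_sub, Prod.fst_add, Prod.snd_add, Prod.smul_fst,
      Prod.smul_snd, smul_eq_mul]
    ring
  rw [h1, abs_mul, key x y z hxy hxz hyz, hd, one_mul]

lemma isUnitCell_of_mem {P : Set (ℝ × ℝ)} {h : ℤ × ℤ → ℝ}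
    {x : (ℝ × ℝ) × Set (Set (ℤ × ℤ))} (hx : x ∈ curvePoints P h) : IsUnitCell (cell P h x.1) :=
  hx.imp And.left And.left

lemma ne_fst_of_isLink {P : Set (ℝ × ℝ)} {h : ℤ × ℤ → ℝ} {e : Set (ℤ × ℤ)}
    {x y : (ℝ × ℝ) × Set (Set (ℤ × ℤ))} (hl : (boundedCurve P h).IsLink e x y) : x.1 ≠ y.1 :=
  fun h0 ↦ hl.2.2.1 (ext_of_mem hl.1 hl.2.1 hl.2.2.2.2.1 hl.2.2.2.2.2 h0)

lemma exists_third {P : Set (ℝ × ℝ)} {h : ℤ × ℤ → ℝ} {w : ℝ × ℝ} (hw : IsUnitCell (cell P h w))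
    (p q : ℤ × ℤ) : ∃ s ∈ cell P h w, s ≠ p ∧ s ≠ q := by
  have h3 : 3 ≤ (cell P h w).ncard := by
    rcases hw with ⟨b, u, v, hd, hc⟩ | ⟨b, u, v, hd, hc⟩ <;>
    · have hu : u ≠ 0 := by rintro rfl; simp [det] at hd
      have hv : v ≠ 0 := by rintro rfl; simp [det] at hd
      have huv : u ≠ v := by rintro rfl; simp [det, mul_comm] at hd
      have h3 : ({b, b + u, b + v} : Set (ℤ × ℤ)).ncard = 3 := by
        rw [Set.ncard_insert_of_notMem, Set.ncard_pair]
        · simpa using huv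
        · simp [hu, hv]
      have hsub : ({b, b + u, b + v} : Set (ℤ × ℤ)) ⊆ cell P h w := by
        intro x hx
        rw [hc]
        simp only [Set.mem_insert_iff, Set.mem_singleton_iff] at hx ⊢
        tauto
      exact h3.symm.le.trans (Set.ncard_le_ncard hsub (by rw [hc]; simp))
  by_contra! hcon
  have : (cell P h w) ⊆ {p, q} := by
    intro s hs
    by_cases hsp : s = p
    · exact Or.inl hsp
    · exact Or.inr (hcon s hs hsp)
  have h4 := Set.ncard_le_ncard this
  have h5 : ({p, q} : Set (ℤ × ℤ)).ncard ≤ 2 := Set.ncard_insert_le p {q} |>.trans (by simp)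
  omega

lemma eq_of_three {P : Set (ℝ × ℝ)} {h : ℤ × ℤ → ℝ} {w w' : ℝ × ℝ}
    (hw : IsUnitCell (cell P h w)) {p q s : ℤ × ℤ}
    (hpq : p ≠ q) (hps : p ≠ s) (hqs : q ≠ s)
    (hp : p ∈ cell P h w) (hq : q ∈ cell P h w) (hs : s ∈ cell P h w)
    (hp' : p ∈ cell P h w') (hq' : q ∈ cell P h w') (hs' : s ∈ cell P h w') : w = w' := by
  have hd := hw.abs_det hp hq hs hpq hps hqs
  refine eq_of_noncollinear hd ⟨hp, ?_, ?_⟩ ⟨hp', ?_, ?_⟩ <;> simpa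

/-- Two points of the curve joined by an edge have only the ends of the dual edge in common. -/
lemma mem_of_mem_cells {P : Set (ℝ × ℝ)} {h : ℤ × ℤ → ℝ} {p q : ℤ × ℤ}
    {w w' : ℝ × ℝ} (hpq : p ≠ q) (hw : IsUnitCell (cell P h w)) (hne : w ≠ w')
    (hp : p ∈ cell P h w) (hq : q ∈ cell P h w) (hp' : p ∈ cell P h w')
    (hq' : q ∈ cell P h w') {a : ℤ × ℤ} (ha : a ∈ cell P h w) (ha' : a ∈ cell P h w') :
    a = p ∨ a = q := by
  by_contra! hcon
  exact hne (eq_of_three hw hpq hcon.1.symm hcon.2.symm hp hq ha hp' hq' ha')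

/-! ### The curve along vertical lines -/

namespace Strip

variable {P : Set (ℝ × ℝ)} {h : ℤ × ℤ → ℝ} (S : Strip P h)

/-- The value of the tropical monomial with exponent `a`, up to a function of `w` only. -/
noncomputable def val (a : ℤ × ℤ) (w : ℝ × ℝ) : ℝ := h a + S.c a * S.X w + S.ρ a * S.Y w

/-- The orientation of a triple of lattice points. -/
def D (p q s : ℤ × ℤ) : ℤ := (S.c q - S.c p) * (S.ρ s - S.ρ p) - (S.ρ q - S.ρ p) * (S.c s - S.c p)

lemma D_eq (p q s : ℤ × ℤ) : S.D p q s = det (q - p) (s - p) := by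
  rw [S.det_eq p]; simp [D]

lemma mem_cell' {a : ℤ × ℤ} {w : ℝ × ℝ} : a ∈ cell P h w ↔ a ∈ latticePoints P ∧
    ∀ b ∈ latticePoints P, S.val b w ≤ S.val a w := S.mem_cell a w

lemma mem_cell_of_le {a b : ℤ × ℤ} {w : ℝ × ℝ} (ha : a ∈ cell P h w) (hb : b ∈ latticePoints P)
    (hab : S.val a w ≤ S.val b w) : b ∈ cell P h w := by
  rw [S.mem_cell'] at ha ⊢
  exact ⟨hb, fun d hd ↦ (ha.2 d hd).trans hab⟩

lemma val_eq {a b : ℤ × ℤ} {w : ℝ × ℝ} (ha : a ∈ cell P h w) (hb : b ∈ cell P h w) :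
    S.val a w = S.val b w := by
  rw [S.mem_cell'] at ha hb
  exact le_antisymm (hb.2 a ha.1) (ha.2 b hb.1)

lemma val_lt {a b : ℤ × ℤ} {w : ℝ × ℝ} (ha : a ∈ cell P h w) (hb : b ∈ latticePoints P)
    (hb' : b ∉ cell P h w) : S.val b w < S.val a w := by
  by_contra! hcon
  exact hb' (S.mem_cell_of_le ha hb hcon)

lemma eq_of_coords {w w' : ℝ × ℝ} (hX : S.X w = S.X w') (hY : S.Y w = S.Y w') : w = w' := by
  rw [← S.W_XY w, ← S.W_XY w', hX, hY]

lemma abs_D {w : ℝ × ℝ} (hw : IsUnitCell (cell P h w)) {p q s : ℤ × ℤ} (hp : p ∈ cell P h w)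
    (hq : q ∈ cell P h w) (hs : s ∈ cell P h w) (hpq : p ≠ q) (hps : p ≠ s) (hqs : q ≠ s) :
    |S.D p q s| = 1 := by
  rw [D_eq]; exact hw.abs_det hp hq hs hpq hps hqs

lemma isUnitCell_of_D (hn : IsNodal P h) {w : ℝ × ℝ} {p q s : ℤ × ℤ} (hp : p ∈ cell P h w)
    (hq : q ∈ cell P h w) (hs : s ∈ cell P h w) (hD : S.D p q s ≠ 0) :
    IsUnitCell (cell P h w) := by
  refine hn w fun hcol ↦ hD ?_
  rw [D_eq]
  exact det_eq_zero_of_collinear hcol hp hq hs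

/-- The set of points of a convex combination in coordinates. -/
lemma exists_between {w w' : ℝ × ℝ} (s : ℝ) : ∃ v : ℝ × ℝ,
    S.X v = (1 - s) * S.X w + s * S.X w' ∧
    ∀ a, S.val a v = (1 - s) * S.val a w + s * S.val a w' := by
  refine ⟨S.W ((1 - s) * S.X w + s * S.X w') ((1 - s) * S.Y w + s * S.Y w'), S.X_W _ _, ?_⟩
  intro a
  simp only [val, S.X_W, S.Y_W]
  ring

/-- The cell dual to the inner points of an edge. -/
lemma cell_between {p q : ℤ × ℤ} {w w' : ℝ × ℝ} (hpq : p ≠ q) (hw : IsUnitCell (cell P h w))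
    (hne : w ≠ w') (hp : p ∈ cell P h w) (hq : q ∈ cell P h w) (hp' : p ∈ cell P h w')
    (hq' : q ∈ cell P h w') {s : ℝ} (hs0 : 0 < s) (hs1 : s < 1) :
    ∃ v, S.X v = (1 - s) * S.X w + s * S.X w' ∧ cell P h v = {p, q} := by
  obtain ⟨v, hvX, hv⟩ := S.exists_between (w := w) (w' := w') s
  refine ⟨v, hvX, ?_⟩
  have sub : ∀ a, a ∈ cell P h w → a ∈ cell P h w' → a ∈ cell P h v := by
    intro a ha ha'
    rw [S.mem_cell'] at ha ha' ⊢
    refine ⟨ha.1, fun b hb ↦ ?_⟩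
    rw [hv, hv]
    have := mul_le_mul_of_nonneg_left (ha.2 b hb) (by linarith : 0 ≤ 1 - s)
    have := mul_le_mul_of_nonneg_left (ha'.2 b hb) hs0.le
    linarith
  have hpv := sub p hp hp'
  ext a
  constructor
  · intro ha
    have haA := (S.mem_cell'.1 ha).1
    have e := S.val_eq ha hpv
    rw [hv, hv] at e
    have l1 := (S.mem_cell'.1 hp).2 a haA
    have l2 := (S.mem_cell'.1 hp').2 a haA
    have k1 : S.val p w ≤ S.val a w := by nlinarith
    have k2 : S.val p w' ≤ S.val a w' := by nlinarith
    exact mem_of_mem_cells hpq hw hne hp hq hp' hq' (S.mem_cell_of_le hp haA k1)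
      (S.mem_cell_of_le hp' haA k2)
  · rintro (rfl | rfl)
    · exact hpv
    · exact sub _ hq hq'

/-- On a vertical line, a change of `Y` shifts all monomials of one row equally, so the order within
the row does not depend on `Y`. -/
lemma mem_cell_of_row {w w' : ℝ × ℝ} (hX : S.X w = S.X w') {p p' : ℤ × ℤ} (hp : p ∈ cell P h w)
    (hp' : p' ∈ cell P h w') (hρ : S.ρ p = S.ρ p') : p' ∈ cell P h w := by
  have hA := S.mem_cell'.1 hp'
  have h1 := hA.2 p (S.mem_cell'.1 hp).1
  refine S.mem_cell_of_le hp hA.1 ?_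
  simp only [val, hX, hρ] at *
  linarith

/-- The ends of an edge whose dual is not horizontal lie on different rows. -/
lemma row_ne {p q : ℤ × ℤ} {w w' : ℝ × ℝ} (hpq : p ≠ q) (hX : S.X w ≠ S.X w')
    (hp : p ∈ cell P h w) (hq : q ∈ cell P h w) (hp' : p ∈ cell P h w')
    (hq' : q ∈ cell P h w') : S.ρ p ≠ S.ρ q := by
  intro hρ
  have e1 := S.val_eq hp hq
  have e2 := S.val_eq hp' hq'
  simp only [val, hρ] at e1 e2
  have h0 : ((S.c p : ℝ) - S.c q) * (S.X w - S.X w') = 0 := by linarith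
  rcases mul_eq_zero.1 h0 with h1 | h1
  · exact hpq (S.inj p q (by exact_mod_cast sub_eq_zero.1 h1) hρ)
  · exact hX (by linarith)

/-- Among the edges of the subdivision that are dual to points on one vertical line and that do
not lie in a row, three are never distinct. -/
lemma not_three {t : ℝ} {e : Fin 3 → Set (ℤ × ℤ)} (he : Function.Injective e)
    (hw : ∀ i, ∃ w p q, S.X w = t ∧ cell P h w = e i ∧ e i = {p, q} ∧ S.ρ p ≠ S.ρ q) : False := by
  -- `m` is the row that the edge misses. Since the three row numbers add up to zero, it is minus
  -- the sum of the rows of the two ends.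
  have hm : ∀ i, ∃ m : ℤ, -1 ≤ m ∧ m ≤ 1 ∧ (∀ r, -1 ≤ r → r ≤ 1 → r ≠ m → ∃ a ∈ e i, S.ρ a = r) ∧
      ∀ a ∈ e i, ∀ b ∈ e i, S.ρ a = S.ρ b → a = b := by
    intro i
    obtain ⟨w, p, q, -, hc, hpq, hρ⟩ := hw i
    have hp : p ∈ cell P h w := by rw [hc, hpq]; simp
    have hq : q ∈ cell P h w := by rw [hc, hpq]; simp
    have rp := S.row p (S.mem_cell'.1 hp).1
    have rq := S.row q (S.mem_cell'.1 hq).1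
    refine ⟨-(S.ρ p + S.ρ q), ?_, ?_, ?_, ?_⟩
    · omega
    · omega
    · intro r h1 h2 h3
      have : r = S.ρ p ∨ r = S.ρ q := by omega
      rcases this with rfl | rfl
      · exact ⟨p, by rw [hpq]; simp, rfl⟩
      · exact ⟨q, by rw [hpq]; simp, rfl⟩
    · rw [hpq]
      rintro a (rfl | rfl) b (rfl | rfl) hab
      · rfl
      · exact (hρ hab).elim
      · exact (hρ hab.symm).elim
      · rfl
  choose m hm1 hm2 hmr hmu using hm
  choose w p q hX hc hpq hρ using hw
  have hmem : ∀ {i a}, a ∈ e i → a ∈ cell P h (w i) := fun {i a} ha ↦ by rw [hc]; exact ha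
  have hsub : ∀ i j, ∀ a ∈ e i, (∃ b ∈ e j, S.ρ b = S.ρ a) → a ∈ e j := by
    rintro i j a ha ⟨b, hb, hρ⟩
    have := S.mem_cell_of_row ((hX j).trans (hX i).symm) (hmem hb) (hmem ha) hρ
    rwa [hc] at this
  have hmiss : ∀ i, ∀ a ∈ e i, S.ρ a ≠ m i := by
    intro i a ha hma
    have h1 : ∃ r s : ℤ, -1 ≤ r ∧ r ≤ 1 ∧ -1 ≤ s ∧ s ≤ 1 ∧ r ≠ m i ∧ s ≠ m i ∧ r ≠ s := by
      have := hm1 i; have := hm2 i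
      have : m i = -1 ∨ m i = 0 ∨ m i = 1 := by omega
      rcases this with h | h | h
      · exact ⟨0, 1, by omega⟩
      · exact ⟨-1, 1, by omega⟩
      · exact ⟨-1, 0, by omega⟩
    obtain ⟨r, s, hr1, hr2, hs1, hs2, hr, hs, hrs⟩ := h1
    obtain ⟨b, hb, hbr⟩ := hmr i r hr1 hr2 hr
    obtain ⟨d, hd, hds⟩ := hmr i s hs1 hs2 hs
    rw [hpq i] at ha hb hd
    rcases ha with rfl | rfl <;> rcases hb with rfl | rfl <;> rcases hd with rfl | rfl <;> omega
  -- On the vertical line, an edge is determined by the two rows that it meets, by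
  -- `mem_cell_of_row`.
  have hminj : ∀ i j, m i = m j → i = j := by
    intro i j hij
    refine he (Set.Subset.antisymm ?_ ?_)
    · intro a ha
      have r := S.row a (S.mem_cell'.1 (hmem ha)).1
      exact hsub i j a ha (hmr j _ r.1 r.2 (hij ▸ hmiss i a ha))
    · intro a ha
      have r := S.row a (S.mem_cell'.1 (hmem ha)).1
      exact hsub j i a ha (hmr i _ r.1 r.2 (hij ▸ hmiss j a ha))
  -- If an edge joins the outer rows, the middle row lies strictly below the mean of its two ends.
  -- On the line neither this mean nor the middle row, up to the common normalisation of `val`,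
  -- depends on `Y`, so no maximal cell on the line can contain a point of the middle row.
  have hzero : ∀ i j, m i = 0 → m j ≠ 0 → False := by
    intro i j hi hj
    obtain ⟨a, ha, hρa⟩ := hmr i 1 (by norm_num) le_rfl (by omega)
    obtain ⟨b, hb, hρb⟩ := hmr i (-1) le_rfl (by norm_num) (by omega)
    obtain ⟨d, hd, hρd⟩ := hmr j 0 (by norm_num) (by norm_num) hj.symm
    have hdA := S.mem_cell'.1 (hmem hd)
    have hdi : d ∉ cell P h (w i) := by
      rw [hc]
      intro hd'
      exact hmiss i d hd' (by omega)
    have l1 := S.val_lt (hmem ha) hdA.1 hdi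
    have l2 := S.val_lt (hmem hb) hdA.1 hdi
    have l3 := hdA.2 a (S.mem_cell'.1 (hmem ha)).1
    have l4 := hdA.2 b (S.mem_cell'.1 (hmem hb)).1
    simp only [val, hX, hρa, hρb, hρd] at l1 l2 l3 l4
    push_cast at l1 l2 l3 l4
    linarith
  have h01 : m 0 ≠ m 1 := fun h ↦ absurd (hminj _ _ h) (by decide)
  have h02 : m 0 ≠ m 2 := fun h ↦ absurd (hminj _ _ h) (by decide)
  have h12 : m 1 ≠ m 2 := fun h ↦ absurd (hminj _ _ h) (by decide)
  have b0 := hm1 0; have b0' := hm2 0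
  have b1 := hm1 1; have b1' := hm2 1
  have b2 := hm1 2; have b2' := hm2 2
  by_cases z0 : m 0 = 0
  · exact hzero 0 1 z0 (by omega)
  · by_cases z1 : m 1 = 0
    · exact hzero 1 0 z1 z0
    · exact hzero 2 0 (by omega) z0

/-- An edge between points on a vertical line is dual to an edge in the row of the interior
lattice points. -/
lemma row_eq_zero {p q : ℤ × ℤ} {w w' : ℝ × ℝ} (hpq : p ≠ q) (hw : IsUnitCell (cell P h w))
    (hw' : IsUnitCell (cell P h w')) (hX : S.X w = S.X w') (hY : S.Y w < S.Y w')
    (hp : p ∈ cell P h w) (hq : q ∈ cell P h w) (hp' : p ∈ cell P h w')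
    (hq' : q ∈ cell P h w') : S.ρ p = 0 ∧ S.ρ q = 0 := by
  have hρ : S.ρ p = S.ρ q := by
    have e1 := S.val_eq hp hq
    have e2 := S.val_eq hp' hq'
    simp only [val, hX] at e1 e2
    have h0 : ((S.ρ p : ℝ) - S.ρ q) * (S.Y w' - S.Y w) = 0 := by linarith
    rcases mul_eq_zero.1 h0 with h1 | h1
    · exact_mod_cast sub_eq_zero.1 h1
    · linarith
  have third : ∀ v, IsUnitCell (cell P h v) → p ∈ cell P h v → q ∈ cell P h v →
      ∃ s ∈ cell P h v, S.ρ s ≠ S.ρ p := by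
    intro v hv hpv hqv
    obtain ⟨s, hs, hsp, hsq⟩ := exists_third hv p q
    refine ⟨s, hs, fun hsρ ↦ ?_⟩
    have := S.abs_D hv hpv hqv hs hpq hsp.symm hsq.symm
    simp [D, hsρ, hρ] at this
  have rp := S.row p (S.mem_cell'.1 hp).1
  suffices S.ρ p = 0 from ⟨this, hρ ▸ this⟩
  by_contra hne
  have : S.ρ p = 1 ∨ S.ρ p = -1 := by omega
  -- With increasing `Y` the upper row gains on the others. A vertex of another row that ties with
  -- it at the upper end of the edge would beat it at the lower end. The lower row is symmetric.
  rcases this with h1 | h1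
  · obtain ⟨s, hs, hsρ⟩ := third w' hw' hp' hq'
    have rs := S.row s (S.mem_cell'.1 hs).1
    have e := S.val_eq hp' hs
    have l := (S.mem_cell'.1 hp).2 s (S.mem_cell'.1 hs).1
    simp only [val, hX, h1] at e l
    have : (S.ρ s : ℝ) ≤ 0 := by exact_mod_cast (by omega : S.ρ s ≤ 0)
    push_cast at e l
    nlinarith
  · obtain ⟨s, hs, hsρ⟩ := third w hw hp hq
    have rs := S.row s (S.mem_cell'.1 hs).1
    have e := S.val_eq hp hs
    have l := (S.mem_cell'.1 hp').2 s (S.mem_cell'.1 hs).1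
    simp only [val, hX, h1] at e l
    have : (0 : ℝ) ≤ S.ρ s := by exact_mod_cast (by omega : 0 ≤ S.ρ s)
    push_cast at e l
    nlinarith

/-- The level of a point of the abstract curve. -/
def level (z : (ℝ × ℝ) × Set (Set (ℤ × ℤ))) : ℝ := S.X z.1

open Classical in
/-- The number of times a (straight) edge covers a cut. -/
noncomputable def cover (e : Set (ℤ × ℤ)) (t : ℝ) (b : Bool) : ℕ :=
  if ∃ x y, (boundedCurve P h).IsLink e x y ∧ Below S.level t b x ∧ ¬ Below S.level t b y
  then 1 else 0

lemma cover_eq_one_iff {e : Set (ℤ × ℤ)} {t : ℝ} {b : Bool} : S.cover e t b = 1 ↔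
    ∃ x y, (boundedCurve P h).IsLink e x y ∧ Below S.level t b x ∧ ¬ Below S.level t b y := by
  unfold cover
  split_ifs with h0
  · simpa using h0
  · simpa using h0

lemma cover_le_one {e : Set (ℤ × ℤ)} {t : ℝ} {b : Bool} : S.cover e t b ≤ 1 := by
  unfold cover; split_ifs <;> omega

lemma odd_cover_iff {e : Set (ℤ × ℤ)} {x y : (ℝ × ℝ) × Set (Set (ℤ × ℤ))}
    (hl : (boundedCurve P h).IsLink e x y) (t : ℝ) (b : Bool) : Odd (S.cover e t b) ↔
      ¬ (Below S.level t b x ↔ Below S.level t b y) := by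
  have h1 : Odd (S.cover e t b) ↔ S.cover e t b = 1 := by
    have := S.cover_le_one (e := e) (t := t) (b := b)
    interval_cases S.cover e t b <;> simp
  rw [h1, S.cover_eq_one_iff]
  constructor
  · rintro ⟨x', y', hl', hx, hy⟩
    rcases hl'.eq_and_eq_or_eq_and_eq hl with ⟨rfl, rfl⟩ | ⟨rfl, rfl⟩ <;> tauto
  · intro hne
    by_cases hx : Below S.level t b x
    · exact ⟨x, y, hl, hx, fun hy ↦ hne (by tauto)⟩
    · exact ⟨y, x, hl.symm, by tauto, hx⟩

/-- Flat edges are vertical. -/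
lemma level_eq_of_flat {e : Set (ℤ × ℤ)} {x y : (ℝ × ℝ) × Set (Set (ℤ × ℤ))}
    (hl : (boundedCurve P h).IsLink e x y) (hf : Flat S.cover e) : S.level x = S.level y := by
  have h1 := S.odd_cover_iff hl (S.level x) true
  have h2 := S.odd_cover_iff hl (S.level y) true
  simp only [hf _ _, below_true, le_refl, true_iff, iff_true] at h1 h2
  have h3 : ¬ Odd 0 := by decide
  exact le_antisymm (not_not.1 fun h ↦ h3 (h2.2 h)) (not_not.1 fun h ↦ h3 (h1.2 h))

lemma exists_cell_of_cover {e : Set (ℤ × ℤ)} {x y : (ℝ × ℝ) × Set (Set (ℤ × ℤ))}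
    (hl : (boundedCurve P h).IsLink e x y) {t : ℝ} (hx : S.level x < t) (hy : t < S.level y) :
    ∃ w p q, S.X w = t ∧ cell P h w = e ∧ e = {p, q} ∧ S.ρ p ≠ S.ρ q := by
  obtain ⟨p, q, hpq, rfl⟩ := Set.ncard_eq_two.1 hl.2.2.2.1
  have sx := subset_of_mem_snd hl.1 hl.2.2.2.2.1
  have sy := subset_of_mem_snd hl.2.1 hl.2.2.2.2.2
  have px := sx (Set.mem_insert p _)
  have qx := sx (Set.mem_insert_of_mem p rfl)
  have py := sy (Set.mem_insert p _)
  have qy := sy (Set.mem_insert_of_mem p rfl)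
  simp only [level] at hx hy
  have hpos : 0 < S.X y.1 - S.X x.1 := by linarith
  obtain ⟨w, hwX, hw⟩ := S.cell_between hpq (isUnitCell_of_mem hl.1) (ne_fst_of_isLink hl)
    px qx py qy (s := (t - S.X x.1) / (S.X y.1 - S.X x.1)) (div_pos (by linarith) hpos)
    ((div_lt_one hpos).2 (by linarith))
  refine ⟨w, p, q, ?_, hw, rfl, S.row_ne hpq (by linarith : S.X x.1 ≠ S.X y.1) px qx py qy⟩
  rw [hwX]
  field_simp
  ring

/-- Three edges that cover the same cut all pass over a vertical line close to it, against
`not_three`. -/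
lemma sum_cover_le (t : ℝ) (b : Bool) (s : Finset (Set (ℤ × ℤ))) :
    ∑ e ∈ s, S.cover e t b ≤ 2 := by
  classical
  by_contra! hcon
  have h1 : ∑ e ∈ s, S.cover e t b = (s.filter (fun e ↦ S.cover e t b = 1)).card := by
    rw [Finset.card_filter]
    refine Finset.sum_congr rfl fun e _ ↦ ?_
    have := S.cover_le_one (e := e) (t := t) (b := b)
    split_ifs <;> omega
  rw [h1] at hcon
  obtain ⟨e₀, h0, e₁, h1, e₂, h2, h01, h02, h12⟩ := Finset.two_lt_card.1 hcon
  simp only [Finset.mem_filter, S.cover_eq_one_iff] at h0 h1 h2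
  obtain ⟨-, x₀, y₀, l₀, bx₀, by₀⟩ := h0
  obtain ⟨-, x₁, y₁, l₁, bx₁, by₁⟩ := h1
  obtain ⟨-, x₂, y₂, l₂, bx₂, by₂⟩ := h2
  obtain ⟨r, r0, r1, r2, r0', r1', r2'⟩ : ∃ r, S.level x₀ < r ∧ S.level x₁ < r ∧
      S.level x₂ < r ∧ r < S.level y₀ ∧ r < S.level y₁ ∧ r < S.level y₂ := by
    cases b
    · simp only [below_false, not_lt] at *
      obtain ⟨r, hr1, hr2⟩ := _root_.exists_between (max_lt (max_lt bx₀ bx₁) bx₂)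
      simp only [max_lt_iff] at hr1
      exact ⟨r, hr1.1.1, hr1.1.2, hr1.2, by linarith, by linarith, by linarith⟩
    · simp only [below_true, not_le] at *
      obtain ⟨r, hr1, hr2⟩ := _root_.exists_between (lt_min (lt_min by₀ by₁) by₂)
      simp only [lt_min_iff] at hr2
      exact ⟨r, by linarith, by linarith, by linarith, hr2.1.1, hr2.1.2, hr2.2⟩
  refine S.not_three (t := r) (e := ![e₀, e₁, e₂]) ?_ ?_
  · intro i j hij
    fin_cases i <;> fin_cases j <;> simp_all
  · intro i
    fin_cases i
    · exact S.exists_cell_of_cover l₀ r0 r0'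
    · exact S.exists_cell_of_cover l₁ r1 r1'
    · exact S.exists_cell_of_cover l₂ r2 r2'

/-- The ends of a vertical edge. -/
lemma rows_of_vertical {e : Set (ℤ × ℤ)} {x y : (ℝ × ℝ) × Set (Set (ℤ × ℤ))}
    (hl : (boundedCurve P h).IsLink e x y) (hX : S.level x = S.level y) :
    ∀ a ∈ e, S.ρ a = 0 := by
  obtain ⟨p, q, hpq, rfl⟩ := Set.ncard_eq_two.1 hl.2.2.2.1
  have sx := subset_of_mem_snd hl.1 hl.2.2.2.2.1
  have sy := subset_of_mem_snd hl.2.1 hl.2.2.2.2.2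
  have px := sx (Set.mem_insert p _)
  have qx := sx (Set.mem_insert_of_mem p rfl)
  have py := sy (Set.mem_insert p _)
  have qy := sy (Set.mem_insert_of_mem p rfl)
  have ux := isUnitCell_of_mem hl.1
  have uy := isUnitCell_of_mem hl.2.1
  have : S.ρ p = 0 ∧ S.ρ q = 0 := by
    rcases lt_trichotomy (S.Y x.1) (S.Y y.1) with h1 | h1 | h1
    · exact S.row_eq_zero hpq ux uy hX h1 px qx py qy
    · exact (ne_fst_of_isLink hl (S.eq_of_coords hX h1)).elim
    · exact S.row_eq_zero hpq uy ux hX.symm h1 py qy px qx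
  rintro a (rfl | rfl)
  · exact this.1
  · exact this.2

/-- Both dual segments lie in the middle row, and over one vertical line their points belong to a
common unit cell, which has no three points in a row. -/
lemma eq_of_vertical {e e' : Set (ℤ × ℤ)} {x y x' y' : (ℝ × ℝ) × Set (Set (ℤ × ℤ))}
    (hl : (boundedCurve P h).IsLink e x y) (hl' : (boundedCurve P h).IsLink e' x' y')
    (hX : S.level x = S.level y) (hX' : S.level x' = S.level y') (hxx : S.level x = S.level x') :
    e = e' := by
  have r := S.rows_of_vertical hl hX
  have r' := S.rows_of_vertical hl' hX'
  have sx := subset_of_mem_snd hl.1 hl.2.2.2.2.1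
  have sx' := subset_of_mem_snd hl'.1 hl'.2.2.2.2.1
  have h2 := hl.2.2.2.1
  have h2' := hl'.2.2.2.1
  have ux := isUnitCell_of_mem hl.1
  obtain ⟨p, q, hpq, rfl⟩ := Set.ncard_eq_two.1 h2
  have px := sx (Set.mem_insert p _)
  have qx := sx (Set.mem_insert_of_mem p rfl)
  have rp := r p (Set.mem_insert p _)
  have rq := r q (Set.mem_insert_of_mem p rfl)
  refine (Set.eq_of_subset_of_ncard_le ?_ (by omega) (by simp)).symm
  intro a ha
  have ra := r' a ha
  have hax := S.mem_cell_of_row hxx px (sx' ha) (by omega)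
  by_contra hcon
  simp only [Set.mem_insert_iff, Set.mem_singleton_iff, not_or] at hcon
  have := S.abs_D ux px qx hax hpq (Ne.symm hcon.1) (Ne.symm hcon.2)
  simp [D, rp, rq, ra] at this

lemma covering : Covering (boundedCurve P h) S.level S.cover where
  parity e x y hl t b := S.odd_cover_iff hl t b
  sum_le t b s _ := S.sum_cover_le t b s
  adjacent e x y hl := by
    by_cases hX : S.level x = S.level y
    · left
      intro t b
      have h1 := S.odd_cover_iff hl t b
      have h2 := S.cover_le_one (e := e) (t := t) (b := b)
      have h3 : ¬ Odd (S.cover e t b) := by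
        rw [h1]; cases b <;> simp [hX]
      have := Nat.not_odd_iff_even.1 h3
      interval_cases S.cover e t b
      · rfl
      · exact absurd this (by decide)
    · right
      rcases lt_or_gt_of_ne hX with h1 | h1
      · right
        have : Odd (S.cover e (S.level x) true) := by
          rw [S.odd_cover_iff hl]; simpa using h1
        exact this.pos.ne'
      · left
        have : Odd (S.cover e (S.level x) false) := by
          rw [S.odd_cover_iff hl]; simpa using h1
        exact this.pos.ne'
  flat_unique e e' x y x' y' hl hl' hf hf' hxx :=
    S.eq_of_vertical hl hl' (S.level_eq_of_flat hl hf) (S.level_eq_of_flat hl' hf') hxx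
  flat_ne e x hl _ := hl.2.2.1 rfl

lemma finite_curvePoints (S : Strip P h) : (curvePoints P h).Finite := by
  have hfin : (Set.powerset (latticePoints P) ×ˢ
      Set.powerset (Set.powerset (latticePoints P))).Finite :=
    S.fin.powerset.prod S.fin.powerset.powerset
  refine Set.Finite.of_finite_image (f := fun x ↦ (cell P h x.1, x.2)) (hfin.subset ?_) ?_
  · rintro _ ⟨x, hx, rfl⟩
    refine ⟨fun a ha ↦ ha.1, fun e he a ha ↦ (subset_of_mem_snd hx he ha).1⟩
  · intro x hx y hy hxy
    simp only [Prod.mk.injEq] at hxy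
    obtain ⟨p, u, v, hd, h1⟩ := exists_noncollinear hx
    have h2 := h1
    rw [hxy.1] at h2
    exact Prod.ext (eq_of_noncollinear hd h1 h2) hxy.2

lemma finite_edgeSet (S : Strip P h) : E(boundedCurve P h).Finite := by
  refine S.fin.powerset.subset fun e he a ha ↦ ?_
  obtain ⟨x, y, hl⟩ := Graph.exists_isLink_of_mem_edgeSet he
  exact (subset_of_mem_snd hl.1 hl.2.2.2.2.1 ha).1

end Strip

lemma ncard_snd_le {P : Set (ℝ × ℝ)} {h : ℤ × ℤ → ℝ} {z : (ℝ × ℝ) × Set (Set (ℤ × ℤ))}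
    (hz : z ∈ curvePoints P h) : z.2.ncard ≤ 3 ∧ z.2.Finite := by
  rcases hz with ⟨⟨p, u, v, hd, hc⟩, hz⟩ | ⟨-, e, he, hz⟩
  · have hsub : z.2 ⊆ {{p, p + u}, {p, p + v}, {p + u, p + v}} := by
      intro e he
      rw [hz] at he
      obtain ⟨a, b, hab, rfl⟩ := Set.ncard_eq_two.1 he.2.1
      have h1 := he.1
      rw [hc, Set.insert_subset_iff, Set.singleton_subset_iff] at h1
      obtain ⟨ha, hb⟩ := h1
      simp only [Set.mem_insert_iff, Set.mem_singleton_iff] at ha hb ⊢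
      rcases ha with rfl | rfl | rfl <;> rcases hb with rfl | rfl | rfl <;>
        first
        | exact (hab rfl).elim
        | simp [Set.pair_comm]
    refine ⟨(Set.ncard_le_ncard hsub (by simp)).trans ?_, Set.Finite.subset (by simp) hsub⟩
    refine (Set.ncard_insert_le _ _).trans ?_
    have := Set.ncard_insert_le ({p, p + v} : Set (ℤ × ℤ)) {{p + u, p + v}}
    simp only [Set.ncard_singleton] at this
    omega
  · rw [hz]
    refine ⟨(Set.ncard_insert_le _ _).trans (by simp), by simp⟩

lemma sum_incidence_le {P : Set (ℝ × ℝ)} {h : ℤ × ℤ → ℝ} (z : (ℝ × ℝ) × Set (Set (ℤ × ℤ)))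
    (s : Finset (Set (ℤ × ℤ))) : ∑ e ∈ s, incidence (boundedCurve P h) e z ≤ 3 := by
  classical
  by_cases hz : z ∈ curvePoints P h
  · obtain ⟨h3, hfin⟩ := ncard_snd_le hz
    have h1 : ∀ e, incidence (boundedCurve P h) e z ≤ if e ∈ z.2 then 1 else 0 := by
      intro e
      by_cases he : (boundedCurve P h).Inc e z
      · rw [incidence_of_inc he fun hl ↦ hl.2.2.1 rfl]
        obtain ⟨y, hl⟩ := he
        simp [hl.2.2.2.2.1]
      · rw [incidence_of_not_inc he]; exact Nat.zero_le _
    refine (Finset.sum_le_sum fun e _ ↦ h1 e).trans ?_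
    rw [← Finset.card_filter]
    refine le_trans ?_ h3
    rw [Set.ncard_eq_toFinset_card _ hfin]
    refine Finset.card_le_card fun e he ↦ ?_
    rw [Set.Finite.mem_toFinset]
    exact (Finset.mem_filter.1 he).2
  · rw [Finset.sum_eq_zero]
    · omega
    · intro e _
      refine incidence_of_not_inc fun ⟨y, hl⟩ ↦ hz hl.1

end NodalCurve

namespace NodalCurve

namespace Strip

variable {P : Set (ℝ × ℝ)} {h : ℤ × ℤ → ℝ} (S : Strip P h)

/-! ### Sides of unit cells and the edges dual to them -/

lemma D_self_right (p q : ℤ × ℤ) : S.D p q q = 0 := by simp only [D]; ring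

lemma D_self_left (p q : ℤ × ℤ) : S.D p q p = 0 := by simp [D]

/-- Moving away from a polygon in the direction orthogonal to its side `p q`. -/
lemma exists_shift (w : ℝ × ℝ) (p q : ℤ × ℤ) (ε : ℝ) : ∃ v : ℝ × ℝ,
    S.X v = S.X w + ε * (S.ρ p - S.ρ q) ∧
    ∀ a, S.val a v - S.val p v = S.val a w - S.val p w + ε * S.D p q a := by
  refine ⟨S.W (S.X w + ε * (S.ρ p - S.ρ q)) (S.Y w + ε * (S.c q - S.c p)), S.X_W _ _, fun a ↦ ?_⟩
  simp only [val, D, S.X_W, S.Y_W]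
  push_cast
  ring

/-- A side of a cell is a cell. -/
lemma exists_cell_eq_pair {w : ℝ × ℝ} {p q : ℤ × ℤ} (hp : p ∈ cell P h w) (hq : q ∈ cell P h w)
    (hs : ∀ s ∈ cell P h w, s ≠ p → s ≠ q → S.D p q s < 0) : ∃ v, cell P h v = {p, q} := by
  -- After a small shift across the side, the points outside the cell are still below `p`, and in
  -- the cell all points but `q` fall behind `p`.
  have hev : ∀ᶠ ε in nhdsWithin (0 : ℝ) (Set.Ioi 0), ∀ a ∈ latticePoints P, a ∉ cell P h w →
      ε * S.D p q a < S.val p w - S.val a w := by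
    refine (Filter.eventually_all_finite S.fin).2 fun a ha ↦ ?_
    by_cases haw : a ∈ cell P h w
    · exact Filter.Eventually.of_forall fun _ h ↦ (h haw).elim
    have hlt := sub_pos.2 (S.val_lt hp ha haw)
    have hc : Filter.Tendsto (fun ε : ℝ ↦ ε * S.D p q a) (nhds 0) (nhds (0 * S.D p q a)) :=
      (Continuous.tendsto (by fun_prop) 0)
    rw [zero_mul] at hc
    filter_upwards [nhdsWithin_le_nhds (hc.eventually_lt_const hlt)] with ε h1 _ using h1
  obtain ⟨ε, hε, hε0⟩ := (hev.and self_mem_nhdsWithin).exists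
  obtain ⟨v, -, hv⟩ := S.exists_shift w p q ε
  refine ⟨v, ?_⟩
  have hε0 : 0 < ε := hε0
  have hlt : ∀ a ∈ latticePoints P, a ≠ p → a ≠ q → S.val a v < S.val p v := by
    intro a ha hap haq
    have e := hv a
    by_cases haw : a ∈ cell P h w
    · have h1 := S.val_eq haw hp
      have h2 : (S.D p q a : ℝ) < 0 := by exact_mod_cast hs a haw hap haq
      nlinarith
    · have := hε a ha haw
      linarith
  have hpA := (S.mem_cell'.1 hp).1
  have hqA := (S.mem_cell'.1 hq).1
  have hqv : S.val q v = S.val p v := by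
    have e := hv q
    rw [D_self_right, S.val_eq hq hp] at e
    simp only [Int.cast_zero, mul_zero] at e
    linarith
  have hmax : ∀ a ∈ latticePoints P, S.val a v ≤ S.val p v := by
    intro a ha
    by_cases hap : a = p
    · rw [hap]
    by_cases haq : a = q
    · rw [haq, hqv]
    exact (hlt a ha hap haq).le
  ext a
  rw [S.mem_cell']
  constructor
  · rintro ⟨haA, ha⟩
    by_contra hcon
    simp only [Set.mem_insert_iff, Set.mem_singleton_iff, not_or] at hcon
    have := hlt a haA hcon.1 hcon.2
    linarith [ha p hpA]
  · rintro (rfl | rfl)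
    · exact ⟨hpA, hmax⟩
    · exact ⟨hqA, fun b hb ↦ (hmax b hb).trans hqv.ge⟩

/-- If there are lattice points beyond a side of a cell, then the edge dual to the side has
another end. -/
lemma exists_neighbour {w : ℝ × ℝ} {p q : ℤ × ℤ} (hp : p ∈ cell P h w) (hq : q ∈ cell P h w)
    (hs : ∀ s ∈ cell P h w, s ≠ p → s ≠ q → S.D p q s < 0)
    (hA : ∃ a ∈ latticePoints P, 0 < S.D p q a) : ∃ v ε, 0 < ε ∧
      S.X v = S.X w + ε * (S.ρ p - S.ρ q) ∧ p ∈ cell P h v ∧ q ∈ cell P h v ∧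
      ∃ a ∈ cell P h v, 0 < S.D p q a := by
  classical
  have hnot : ∀ a, 0 < S.D p q a → a ∉ cell P h w := by
    intro a ha haw
    by_cases hap : a = p
    · rw [hap, D_self_left] at ha; exact lt_irrefl _ ha
    by_cases haq : a = q
    · rw [haq, D_self_right] at ha; exact lt_irrefl _ ha
    exact absurd (hs a haw hap haq) (by omega)
  -- The dual edge is followed until the first point beyond the side ties with `p`: `ε` is the least
  -- quotient of the deficit by the rate of gain.
  obtain ⟨a, ⟨haA, haD⟩, hmin⟩ := Set.exists_min_image {a ∈ latticePoints P | 0 < S.D p q a}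
    (fun a ↦ (S.val p w - S.val a w) / S.D p q a) (S.fin.subset (Set.sep_subset _ _)) hA
  have haD' : (0 : ℝ) < S.D p q a := by exact_mod_cast haD
  set ε := (S.val p w - S.val a w) / S.D p q a with hε
  have hgap := sub_pos.2 (S.val_lt hp haA (hnot a haD))
  have hε0 : 0 < ε := div_pos hgap haD'
  obtain ⟨v, hvX, hv⟩ := S.exists_shift w p q ε
  have hpA := S.mem_cell'.1 hp
  have hpv : p ∈ cell P h v := by
    rw [S.mem_cell']
    refine ⟨hpA.1, fun b hb ↦ ?_⟩
    have e := hv b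
    have l := hpA.2 b hb
    rcases lt_or_ge 0 (S.D p q b) with hD | hD
    · have hD' : (0 : ℝ) < S.D p q b := by exact_mod_cast hD
      have := hmin b ⟨hb, hD⟩
      rw [le_div_iff₀ hD'] at this
      linarith
    · have hD' : (S.D p q b : ℝ) ≤ 0 := by exact_mod_cast hD
      nlinarith
  refine ⟨v, ε, hε0, hvX, hpv, ?_, a, ?_, haD⟩
  · refine S.mem_cell_of_le hpv (S.mem_cell'.1 hq).1 ?_
    have e := hv q
    rw [D_self_right, S.val_eq hq hp] at e
    simp only [Int.cast_zero, mul_zero] at e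
    linarith
  · refine S.mem_cell_of_le hpv haA ?_
    have e := hv a
    rw [hε, div_mul_cancel₀ _ haD'.ne'] at e
    linarith

/-- Over each unit cell and each of its sides there is a point of the abstract curve. -/
lemma exists_point {w : ℝ × ℝ} (hw : IsUnitCell (cell P h w)) {e : Set (ℤ × ℤ)}
    (he : e ∈ sides P h w) : ∃ z ∈ curvePoints P h, z.1 = w ∧ e ∈ z.2 := by
  rcases hw with ht | hp
  · exact ⟨(w, sides P h w), Or.inl ⟨ht, rfl⟩, rfl, he⟩
  · exact ⟨(w, {e, cell P h w \ e}), Or.inr ⟨hp, e, he, rfl⟩, rfl, Or.inl rfl⟩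

/-- The edge dual to `e` leaves the point dual to the cell of `w` to the right. -/
def RightSide (w : ℝ × ℝ) (e : Set (ℤ × ℤ)) : Prop :=
  ∃ p q, e = {p, q} ∧ S.ρ q < S.ρ p ∧ ∀ s ∈ cell P h w, s ≠ p → s ≠ q → S.D p q s < 0

lemma pair_unique {p q p' q' : ℤ × ℤ} (he : ({p, q} : Set (ℤ × ℤ)) = {p', q'})
    (h1 : S.ρ q < S.ρ p) (h2 : S.ρ q' < S.ρ p') : p = p' ∧ q = q' := by
  have hp : p ∈ ({p', q'} : Set (ℤ × ℤ)) := he ▸ Set.mem_insert _ _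
  have hq : q ∈ ({p', q'} : Set (ℤ × ℤ)) := he ▸ Set.mem_insert_of_mem _ rfl
  rcases hp with rfl | hp <;> rcases hq with rfl | hq
  · exact (lt_irrefl _ h1).elim
  · exact ⟨rfl, hq⟩
  · rw [Set.mem_singleton_iff.1 hp] at h1
    exact (lt_asymm h1 h2).elim
  · rw [Set.mem_singleton_iff.1 hp, Set.mem_singleton_iff.1 hq] at h1
    exact (lt_irrefl _ h1).elim

/-- An edge leaves at most one point to the right. -/
lemma eq_of_rightSide {w w' : ℝ × ℝ} {e : Set (ℤ × ℤ)} (hw : IsUnitCell (cell P h w))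
    (hw' : IsUnitCell (cell P h w')) (he : e ⊆ cell P h w) (he' : e ⊆ cell P h w')
    (hr : S.RightSide w e) (hr' : S.RightSide w' e) : w = w' := by
  obtain ⟨p, q, rfl, hρ, hs⟩ := hr
  obtain ⟨p', q', hpq, hρ', hs'⟩ := hr'
  obtain ⟨rfl, rfl⟩ := S.pair_unique hpq hρ hρ'
  have hp := he (Set.mem_insert _ _)
  have hq := he (Set.mem_insert_of_mem _ rfl)
  have hp' := he' (Set.mem_insert _ _)
  have hq' := he' (Set.mem_insert_of_mem _ rfl)
  obtain ⟨s, hsw, hsp, hsq⟩ := exists_third hw p q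
  obtain ⟨s', hsw', hsp', hsq'⟩ := exists_third hw' p q
  have d1 : (S.D p q s : ℝ) < 0 := by exact_mod_cast hs s hsw hsp hsq
  have d2 : (S.D p q s' : ℝ) < 0 := by exact_mod_cast hs' s' hsw' hsp' hsq'
  have e1 := S.val_eq hp hq
  have e2 := S.val_eq hp' hq'
  have e3 := S.val_eq hp hsw
  have e4 := S.val_eq hp' hsw'
  have l1 := (S.mem_cell'.1 hp).2 s' (S.mem_cell'.1 hsw').1
  have l2 := (S.mem_cell'.1 hp').2 s (S.mem_cell'.1 hsw).1
  have hpos : (0 : ℝ) < S.ρ p - S.ρ q := by exact_mod_cast sub_pos.2 hρ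
  simp only [val] at e1 e2 e3 e4 l1 l2
  simp only [D] at d1 d2
  push_cast at d1 d2
  set x := S.X w' - S.X w with hx
  set y := S.Y w' - S.Y w with hy
  -- The displacement `(x, y)` from `w` to `w'` is orthogonal to `p - q`. The third vertex `s'` of
  -- the second cell is not above `p` at `w`, which gives `x ≤ 0`; likewise `s` gives `0 ≤ x`.
  have f1 : ((S.c p : ℝ) - S.c q) * x + (S.ρ p - S.ρ q) * y = 0 := by rw [hx, hy]; linarith
  have f2 : 0 ≤ ((S.c s' : ℝ) - S.c p) * x + (S.ρ s' - S.ρ p) * y := by rw [hx, hy]; linarith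
  have f3 : ((S.c s : ℝ) - S.c p) * x + (S.ρ s - S.ρ p) * y ≤ 0 := by rw [hx, hy]; linarith
  have g2 : 0 ≤ x * (((S.c q : ℝ) - S.c p) * (S.ρ s' - S.ρ p) -
      (S.ρ q - S.ρ p) * (S.c s' - S.c p)) := by
    have := mul_nonneg hpos.le f2
    linear_combination this + (S.ρ s' - S.ρ p) * f1
  have g3 : x * (((S.c q : ℝ) - S.c p) * (S.ρ s - S.ρ p) -
      (S.ρ q - S.ρ p) * (S.c s - S.c p)) ≤ 0 := by
    have := mul_nonneg hpos.le (sub_nonneg.2 f3)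
    linear_combination this - (S.ρ s - S.ρ p) * f1
  have hx1 : x ≤ 0 := by
    by_contra! hc
    nlinarith [mul_neg_of_pos_of_neg hc d2]
  have hx2 : 0 ≤ x := by
    by_contra! hc
    nlinarith [mul_pos_of_neg_of_neg hc d1]
  have hx0 : x = 0 := le_antisymm hx1 hx2
  have hy0 : y = 0 := by
    rw [hx0] at f1
    rcases mul_eq_zero.1 (by linarith : ((S.ρ p : ℝ) - S.ρ q) * y = 0) with h0 | h0
    · linarith
    · exact h0
  exact S.eq_of_coords (by linarith) (by linarith)

lemma rightSide_of_triangle {w : ℝ × ℝ} {p q s : ℤ × ℤ} (hc : cell P h w = {p, q, s})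
    (hρ : S.ρ q < S.ρ p) (hD : S.D p q s < 0) :
    ({p, q} : Set (ℤ × ℤ)) ∈ sides P h w ∧ S.RightSide w {p, q} := by
  have hs : ∀ s ∈ cell P h w, s ≠ p → s ≠ q → S.D p q s < 0 := by
    intro a ha hap haq
    rw [hc] at ha
    rcases ha with rfl | rfl | ha
    · exact (hap rfl).elim
    · exact (haq rfl).elim
    · rw [Set.mem_singleton_iff.1 ha]; exact hD
  refine ⟨⟨?_, Set.ncard_pair (fun h ↦ by rw [h] at hρ; exact lt_irrefl _ hρ), ?_⟩, p, q, rfl, hρ,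
    hs⟩
  · rw [hc]; intro x hx
    simp only [Set.mem_insert_iff, Set.mem_singleton_iff] at hx ⊢
    tauto
  · exact S.exists_cell_eq_pair (by simp [hc]) (by simp [hc]) hs

lemma D_swap (p q s : ℤ × ℤ) : S.D p s q = -S.D p q s := by simp only [D]; ring

lemma D_swap' (p q s : ℤ × ℤ) : S.D s q p = -S.D p q s := by simp only [D]; ring

/-- Each triangle has a side through which an edge leaves to the right. -/
lemma exists_rightSide_of_triangle {w : ℝ × ℝ} (hw : IsUnitTriangle (cell P h w)) :
    ∃ e ∈ sides P h w, S.RightSide w e := by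
  obtain ⟨b, u, v, hd, hc⟩ := hw
  have hD : S.D b (b + u) (b + v) = 1 ∨ S.D b (b + u) (b + v) = -1 := by
    rw [D_eq, add_sub_cancel_left, add_sub_cancel_left]; exact eq_or_eq_neg_of_abs_eq hd
  clear hd
  generalize b + u = x at hc hD
  generalize b + v = y at hc hD
  -- order the vertices by rows
  have key : ∀ p q s, cell P h w = {p, q, s} → S.ρ q < S.ρ p → S.ρ q ≤ S.ρ s → S.ρ s ≤ S.ρ p →
      S.D p q s ≠ 0 → ∃ e ∈ sides P h w, S.RightSide w e := by
    intro p q s hc h1 h2 h3 hne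
    -- If `s` is to the left of the long side `p q`, this side faces right. Otherwise both other
    -- sides face right as far as they are not in a row, and one of them is not.
    rcases lt_or_gt_of_ne hne with h0 | h0
    · exact ⟨_, S.rightSide_of_triangle hc h1 h0⟩
    · rcases h3.lt_or_eq with h4 | h4
      · refine ⟨_, S.rightSide_of_triangle (p := p) (q := s) (s := q) ?_ h4 ?_⟩
        · rw [hc, Set.pair_comm]
        · rw [D_swap]; omega
      · refine ⟨_, S.rightSide_of_triangle (p := s) (q := q) (s := p) ?_ (by omega) ?_⟩
        · rw [hc]; ext; simp; tauto
        · rw [D_swap']; omega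
  have hx : cell P h w = {b, y, x} := by rw [hc, Set.pair_comm]
  have hrow : ¬ (S.ρ b = S.ρ x ∧ S.ρ b = S.ρ y) := by
    rintro ⟨h1, h2⟩
    simp only [D, ← h1, ← h2] at hD
    omega
  have e1 : cell P h w = {x, b, y} := by rw [hc, Set.insert_comm]
  have e2 : cell P h w = {x, y, b} := by rw [e1, Set.pair_comm]
  have e3 : cell P h w = {y, b, x} := by rw [hx, Set.insert_comm]
  have e4 : cell P h w = {y, x, b} := by rw [e3, Set.pair_comm]
  have D1 : S.D b y x ≠ 0 := by rw [D_swap]; omega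
  have D2 : S.D y x b ≠ 0 := by rw [D_swap' ]; omega
  have D3 : S.D y b x ≠ 0 := by rw [D_swap]; omega
  have D4 : S.D x b y ≠ 0 := by rw [D_swap']; exact neg_ne_zero.2 D3
  have D5 : S.D x y b ≠ 0 := by rw [D_swap]; exact neg_ne_zero.2 D4
  by_cases a1 : S.ρ b ≤ S.ρ x <;> by_cases a2 : S.ρ b ≤ S.ρ y <;> by_cases a3 : S.ρ x ≤ S.ρ y
  · exact key y b x e3 (by omega) (by omega) (by omega) D3
  · exact key x b y e1 (by omega) (by omega) (by omega) D4
  · omega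
  · exact key x y b e2 (by omega) (by omega) (by omega) D5
  · exact key y x b e4 (by omega) (by omega) (by omega) D2
  · omega
  · exact key b x y hc (by omega) (by omega) (by omega) (by omega)
  · exact key b y x hx (by omega) (by omega) (by omega) D1

/-- The diagonals of a cell of which both ends lie on a side are sides. -/
lemma mem_cell_of_diagonal {w w' : ℝ × ℝ} {a b r s : ℤ × ℤ} (ha : a ∈ cell P h w)
    (hb : b ∈ cell P h w) (hr : r ∈ cell P h w) (hs : s ∈ cell P h w)
    (hc : S.c a + S.c b = S.c r + S.c s) (hρ : S.ρ a + S.ρ b = S.ρ r + S.ρ s)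
    (ha' : a ∈ cell P h w') (hb' : b ∈ cell P h w') : r ∈ cell P h w' := by
  refine S.mem_cell_of_le ha' (S.mem_cell'.1 hr).1 ?_
  have e1 := S.val_eq ha hb
  have e2 := S.val_eq ha hr
  have e3 := S.val_eq ha hs
  have e4 := S.val_eq ha' hb'
  have l := (S.mem_cell'.1 ha').2 s (S.mem_cell'.1 hs).1
  have hc' : (S.c a : ℝ) + S.c b = S.c r + S.c s := by exact_mod_cast hc
  have hρ' : (S.ρ a : ℝ) + S.ρ b = S.ρ r + S.ρ s := by exact_mod_cast hρ
  simp only [val] at *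
  have hX : ((S.c a : ℝ) + S.c b) * (S.X w' - S.X w) = (S.c r + S.c s) * (S.X w' - S.X w) := by
    rw [hc']
  have hY : ((S.ρ a : ℝ) + S.ρ b) * (S.Y w' - S.Y w) = (S.ρ r + S.ρ s) * (S.Y w' - S.Y w) := by
    rw [hρ']
  linarith

/-- A parallelogram, seen from one of its sides `p q`. -/
lemma exists_opposite_side {w : ℝ × ℝ} (hw : IsUnitParallelogram (cell P h w))
    {e : Set (ℤ × ℤ)} (he : e ∈ sides P h w) : ∃ p q r s : ℤ × ℤ, cell P h w = {p, q, r, s} ∧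
      p ≠ q ∧ p ≠ r ∧ p ≠ s ∧ q ≠ r ∧ q ≠ s ∧ r ≠ s ∧ S.c p + S.c s = S.c q + S.c r ∧
      S.ρ p + S.ρ s = S.ρ q + S.ρ r ∧ e = {p, q} ∧ cell P h w \ e = {r, s} := by
  obtain ⟨b, u, v, hd, hc⟩ := hw
  obtain ⟨hsub, h2, w', hw'⟩ := he
  obtain ⟨x, y, hxy, rfl⟩ := Set.ncard_eq_two.1 h2
  have hu : u ≠ 0 := by rintro rfl; simp [det] at hd
  have hv : v ≠ 0 := by rintro rfl; simp [det] at hd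
  have huv : u ≠ v := by rintro rfl; simp [det, mul_comm] at hd
  have huv' : u + v ≠ 0 := by
    intro h0
    rw [eq_neg_of_add_eq_zero_left h0] at hd
    simp [det, mul_comm] at hd
  have n1 : b ≠ b + u := by simpa using hu
  have n2 : b ≠ b + v := by simpa using hv
  have n3 : b ≠ b + u + v := by simpa [add_assoc] using huv'
  have n4 : b + u ≠ b + v := by simpa using huv
  have n5 : b + u ≠ b + u + v := by simpa using hv
  have n6 : b + v ≠ b + u + v := by rw [add_right_comm]; simpa using hu
  have hcs : S.c b + S.c (b + u + v) = S.c (b + u) + S.c (b + v) := by rw [S.c_add]; ring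
  have hρs : S.ρ b + S.ρ (b + u + v) = S.ρ (b + u) + S.ρ (b + v) := by rw [S.ρ_add]; ring
  generalize b + u + v = d at hc n3 n5 n6 hcs hρs
  generalize b + u = x₁ at hc n1 n4 n5 hcs hρs
  generalize b + v = x₂ at hc n2 n4 n6 hcs hρs
  have build : ∀ p q r s, cell P h w = {p, q, r, s} → p ≠ q → p ≠ r → p ≠ s → q ≠ r → q ≠ s →
      r ≠ s → S.c p + S.c s = S.c q + S.c r → S.ρ p + S.ρ s = S.ρ q + S.ρ r →
      ∃ p' q' r' s' : ℤ × ℤ, cell P h w = {p', q', r', s'} ∧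
      p' ≠ q' ∧ p' ≠ r' ∧ p' ≠ s' ∧ q' ≠ r' ∧ q' ≠ s' ∧ r' ≠ s' ∧
      S.c p' + S.c s' = S.c q' + S.c r' ∧
      S.ρ p' + S.ρ s' = S.ρ q' + S.ρ r' ∧ ({p, q} : Set (ℤ × ℤ)) = {p', q'} ∧
      cell P h w \ {p, q} = {r', s'} := by
    intro p q r s hc h1 h2 h3 h4 h5 h6 h7 h8
    refine ⟨p, q, r, s, hc, h1, h2, h3, h4, h5, h6, h7, h8, rfl, ?_⟩
    rw [hc]
    ext x
    simp only [Set.mem_sdiff, Set.mem_insert_iff, Set.mem_singleton_iff, not_or]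
    constructor
    · tauto
    · rintro (rfl | rfl)
      · exact ⟨by tauto, h2.symm, h4.symm⟩
      · exact ⟨by tauto, h3.symm, h5.symm⟩
  -- A cell that contains both ends of a diagonal contains the whole parallelogram, so a diagonal is
  -- not an edge of the subdivision.
  have diag : ∀ p q r s, cell P h w = {p, r, s, q} → p ≠ r → q ≠ r →
      S.c p + S.c q = S.c r + S.c s → S.ρ p + S.ρ q = S.ρ r + S.ρ s →
      ({x, y} : Set (ℤ × ℤ)) ≠ {p, q} := by
    intro p q r s hc h1 h2 h3 h4 h5
    have := S.mem_cell_of_diagonal (w := w) (w' := w') (a := p) (b := q) (r := r) (s := s)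
      (by simp [hc]) (by simp [hc]) (by simp [hc]) (by simp [hc]) h3 h4 (by simp [hw', h5])
      (by simp [hw', h5])
    rw [hw', h5] at this
    rcases this with h0 | h0
    · exact h1 h0.symm
    · exact h2 (Set.mem_singleton_iff.1 h0).symm
  have hx : x ∈ cell P h w := hsub (Set.mem_insert _ _)
  have hy : y ∈ cell P h w := hsub (Set.mem_insert_of_mem _ rfl)
  have q1 : cell P h w = {x₁, b, d, x₂} := by rw [hc]; ext; simp; tauto
  have q2 : cell P h w = {x₂, b, d, x₁} := by rw [hc]; ext; simp; tauto
  have q3 : cell P h w = {b, x₂, x₁, d} := by rw [hc]; ext; simp; tauto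
  have q4 : cell P h w = {x₁, d, b, x₂} := by rw [hc]; ext; simp; tauto
  have q5 : cell P h w = {d, x₁, x₂, b} := by rw [hc]; ext; simp; tauto
  have q6 : cell P h w = {x₂, d, b, x₁} := by rw [hc]; ext; simp; tauto
  have q7 : cell P h w = {d, x₂, x₁, b} := by rw [hc]; ext; simp; tauto
  have g1 := diag b d x₁ x₂ hc n1 n5.symm hcs hρs
  have g2 := diag x₁ x₂ b d q1 n1.symm n2.symm hcs.symm hρs.symm
  rw [hc] at hx hy
  simp only [Set.mem_insert_iff, Set.mem_singleton_iff] at hx hy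
  rcases hx with rfl | rfl | rfl | rfl <;> rcases hy with rfl | rfl | rfl | rfl
  · exact (hxy rfl).elim
  · exact build _ _ _ _ hc ‹_› ‹_› ‹_› ‹_› ‹_› ‹_› hcs hρs
  · exact build _ _ _ _ q3 n2 n1 n3 n4.symm n6 n5 (by omega) (by omega)
  · exact (g1 rfl).elim
  · exact build _ _ _ _ q1 n1.symm n5 n4 n3 n2 n6.symm (by omega) (by omega)
  · exact (hxy rfl).elim
  · exact (g2 rfl).elim
  · exact build _ _ _ _ q4 n5 n1.symm n4 n3.symm n6.symm n2 (by omega) (by omega)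
  · exact build _ _ _ _ q2 n2.symm n6 n4.symm n3 n1 n5.symm (by omega) (by omega)
  · exact (g2 (Set.pair_comm _ _)).elim
  · exact (hxy rfl).elim
  · exact build _ _ _ _ q6 n6 n2.symm n4.symm n3.symm n5.symm n1 (by omega) (by omega)
  · exact (g1 (Set.pair_comm _ _)).elim
  · exact build _ _ _ _ q5 n5.symm n6.symm n3.symm n4 n1.symm n2.symm (by omega) (by omega)
  · exact build _ _ _ _ q7 n6.symm n5.symm n3.symm n4.symm n2.symm n1.symm (by omega) (by omega)
  · exact (hxy rfl).elim

/-- A branch through a parallelogram is flat if its two edges are dual to edges in rows. -/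
def FlatPoint (z : (ℝ × ℝ) × Set (Set (ℤ × ℤ))) : Prop :=
  IsUnitParallelogram (cell P h z.1) ∧ ∀ e ∈ z.2, ∀ a ∈ e, ∀ b ∈ e, S.ρ a = S.ρ b

/-- At a node, the two edges of a branch are dual to opposite sides of the parallelogram, and one of
these faces right unless they lie in rows. -/
lemma exists_rightSide {z : (ℝ × ℝ) × Set (Set (ℤ × ℤ))} (hz : z ∈ curvePoints P h)
    (hf : ¬ S.FlatPoint z) : ∃ e ∈ z.2, S.RightSide z.1 e := by
  rcases hz with ⟨ht, hz⟩ | ⟨hp, e, he, hz⟩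
  · rw [hz]; exact S.exists_rightSide_of_triangle ht
  obtain ⟨p, q, r, s, hc, hpq, hpr, hps, hqr, hqs, hrs, hcs, hρs, rfl, hd⟩ :=
    S.exists_opposite_side hp he
  rw [hz, hd]
  have hρ : S.ρ p ≠ S.ρ q := by
    intro hρ
    refine hf ⟨hp, ?_⟩
    rw [hz, hd]
    rintro e (rfl | rfl)
    · rintro a (rfl | rfl) b (rfl | rfl) <;> omega
    · rintro a (rfl | rfl) b (rfl | rfl) <;> omega
  have key : ∀ p q r s, cell P h z.1 = {p, q, r, s} → p ≠ q → p ≠ r → q ≠ r →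
      S.c p + S.c s = S.c q + S.c r → S.ρ p + S.ρ s = S.ρ q + S.ρ r → S.ρ q < S.ρ p →
      ∃ e ∈ ({{p, q}, {r, s}} : Set (Set (ℤ × ℤ))), S.RightSide z.1 e := by
    intro p q r s hc hpq hpr hqr hcs hρs hρ
    have hD := eq_or_eq_neg_of_abs_eq (S.abs_D (Or.inr hp) (p := p) (q := q) (s := r)
      (by simp [hc]) (by simp [hc]) (by simp [hc]) hpq hpr hqr)
    have es : S.c s = S.c q + S.c r - S.c p := by omega
    have eρ : S.ρ s = S.ρ q + S.ρ r - S.ρ p := by omega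
    have d1 : S.D p q s = S.D p q r := by simp only [D, es, eρ]; ring
    have d2 : S.D r s p = -S.D p q r := by simp only [D, es, eρ]; ring
    have d3 : S.D r s q = -S.D p q r := by simp only [D, es, eρ]; ring
    rcases hD with hD | hD
    · refine ⟨_, Or.inr rfl, r, s, rfl, by omega, fun a ha har has ↦ ?_⟩
      rw [hc] at ha
      rcases ha with rfl | rfl | rfl | rfl
      · omega
      · omega
      · exact (har rfl).elim
      · exact (has rfl).elim
    · refine ⟨_, Or.inl rfl, p, q, rfl, hρ, fun a ha hap haq ↦ ?_⟩
      rw [hc] at ha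
      rcases ha with rfl | rfl | rfl | rfl
      · exact (hap rfl).elim
      · exact (haq rfl).elim
      · omega
      · omega
  rcases lt_or_gt_of_ne hρ with h1 | h1
  · have := key q p s r (by rw [hc]; ext; simp; tauto) hpq.symm hqs hps (by omega) (by omega) h1
    rwa [Set.pair_comm q p, Set.pair_comm s r] at this
  · exact key p q r s hc hpq hpr hqr hcs hρs h1

lemma FlatPoint.rows {S : Strip P h} {z : (ℝ × ℝ) × Set (Set (ℤ × ℤ))}
    (hf : S.FlatPoint z) (hz : z ∈ curvePoints P h) :
    ∃ p q r s : ℤ × ℤ, cell P h z.1 = {p, q, r, s} ∧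
      z.2 = {{p, q}, {r, s}} ∧ S.ρ p = S.ρ q ∧ S.ρ r = S.ρ s ∧ S.ρ p ≠ S.ρ r := by
  rcases hz with ⟨ht, -⟩ | ⟨hp, e, he, hz⟩
  · exact (not_triangle_parallelogram ht hf.1).elim
  obtain ⟨p, q, r, s, hc, hpq, hpr, hps, hqr, hqs, hrs, hcs, hρs, rfl, hd⟩ :=
    S.exists_opposite_side hp he
  rw [hd] at hz
  have h1 := hf.2 {p, q} (by simp [hz]) p (by simp) q (by simp)
  have h2 := hf.2 {r, s} (by simp [hz]) r (by simp) s (by simp)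
  refine ⟨p, q, r, s, hc, hz, h1, h2, fun h3 ↦ ?_⟩
  have hD := S.abs_D (Or.inr hp) (p := p) (q := q) (s := r)
      (by simp [hc]) (by simp [hc]) (by simp [hc]) hpq hpr hqr
  simp [D, ← h1, ← h3] at hD

/-- At most one of the two branches through a parallelogram is flat. -/
lemma FlatPoint.eq {S : Strip P h} {z z' : (ℝ × ℝ) × Set (Set (ℤ × ℤ))} (hf : S.FlatPoint z)
    (hf' : S.FlatPoint z') (hz : z ∈ curvePoints P h) (hz' : z' ∈ curvePoints P h)
    (hc : cell P h z.1 = cell P h z'.1) : z = z' := by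
  obtain ⟨a, u, v, hd, h1⟩ := exists_noncollinear hz
  have h2 := h1
  rw [hc] at h2
  have hw := eq_of_noncollinear hd h1 h2
  obtain ⟨p, q, r, s, hcz, h2, hpq, hrs, hpr⟩ := hf.rows hz
  obtain ⟨p', q', r', s', hcz', h2', hpq', hrs', hpr'⟩ := hf'.rows hz'
  have hset : ({p, q, r, s} : Set (ℤ × ℤ)) = {p', q', r', s'} := by rw [← hcz, hc, hcz']
  -- The sides of a flat branch are the intersections of the cell with rows, so the cell determines
  -- the branch.
  have hne : ({p', q'} : Set (ℤ × ℤ)) = {x ∈ cell P h z.1 | S.ρ x = S.ρ p'} := by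
    rw [hc, hcz']
    ext x
    simp only [Set.mem_insert_iff, Set.mem_singleton_iff, Set.mem_ofPred_eq]
    constructor
    · rintro (rfl | rfl)
      · tauto
      · exact ⟨by tauto, hpq'.symm⟩
    · rintro ⟨rfl | rfl | rfl | rfl, h0⟩
      · tauto
      · tauto
      · exact (hpr' h0.symm).elim
      · exact (hpr' (by omega)).elim
  have hp' : p' ∈ ({p, q, r, s} : Set (ℤ × ℤ)) := by rw [hset]; simp
  have hmem : ({p', q'} : Set (ℤ × ℤ)) ∈ z.2 := by
    rw [hne, hcz, h2]
    have : S.ρ p' = S.ρ p ∨ S.ρ p' = S.ρ r := by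
      rcases hp' with rfl | rfl | rfl | rfl <;> omega
    rcases this with h0 | h0
    · left
      ext x
      simp only [Set.mem_insert_iff, Set.mem_singleton_iff, Set.mem_ofPred_eq]
      constructor
      · rintro ⟨rfl | rfl | rfl | rfl, h3⟩ <;> first | tauto | omega
      · rintro (rfl | rfl) <;> exact ⟨by tauto, by omega⟩
    · right
      ext x
      simp only [Set.mem_insert_iff, Set.mem_singleton_iff, Set.mem_ofPred_eq]
      constructor
      · rintro ⟨rfl | rfl | rfl | rfl, h3⟩ <;> first | tauto | omega
      · rintro (rfl | rfl) <;> exact ⟨by tauto, by omega⟩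
  exact ext_of_mem hz hz' hmem (by rw [h2']; simp) hw

end Strip

end NodalCurve

namespace NodalCurve

/-- In a finite family of lines, the envelope passes from the lines of slope less than `m` to those
of slope at least `m` at some point. -/
lemma exists_envelope_crossing {κ : Type*} (K : Finset κ) (o s : κ → ℝ) (m : ℝ)
    (h1 : ∃ k ∈ K, s k < m) (h2 : ∃ k ∈ K, m ≤ s k) : ∃ t, ∃ k ∈ K, ∃ l ∈ K, s k < m ∧ m ≤ s l ∧
      (∀ n ∈ K, o n + s n * t ≤ o k + s k * t) ∧ ∀ n ∈ K, o n + s n * t ≤ o l + s l * t := by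
  classical
  -- `τ k l` is where the line `l` of slope at least `m` overtakes the line `k` of smaller slope.
  -- The crossing of the envelope is the maximum over `k` of the minimum over `l`: the last line to
  -- be overtaken, when it is first overtaken.
  set τ : κ → κ → ℝ := fun k l ↦ (o k - o l) / (s l - s k) with hτ
  have hle : ∀ k l t, s k < m → m ≤ s l → (τ k l ≤ t ↔ o k + s k * t ≤ o l + s l * t) := by
    intro k l t hk hl
    rw [hτ, div_le_iff₀ (by linarith)]
    constructor <;> intro h <;> linarith
  have hge : ∀ k l t, s k < m → m ≤ s l → (t ≤ τ k l ↔ o l + s l * t ≤ o k + s k * t) := by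
    intro k l t hk hl
    rw [hτ, le_div_iff₀ (by linarith)]
    constructor <;> intro h <;> linarith
  have hmin : ∀ k, ∃ l ∈ K, m ≤ s l ∧ ∀ n ∈ K, m ≤ s n → τ k l ≤ τ k n := by
    intro k
    obtain ⟨l₀, hl₀, hm₀⟩ := h2
    obtain ⟨l, hl, hmin⟩ := (K.filter (fun l ↦ m ≤ s l)).exists_min_image (τ k)
      ⟨l₀, Finset.mem_filter.2 ⟨hl₀, hm₀⟩⟩
    rw [Finset.mem_filter] at hl
    exact ⟨l, hl.1, hl.2, fun n hn hmn ↦ hmin n (Finset.mem_filter.2 ⟨hn, hmn⟩)⟩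
  choose f hfK hfm hfmin using hmin
  obtain ⟨k₀, hk₀, hm₀⟩ := h1
  obtain ⟨k, hk, hmax⟩ := (K.filter (fun k ↦ s k < m)).exists_max_image (fun k ↦ τ k (f k))
    ⟨k₀, Finset.mem_filter.2 ⟨hk₀, hm₀⟩⟩
  rw [Finset.mem_filter] at hk
  set t := τ k (f k) with ht
  have e1 := (hle k (f k) t hk.2 (hfm k)).1 le_rfl
  have e2 := (hge k (f k) t hk.2 (hfm k)).1 le_rfl
  have high : ∀ n ∈ K, m ≤ s n → o n + s n * t ≤ o k + s k * t := fun n hn hmn ↦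
    (hge k n t hk.2 hmn).1 (hfmin k n hn hmn)
  have all : ∀ n ∈ K, o n + s n * t ≤ o k + s k * t := by
    intro n hn
    rcases lt_or_ge (s n) m with hmn | hmn
    · exact ((hle n (f n) t hmn (hfm n)).1 (hmax n (Finset.mem_filter.2 ⟨hn, hmn⟩))).trans
        (high _ (hfK n) (hfm n))
    · exact high n hn hmn
  exact ⟨t, k, hk.1, f k, hfK k, hk.2, hfm k, all, fun n hn ↦ (all n hn).trans e1⟩

namespace Strip

variable {P : Set (ℝ × ℝ)} {h : ℤ × ℤ → ℝ} (S : Strip P h)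

/-! ### Junctions -/

/-- A balanced pair of lattice points: a point of the middle row, taken twice, or a pair
of points of the upper and of the lower row. -/
def Balanced (k : (ℤ × ℤ) × (ℤ × ℤ)) : Prop :=
  k.1 ∈ latticePoints P ∧ k.2 ∈ latticePoints P ∧
    ((S.ρ k.1 = 0 ∧ k.1 = k.2) ∨ (S.ρ k.1 = 1 ∧ S.ρ k.2 = -1))

/-- The points of the middle row to the left of which there is a balanced pair. -/
def innerPoints : Set (ℤ × ℤ) :=
  {i | i ∈ latticePoints P ∧ S.ρ i = 0 ∧ ∃ k, S.Balanced k ∧ S.c k.1 + S.c k.2 < 2 * S.c i}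

/-- Above each point of the middle row there is a vertical segment on which cells contain
balanced pairs on both sides of the given point. -/
lemma exists_crossing {i : ℤ × ℤ} (hi : i ∈ S.innerPoints)
    (hup : ∃ a ∈ latticePoints P, S.ρ a = 1) (hdown : ∃ a ∈ latticePoints P, S.ρ a = -1) :
    ∃ k l w₁ w₂, S.Balanced k ∧ S.Balanced l ∧ S.c k.1 + S.c k.2 < 2 * S.c i ∧
      2 * S.c i ≤ S.c l.1 + S.c l.2 ∧ S.X w₁ = S.X w₂ ∧
      (∀ w, w = w₁ ∨ w = w₂ → k.1 ∈ cell P h w ∧ k.2 ∈ cell P h w ∧ l.1 ∈ cell P h w ∧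
        l.2 ∈ cell P h w) ∧ (∃ a ∈ cell P h w₁, S.ρ a = 1) ∧ ∃ a ∈ cell P h w₂, S.ρ a = -1 := by
  classical
  obtain ⟨hiA, hi0, k₀, hk₀, hlt⟩ := hi
  have hKfin : {k | S.Balanced k}.Finite :=
    (S.fin.prod S.fin).subset fun k hk ↦ ⟨hk.1, hk.2.1⟩
  -- In the sum of the two monomials of a balanced pair the variable `Y` cancels, so each pair gives
  -- a line in `t`; the pair `(i, i)` has slope `2 * S.c i`.
  obtain ⟨t, k, hk, l, hl, hkm, hlm, hkmax, hlmax⟩ := exists_envelope_crossing hKfin.toFinset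
    (fun k ↦ h k.1 + h k.2) (fun k ↦ (S.c k.1 : ℝ) + S.c k.2) (2 * S.c i)
    ⟨k₀, by simpa using hk₀, by exact_mod_cast hlt⟩
    ⟨(i, i), by simpa using ⟨hiA, hiA, Or.inl ⟨hi0, rfl⟩⟩, by simp only; linarith⟩
  simp only [Set.Finite.mem_toFinset, Set.mem_ofPred_eq] at hk hl hkmax hlmax
  obtain ⟨T, ⟨hTA, hT1⟩, hTmax⟩ := Set.exists_max_image {a ∈ latticePoints P | S.ρ a = 1}
    (fun a ↦ h a + S.c a * t) (S.fin.subset (Set.sep_subset _ _)) hup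
  obtain ⟨B, ⟨hBA, hB1⟩, hBmax⟩ := Set.exists_max_image {a ∈ latticePoints P | S.ρ a = -1}
    (fun a ↦ h a + S.c a * t) (S.fin.subset (Set.sep_subset _ _)) hdown
  set μ := h k.1 + h k.2 + ((S.c k.1 : ℝ) + S.c k.2) * t with hμ
  have hkl : h l.1 + h l.2 + ((S.c l.1 : ℝ) + S.c l.2) * t = μ :=
    le_antisymm (hkmax l hl) (hlmax k hk)
  have hTB := hkmax (T, B) ⟨hTA, hBA, Or.inr ⟨hT1, hB1⟩⟩
  have hmid : ∀ a ∈ latticePoints P, S.ρ a = 0 → 2 * (h a + S.c a * t) ≤ μ := by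
    intro a ha h0
    have := hkmax (a, a) ⟨ha, ha, Or.inl ⟨h0, rfl⟩⟩
    simp only at this
    linarith
  simp only at hTB
  have hrow : ∀ a ∈ latticePoints P, S.ρ a = 1 ∨ S.ρ a = 0 ∨ S.ρ a = -1 := by
    intro a ha
    have := S.row a ha
    omega
  -- The two values of `y` raise the best upper, respectively lower, monomial to `μ / 2`. At both,
  -- no monomial exceeds `μ / 2`, so two monomials with sum `μ` are both maximal.
  have hbd : ∀ y, y = μ / 2 - (h T + S.c T * t) ∨ y = h B + S.c B * t - μ / 2 →
      ∀ a ∈ latticePoints P, S.val a (S.W t y) ≤ μ / 2 := by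
    intro y hy a ha
    simp only [val, S.X_W, S.Y_W]
    rcases hrow a ha with h1 | h1 | h1
    · have := hTmax a ⟨ha, h1⟩
      rw [h1]; push_cast
      rcases hy with rfl | rfl <;> linarith
    · have := hmid a ha h1
      rw [h1]; push_cast
      linarith
    · have := hBmax a ⟨ha, h1⟩
      rw [h1]; push_cast
      rcases hy with rfl | rfl <;> linarith
  have hcell : ∀ y, y = μ / 2 - (h T + S.c T * t) ∨ y = h B + S.c B * t - μ / 2 →
      ∀ a ∈ latticePoints P, S.val a (S.W t y) = μ / 2 → a ∈ cell P h (S.W t y) := by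
    intro y hy a ha he
    rw [S.mem_cell']
    exact ⟨ha, fun b hb ↦ (hbd y hy b hb).trans he.ge⟩
  have hpair : ∀ n, S.Balanced n → h n.1 + h n.2 + ((S.c n.1 : ℝ) + S.c n.2) * t = μ →
      ∀ y, y = μ / 2 - (h T + S.c T * t) ∨ y = h B + S.c B * t - μ / 2 →
      n.1 ∈ cell P h (S.W t y) ∧ n.2 ∈ cell P h (S.W t y) := by
    intro n hn he y hy
    have b1 := hbd y hy n.1 hn.1
    have b2 := hbd y hy n.2 hn.2.1
    have hsum : S.val n.1 (S.W t y) + S.val n.2 (S.W t y) = μ := by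
      have hρ : (S.ρ n.1 : ℝ) + S.ρ n.2 = 0 := by
        rcases hn.2.2 with ⟨h1, h2⟩ | ⟨h1, h2⟩
        · rw [← h2, h1]; simp
        · rw [h1, h2]; simp
      simp only [val, S.X_W, S.Y_W]
      linear_combination he + y * hρ
    exact ⟨hcell y hy _ hn.1 (by linarith), hcell y hy _ hn.2.1 (by linarith)⟩
  refine ⟨k, l, S.W t (μ / 2 - (h T + S.c T * t)), S.W t (h B + S.c B * t - μ / 2), hk, hl,
    by exact_mod_cast hkm, by exact_mod_cast hlm, by rw [S.X_W, S.X_W], ?_, ?_, ?_⟩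
  · rintro w (rfl | rfl)
    · have h1 := hpair k hk rfl _ (Or.inl rfl)
      have h2 := hpair l hl hkl _ (Or.inl rfl)
      exact ⟨h1.1, h1.2, h2.1, h2.2⟩
    · have h1 := hpair k hk rfl _ (Or.inr rfl)
      have h2 := hpair l hl hkl _ (Or.inr rfl)
      exact ⟨h1.1, h1.2, h2.1, h2.2⟩
  · refine ⟨T, hcell _ (Or.inl rfl) T hTA ?_, hT1⟩
    simp only [val, S.X_W, S.Y_W, hT1]
    push_cast
    ring
  · refine ⟨B, hcell _ (Or.inr rfl) B hBA ?_, hB1⟩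
    simp only [val, S.X_W, S.Y_W, hB1]
    push_cast
    ring

/-- A vertical edge dual to a segment with right end `i`. -/
def IsVerticalAt (i : ℤ × ℤ) (e : Set (ℤ × ℤ)) : Prop :=
  (∃ x y, (boundedCurve P h).IsLink e x y ∧ S.level x = S.level y) ∧
    i ∈ e ∧ ∀ a ∈ e, S.c a ≤ S.c i

/-- A point dual to a triangle with one vertex `i` in the middle row, which lies to the right of
the opposite side. -/
def IsSplitAt (i : ℤ × ℤ) (z : (ℝ × ℝ) × Set (Set (ℤ × ℤ))) : Prop :=
  z ∈ curvePoints P h ∧ z.2 = sides P h z.1 ∧ S.ρ i = 0 ∧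
    ∃ a b, cell P h z.1 = {a, i, b} ∧ S.ρ a = 1 ∧ S.ρ b = -1 ∧ S.c a + S.c b < 2 * S.c i

/-- A parallelogram that meets all rows, the right point of which in the middle row is `i`. -/
def IsCrossingAt (i : ℤ × ℤ) (σ : Set (ℤ × ℤ)) : Prop :=
  (IsUnitParallelogram σ ∧ ∃ w, cell P h w = σ) ∧ (∃ a ∈ σ, S.ρ a = 1) ∧ (∃ a ∈ σ, S.ρ a = -1) ∧
    i ∈ σ ∧ S.ρ i = 0 ∧ ∃ j ∈ σ, S.ρ j = 0 ∧ S.c j < S.c i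

lemma exists_link (S : Strip P h) {w w' : ℝ × ℝ} {p q : ℤ × ℤ} (hpq : p ≠ q)
    (hw : IsUnitCell (cell P h w))
    (hw' : IsUnitCell (cell P h w')) (hne : w ≠ w') (hp : p ∈ cell P h w) (hq : q ∈ cell P h w)
    (hp' : p ∈ cell P h w') (hq' : q ∈ cell P h w') {z : (ℝ × ℝ) × Set (Set (ℤ × ℤ))}
    (hz : z ∈ curvePoints P h) (hzw : z.1 = w) (hez : {p, q} ∈ z.2) :
    ∃ y, y.1 = w' ∧ (boundedCurve P h).IsLink {p, q} z y := by
  obtain ⟨v, -, hv⟩ := S.cell_between hpq hw hne hp hq hp' hq' (s := 1 / 2) (by norm_num)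
    (by norm_num)
  obtain ⟨y, hy, hyw, hey⟩ := exists_point (P := P) (h := h) hw' (e := {p, q})
    ⟨Set.insert_subset hp' (Set.singleton_subset_iff.2 hq'), Set.ncard_pair hpq, v, hv⟩
  refine ⟨y, hyw, hz, hy, ?_, Set.ncard_pair hpq, hez, hey⟩
  rintro rfl
  exact hne (hzw.symm.trans hyw)

lemma eq_one_or_of_mem (hn : IsNodal P h) {w : ℝ × ℝ} {p q s : ℤ × ℤ} (hp : p ∈ cell P h w)
    (hq : q ∈ cell P h w) (hs : s ∈ cell P h w) (hD : S.D p q s ≠ 0) :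
    IsUnitCell (cell P h w) ∧ (S.D p q s = 1 ∨ S.D p q s = -1) := by
  have hw := S.isUnitCell_of_D hn hp hq hs hD
  refine ⟨hw, eq_or_eq_neg_of_abs_eq (S.abs_D hw hp hq hs ?_ ?_ ?_)⟩
  · rintro rfl; simp [D] at hD
  · rintro rfl; exact hD (S.D_self_left _ _)
  · rintro rfl; exact hD (S.D_self_right _ _)

/-- Each inner point gives rise to a vertical edge, a triangle or a crossing. -/
lemma exists_junction (hn : IsNodal P h) {i : ℤ × ℤ} (hi : i ∈ S.innerPoints)
    (hup : ∃ a ∈ latticePoints P, S.ρ a = 1) (hdown : ∃ a ∈ latticePoints P, S.ρ a = -1) :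
    (∃ e, S.IsVerticalAt i e) ∨ (∃ z, S.IsSplitAt i z) ∨ ∃ σ, S.IsCrossingAt i σ := by
  obtain ⟨⟨a, b⟩, ⟨a', b'⟩, w₁, w₂, ⟨haA, hbA, hk⟩, ⟨haA', hbA', hl⟩, hlt, hle, hX, hmem,
    ⟨T, hT, hT1⟩, ⟨B, hB, hB1⟩⟩ := S.exists_crossing hi hup hdown
  simp only at *
  obtain ⟨ma, mb, ma', mb'⟩ := hmem w₁ (Or.inl rfl)
  obtain ⟨na, nb, na', nb'⟩ := hmem w₂ (Or.inr rfl)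
  have hi0 := hi.2.1
  -- The points of both pairs lie in one cell, so every nonzero determinant among them is `±1`; this
  -- restricts the pairs severely.
  rcases hk with ⟨ha, rfl⟩ | ⟨ha, hb⟩ <;> rcases hl with ⟨ha', rfl⟩ | ⟨ha', hb'⟩
  · -- two adjacent points of the middle row
    have hD1 : S.D a a' T = S.c a' - S.c a := by simp [D, ha, ha', hT1]
    have hD2 : S.D a a' B = -(S.c a' - S.c a) := by simp [D, ha, ha', hB1]
    obtain ⟨u₁, d₁⟩ := S.eq_one_or_of_mem hn ma ma' hT (by omega)
    obtain ⟨u₂, d₂⟩ := S.eq_one_or_of_mem hn na na' hB (by omega)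
    obtain rfl : a' = i := S.inj _ _ (by omega) (by omega)
    have hne : a ≠ a' := by rintro rfl; omega
    by_cases hw : w₁ = w₂
    · subst hw
      right; right
      refine ⟨cell P h w₁, ⟨⟨?_, w₁, rfl⟩, ⟨T, hT, hT1⟩, ⟨B, hB, hB1⟩, ma', hi0, a, ma, ha,
        by omega⟩⟩
      exact u₁.isUnitParallelogram (a := a) (b := a') (c := T) (d := B) hne (by rintro rfl; omega)
        (by rintro rfl; omega) (by rintro rfl; omega) (by rintro rfl; omega)
        (by rintro rfl; omega) ma ma' hT hB
    · left
      obtain ⟨v, -, hv⟩ := S.cell_between hne u₁ hw ma ma' na na' (s := 1 / 2) (by norm_num)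
        (by norm_num)
      obtain ⟨x, hx, hxw, hex⟩ := exists_point (P := P) (h := h) u₁ (e := {a, a'})
        ⟨Set.insert_subset ma (Set.singleton_subset_iff.2 ma'), Set.ncard_pair hne, v, hv⟩
      obtain ⟨y, hyw, hl⟩ := S.exists_link hne u₁ u₂ hw ma ma' na na' hx hxw hex
      refine ⟨{a, a'}, ⟨x, y, hl, ?_⟩, by simp, ?_⟩
      · rw [level, level, hxw, hyw, hX]
      · rintro c (rfl | rfl) <;> omega
  -- The determinant is at most `-2`, since `2 * S.c a ≤ 2 * S.c i - 2`.
  · exfalso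
    have hD : S.D a a' b' = 2 * S.c a - S.c a' - S.c b' := by simp [D, ha, ha', hb']; ring
    obtain ⟨-, d⟩ := S.eq_one_or_of_mem hn ma ma' mb' (by omega)
    omega
  -- The determinant is positive, hence one, which forces `a' = i`. Without a further point the cell
  -- is a split; a fourth point must be in the middle row to the left of `i`, which gives a
  -- crossing.
  · have hD : S.D a' a b = 2 * S.c a' - S.c a - S.c b := by simp [D, ha, ha', hb]; ring
    obtain ⟨u, d⟩ := S.eq_one_or_of_mem hn ma' ma mb (by omega)
    obtain rfl : a' = i := S.inj _ _ (by omega) (by omega)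
    by_cases hx : ∃ x ∈ cell P h w₁, x ≠ a ∧ x ≠ a' ∧ x ≠ b
    · right; right
      obtain ⟨x, hx, hxa, hxi, hxb⟩ := hx
      have hia : a' ≠ a := by rintro rfl; omega
      have hib : a' ≠ b := by rintro rfl; omega
      have hab : a ≠ b := by rintro rfl; omega
      have hp : IsUnitParallelogram (cell P h w₁) :=
        u.isUnitParallelogram hxa hxi hxb hia.symm hab hib hx ma ma' mb
      have D1 := eq_or_eq_neg_of_abs_eq (S.abs_D u hx ma mb hxa hxb hab)
      have D2 := eq_or_eq_neg_of_abs_eq (S.abs_D u ma' ma hx hia hxi.symm hxa.symm)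
      have D3 := eq_or_eq_neg_of_abs_eq (S.abs_D u ma' mb hx hib hxi.symm hxb.symm)
      have hxr := S.row x (S.mem_cell'.1 hx).1
      have hxr : S.ρ x = 1 ∨ S.ρ x = 0 ∨ S.ρ x = -1 := by omega
      have nxa : S.ρ x = S.ρ a → S.c x ≠ S.c a := fun h1 h2 ↦ hxa (S.inj _ _ h2 h1)
      have nxb : S.ρ x = S.ρ b → S.c x ≠ S.c b := fun h1 h2 ↦ hxb (S.inj _ _ h2 h1)
      have nxi : S.ρ x = S.ρ a' → S.c x ≠ S.c a' := fun h1 h2 ↦ hxi (S.inj _ _ h2 h1)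
      simp only [D, ha, ha', hb] at D1 D2 D3
      rcases hxr with h1 | h1 | h1 <;> rw [h1] at D1 D2 D3 nxa nxb nxi
      · omega
      · exact ⟨cell P h w₁, ⟨hp, w₁, rfl⟩, ⟨a, ma, ha⟩, ⟨b, mb, hb⟩, ma', ha', x, hx, h1,
          by omega⟩
      · omega
    · right; left
      have hc : cell P h w₁ = {a, a', b} := by
        ext x
        constructor
        · intro h1
          by_contra h2
          simp only [Set.mem_insert_iff, Set.mem_singleton_iff, not_or] at h2
          exact hx ⟨x, h1, h2⟩
        · rintro (rfl | rfl | rfl) <;> assumption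
      have ht : IsUnitTriangle (cell P h w₁) := by
        refine ⟨a, a' - a, b - a, ?_, by rw [hc]; simp⟩
        rw [← D_eq]
        have : S.D a a' b = -S.D a' a b := by simp only [D]; ring
        rw [this, abs_neg]
        rcases d with d | d <;> rw [d] <;> simp
      exact ⟨(w₁, sides P h w₁), Or.inl ⟨ht, rfl⟩, rfl, ha', a, b, hc, ha, hb, by omega⟩
  -- Two different pairs of outer points give a nonzero even determinant.
  · exfalso
    have hD1 : S.D a a' b = -2 * (S.c a' - S.c a) := by simp [D, ha, ha', hb]; ring
    have hD2 : S.D b b' a = 2 * (S.c b' - S.c b) := by simp [D, ha, hb', hb]; ring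
    by_cases h0 : S.c a' = S.c a
    · obtain ⟨-, d⟩ := S.eq_one_or_of_mem hn mb mb' ma (by omega)
      omega
    · obtain ⟨-, d⟩ := S.eq_one_or_of_mem hn ma ma' mb (by omega)
      omega

end Strip

end NodalCurve

namespace NodalCurve

lemma ncard_le_ncard_of_rel {α β : Type*} {s : Set α} {t : Set β} (r : α → β → Prop)
    (hex : ∀ a ∈ s, ∃ b ∈ t, r a b) (hinj : ∀ a ∈ s, ∀ a' ∈ s, ∀ b ∈ t, r a b → r a' b → a = a')
    (ht : t.Finite) : s.ncard ≤ t.ncard := by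
  rcases s.eq_empty_or_nonempty with rfl | ⟨a₀, ha₀⟩
  · simp
  have : Nonempty β := ⟨(hex a₀ ha₀).choose⟩
  choose! f hft hfr using hex
  exact Set.ncard_le_ncard_of_injOn f hft
    (fun a ha a' ha' h ↦ hinj a ha a' ha' (f a) (hft a ha) (hfr a ha) (h ▸ hfr a' ha')) ht

namespace Strip

variable {P : Set (ℝ × ℝ)} {h : ℤ × ℤ → ℝ} (S : Strip P h)

/-! ### The number of edges -/

/-- The edges that leave a point of the abstract curve to the right. -/
def rightEdges : Set (Set (ℤ × ℤ)) := {e | ∃ z ∈ curvePoints P h, e ∈ z.2 ∧ S.RightSide z.1 e}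

/-- The points dual to triangles at which a strand splits. -/
def splits : Set ((ℝ × ℝ) × Set (Set (ℤ × ℤ))) := {z | ∃ i, S.IsSplitAt i z}

/-- The flat branches. -/
def flatPoints : Set ((ℝ × ℝ) × Set (Set (ℤ × ℤ))) := {z | z ∈ curvePoints P h ∧ S.FlatPoint z}

lemma splits_subset : S.splits ⊆ curvePoints P h := fun _ ⟨_, hz⟩ ↦ hz.1

lemma mem_powerset_of_mem_snd {z : (ℝ × ℝ) × Set (Set (ℤ × ℤ))} (hz : z ∈ curvePoints P h)
    {e : Set (ℤ × ℤ)} (he : e ∈ z.2) : e ∈ Set.powerset (latticePoints P) :=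
  fun _ ha ↦ (subset_of_mem_snd hz he ha).1

/-- From a split point two edges leave to the right. -/
lemma IsSplitAt.exists_rightSides {S : Strip P h} {i : ℤ × ℤ} {z : (ℝ × ℝ) × Set (Set (ℤ × ℤ))}
    (hz : S.IsSplitAt i z) : ∃ e ∈ z.2, ∃ e' ∈ z.2, e ≠ e' ∧ S.RightSide z.1 e ∧
      S.RightSide z.1 e' := by
  obtain ⟨-, hz2, hi, a, b, hc, ha, hb, hlt⟩ := hz
  have h1 := S.rightSide_of_triangle (p := a) (q := i) (s := b) hc (by omega)
    (by simp only [D, ha, hb, hi]; omega)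
  have h2 := S.rightSide_of_triangle (p := i) (q := b) (s := a) (w := z.1)
    (by rw [hc]; ext; simp; tauto) (by omega) (by simp only [D, ha, hb, hi]; omega)
  refine ⟨_, hz2 ▸ h1.1, _, hz2 ▸ h2.1, fun h0 ↦ ?_, h1.2, h2.2⟩
  have : a ∈ ({i, b} : Set (ℤ × ℤ)) := h0 ▸ Set.mem_insert _ _
  rcases this with rfl | rfl <;> omega

/-- Each point sends an edge to the right, a split sends two, and only a flat branch may send none.
By `eq_of_rightSide` no edge is counted at two points, so the local inequalities can be summed. -/
lemma ncard_curvePoints_add_le : (curvePoints P h).ncard + S.splits.ncard ≤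
    S.rightEdges.ncard + S.flatPoints.ncard := by
  classical
  have hfin := finite_curvePoints S
  set V := hfin.toFinset with hV
  set r : (ℝ × ℝ) × Set (Set (ℤ × ℤ)) → Finset (Set (ℤ × ℤ)) := fun z ↦
    S.fin.powerset.toFinset.filter (fun e ↦ e ∈ z.2 ∧ S.RightSide z.1 e) with hr
  have hmem : ∀ z ∈ V, ∀ e, e ∈ r z ↔ e ∈ z.2 ∧ S.RightSide z.1 e := by
    intro z hz e
    rw [hr, Finset.mem_filter, Set.Finite.mem_toFinset, and_iff_right_iff_imp]
    exact fun he ↦ mem_powerset_of_mem_snd ((hfin.mem_toFinset).1 hz) he.1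
  have hpt : ∀ z ∈ V, 1 + (if z ∈ S.splits then 1 else 0) ≤
      (r z).card + (if S.FlatPoint z then 1 else 0) := by
    intro z hz
    have hzc := hfin.mem_toFinset.1 hz
    by_cases hs : z ∈ S.splits
    · obtain ⟨i, hi⟩ := hs
      obtain ⟨e, he, e', he', hne, hre, hre'⟩ := hi.exists_rightSides
      have : 1 < (r z).card := Finset.one_lt_card.2
        ⟨e, (hmem z hz e).2 ⟨he, hre⟩, e', (hmem z hz e').2 ⟨he', hre'⟩, hne⟩
      split_ifs <;> omega
    · by_cases hf : S.FlatPoint z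
      · simp [hs, hf]
      · obtain ⟨e, he, hre⟩ := S.exists_rightSide hzc hf
        have : 0 < (r z).card := Finset.card_pos.2 ⟨e, (hmem z hz e).2 ⟨he, hre⟩⟩
        simp only [hs, hf, if_false]
        omega
  have hsum := Finset.sum_le_sum hpt
  rw [Finset.sum_add_distrib, Finset.sum_add_distrib, ← Finset.card_filter, ← Finset.card_filter,
    ← Finset.card_eq_sum_ones, ← Finset.card_biUnion] at hsum
  · have e1 : (curvePoints P h).ncard = V.card := Set.ncard_eq_toFinset_card _ hfin
    have e2 : S.splits.ncard = (V.filter (· ∈ S.splits)).card := by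
      rw [← Set.ncard_coe_finset]
      congr 1
      ext z
      simp only [Finset.coe_filter, hV, Set.Finite.mem_toFinset, Set.mem_ofPred_eq]
      exact ⟨fun hz ↦ ⟨S.splits_subset hz, hz⟩, And.right⟩
    have e3 : S.flatPoints.ncard = (V.filter S.FlatPoint).card := by
      rw [← Set.ncard_coe_finset]
      congr 1
      ext z
      simp only [Finset.coe_filter, hV, Set.Finite.mem_toFinset, Set.mem_ofPred_eq]
      exact Iff.rfl
    have e4 : S.rightEdges.ncard = (V.biUnion r).card := by
      rw [← Set.ncard_coe_finset]
      congr 1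
      ext e
      simp only [Finset.coe_biUnion, Set.mem_iUnion, Finset.mem_coe, exists_prop]
      constructor
      · rintro ⟨z, hz, he⟩
        have hzV := hfin.mem_toFinset.2 hz
        exact ⟨z, hzV, (hmem z hzV e).2 he⟩
      · rintro ⟨z, hz, he⟩
        exact ⟨z, hfin.mem_toFinset.1 hz, (hmem z hz e).1 he⟩
    rw [e1, e2, e3, e4]
    exact hsum
  · intro z hz z' hz' hne
    rw [Function.onFun, Finset.disjoint_left]
    intro e he he'
    have h1 := (hmem z hz e).1 he
    have h2 := (hmem z' hz' e).1 he'
    have c1 := hfin.mem_toFinset.1 hz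
    have c2 := hfin.mem_toFinset.1 hz'
    exact hne (ext_of_mem c1 c2 h1.1 h2.1 (S.eq_of_rightSide (isUnitCell_of_mem c1)
      (isUnitCell_of_mem c2) (subset_of_mem_snd c1 h1.1) (subset_of_mem_snd c2 h2.1) h1.2 h2.2))

/-- The edges between points on different levels. -/
def slantedEdges : Set (Set (ℤ × ℤ)) :=
  {e | ∃ x y, (boundedCurve P h).IsLink e x y ∧ S.level x < S.level y}

/-- The edges between points on the same level. -/
def verticalEdges : Set (Set (ℤ × ℤ)) :=
  {e | ∃ x y, (boundedCurve P h).IsLink e x y ∧ S.level x = S.level y}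

/-- The edges dual to the right part of the boundary of the polygon. -/
def rightBoundary : Set (Set (ℤ × ℤ)) :=
  {e | ∃ z ∈ curvePoints P h, e ∈ z.2 ∧ ∃ p q, e = {p, q} ∧ S.ρ q < S.ρ p ∧
    ∀ a ∈ latticePoints P, S.D p q a ≤ 0}

lemma ncard_slanted_add_vertical_le :
    S.slantedEdges.ncard + S.verticalEdges.ncard ≤ E(boundedCurve P h).ncard := by
  have hfin := finite_edgeSet S
  have h1 : S.slantedEdges ⊆ E(boundedCurve P h) := fun e ⟨x, y, hl, _⟩ ↦ hl.edge_mem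
  have h2 : S.verticalEdges ⊆ E(boundedCurve P h) := fun e ⟨x, y, hl, _⟩ ↦ hl.edge_mem
  rw [← Set.ncard_union_eq _ (hfin.subset h1) (hfin.subset h2)]
  · exact Set.ncard_le_ncard (Set.union_subset h1 h2) hfin
  · rw [Set.disjoint_left]
    rintro e ⟨x, y, hl, hlt⟩ ⟨x', y', hl', heq⟩
    rcases hl'.eq_and_eq_or_eq_and_eq hl with ⟨rfl, rfl⟩ | ⟨rfl, rfl⟩ <;> linarith

/-- If there are lattice points beyond the dual side, the edge ends at a point with larger `X`;
otherwise the side is on the right boundary. -/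
lemma rightEdges_subset (hn : IsNodal P h) :
    S.rightEdges ⊆ S.slantedEdges ∪ S.rightBoundary := by
  rintro _ ⟨z, hz, he, p, q, rfl, hρ, hs⟩
  by_cases hb : ∀ a ∈ latticePoints P, S.D p q a ≤ 0
  · exact Or.inr ⟨z, hz, he, p, q, rfl, hρ, hb⟩
  left
  push Not at hb
  have hsub := subset_of_mem_snd hz he
  have hp := hsub (Set.mem_insert _ _)
  have hq := hsub (Set.mem_insert_of_mem _ rfl)
  obtain ⟨v, ε, hε, hX, hpv, hqv, a, hav, hD⟩ := S.exists_neighbour hp hq hs hb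
  have hlt : S.X z.1 < S.X v := by
    have : (0 : ℝ) < S.ρ p - S.ρ q := by exact_mod_cast sub_pos.2 hρ
    rw [hX]
    linarith [mul_pos hε this]
  obtain ⟨y, hyv, hl⟩ := S.exists_link (p := p) (q := q) (by rintro rfl; omega)
    (isUnitCell_of_mem hz) (S.isUnitCell_of_D hn hpv hqv hav hD.ne')
    (by rintro rfl; exact lt_irrefl _ hlt) hp hq hpv hqv hz rfl he
  exact ⟨z, y, hl, by rw [level, level, hyv]; exact hlt⟩

lemma finite_rightBoundary : S.rightBoundary.Finite :=
  S.fin.powerset.subset fun _ ⟨_, hz, he, _⟩ ↦ mem_powerset_of_mem_snd hz he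

/-- The crossings that meet all rows. -/
def crossings : Set (Set (ℤ × ℤ)) := {σ | ∃ i, S.IsCrossingAt i σ}

lemma finite_parallelograms (S : Strip P h) :
    {σ : Set (ℤ × ℤ) | IsUnitParallelogram σ ∧ ∃ w, cell P h w = σ}.Finite := by
  refine S.fin.powerset.subset ?_
  rintro _ ⟨-, w, rfl⟩ a ha
  exact ha.1

lemma crossings_subset :
    S.crossings ⊆ {σ : Set (ℤ × ℤ) | IsUnitParallelogram σ ∧ ∃ w, cell P h w = σ} :=
  fun _ ⟨_, hσ⟩ ↦ hσ.1

/-- The object supplied by `exists_junction` determines the inner point: the right end of the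
segment, the only middle vertex of the triangle, or the right one of the two middle vertices of the
parallelogram. -/
lemma ncard_innerPoints_le (hn : IsNodal P h) (hup : ∃ a ∈ latticePoints P, S.ρ a = 1)
    (hdown : ∃ a ∈ latticePoints P, S.ρ a = -1) :
    S.innerPoints.ncard ≤ S.verticalEdges.ncard + S.splits.ncard + S.crossings.ncard := by
  have hfin : S.innerPoints.Finite := S.fin.subset fun i hi ↦ hi.1
  have hsub : S.innerPoints ⊆ {i ∈ S.innerPoints | ∃ e, S.IsVerticalAt i e} ∪
      {i ∈ S.innerPoints | ∃ z, S.IsSplitAt i z} ∪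
      {i ∈ S.innerPoints | ∃ σ, S.IsCrossingAt i σ} := by
    intro i hi
    rcases S.exists_junction hn hi hup hdown with h1 | h1 | h1
    · exact Or.inl (Or.inl ⟨hi, h1⟩)
    · exact Or.inl (Or.inr ⟨hi, h1⟩)
    · exact Or.inr ⟨hi, h1⟩
  have l1 : {i ∈ S.innerPoints | ∃ e, S.IsVerticalAt i e}.ncard ≤ S.verticalEdges.ncard := by
    refine ncard_le_ncard_of_rel S.IsVerticalAt ?_ ?_
      ((finite_edgeSet S).subset fun e ⟨x, y, hl, _⟩ ↦ hl.edge_mem)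
    · rintro i ⟨-, e, he⟩
      exact ⟨e, he.1, he⟩
    · rintro i hi j hj e ⟨x, y, hl, hX⟩ ⟨-, hie, hic⟩ ⟨-, hje, hjc⟩
      exact S.inj _ _ (le_antisymm (hjc i hie) (hic j hje)) (by rw [hi.1.2.1, hj.1.2.1])
  have l2 : {i ∈ S.innerPoints | ∃ z, S.IsSplitAt i z}.ncard ≤ S.splits.ncard := by
    refine ncard_le_ncard_of_rel S.IsSplitAt ?_ ?_ ((finite_curvePoints S).subset S.splits_subset)
    · rintro i ⟨-, z, hz⟩
      exact ⟨z, ⟨i, hz⟩, hz⟩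
    · rintro i - j - z - ⟨-, -, hi0, a, b, hc, ha, hb, -⟩ ⟨-, -, hj0, a', b', hc', -⟩
      have hj : j ∈ cell P h z.1 := by rw [hc']; simp
      rw [hc] at hj
      rcases hj with rfl | rfl | rfl
      · omega
      · rfl
      · omega
  have l3 : {i ∈ S.innerPoints | ∃ σ, S.IsCrossingAt i σ}.ncard ≤ S.crossings.ncard := by
    refine ncard_le_ncard_of_rel S.IsCrossingAt ?_ ?_ (S.finite_parallelograms.subset
      S.crossings_subset)
    · rintro i ⟨-, σ, hσ⟩
      exact ⟨σ, ⟨i, hσ⟩, hσ⟩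
    · have key : ∀ i j σ, S.IsCrossingAt i σ → S.IsCrossingAt j σ → ¬ S.c i < S.c j := by
        rintro i j σ ⟨⟨hp, w, rfl⟩, -, -, hi, hi0, i', hi', hi'0, hlt⟩ ⟨-, -, -, hj, hj0, -⟩ hij
        have := S.abs_D (Or.inr hp) hi' hi hj (by rintro rfl; omega) (by rintro rfl; omega)
          (by rintro rfl; omega)
        simp [D, hi'0, hi0, hj0] at this
      intro i _ j _ σ _ hi hj
      refine S.inj _ _ ?_ (by rw [hi.2.2.2.2.1, hj.2.2.2.2.1])
      have := key i j σ hi hj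
      have := key j i σ hj hi
      omega
  have u1 := Set.ncard_le_ncard hsub (((hfin.subset (Set.sep_subset _ _)).union
    (hfin.subset (Set.sep_subset _ _))).union (hfin.subset (Set.sep_subset _ _)))
  have u2 := Set.ncard_union_le ({i ∈ S.innerPoints | ∃ e, S.IsVerticalAt i e} ∪
      {i ∈ S.innerPoints | ∃ z, S.IsSplitAt i z}) {i ∈ S.innerPoints | ∃ σ, S.IsCrossingAt i σ}
  have u3 := Set.ncard_union_le {i ∈ S.innerPoints | ∃ e, S.IsVerticalAt i e}
      {i ∈ S.innerPoints | ∃ z, S.IsSplitAt i z}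
  omega

/-- The parallelogram of a flat branch meets only two rows and carries only one flat branch, whereas
a crossing meets all three rows. -/
lemma ncard_flatPoints_add_crossings_le :
    S.flatPoints.ncard + S.crossings.ncard ≤ numParallelograms P h := by
  have hfin := S.finite_parallelograms
  set F := {σ : Set (ℤ × ℤ) | ∃ z ∈ S.flatPoints, cell P h z.1 = σ} with hF
  have hFsub : F ⊆ {σ : Set (ℤ × ℤ) | IsUnitParallelogram σ ∧ ∃ w, cell P h w = σ} := by
    rintro _ ⟨z, hz, rfl⟩
    exact ⟨hz.2.1, z.1, rfl⟩
  have h1 : S.flatPoints.ncard ≤ F.ncard :=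
    ncard_le_ncard_of_rel (fun z σ ↦ cell P h z.1 = σ) (fun z hz ↦ ⟨_, ⟨z, hz, rfl⟩, rfl⟩)
      (fun z hz z' hz' σ _ e e' ↦ hz.2.eq hz'.2 hz.1 hz'.1 (e.trans e'.symm)) (hfin.subset hFsub)
  refine (Nat.add_le_add_right h1 _).trans ?_
  rw [← Set.ncard_union_eq _ (hfin.subset hFsub) (hfin.subset S.crossings_subset)]
  · exact Set.ncard_le_ncard (Set.union_subset hFsub S.crossings_subset) hfin
  · rw [Set.disjoint_left]
    rintro _ ⟨z, hz, rfl⟩ ⟨i, -, ⟨a, ha, ha1⟩, ⟨b, hb, hb1⟩, hi, hi0, -⟩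
    obtain ⟨p, q, r, s, hc, -, hpq, hrs, -⟩ := hz.2.rows hz.1
    rw [hc] at ha hb hi
    simp only [Set.mem_insert_iff, Set.mem_singleton_iff] at ha hb hi
    have ra : S.ρ a = S.ρ p ∨ S.ρ a = S.ρ r := by rcases ha with rfl | rfl | rfl | rfl <;> omega
    have rb : S.ρ b = S.ρ p ∨ S.ρ b = S.ρ r := by rcases hb with rfl | rfl | rfl | rfl <;> omega
    have ri : S.ρ i = S.ρ p ∨ S.ρ i = S.ρ r := by rcases hi with rfl | rfl | rfl | rfl <;> omega
    omega

/-- The interior lattice points are inner points. -/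
lemma interiorLatticePoints_subset (hup : ∃ a ∈ latticePoints P, S.ρ a = 1) :
    interiorLatticePoints P ⊆ S.innerPoints := by
  intro i hi
  have hi0 := S.int_row i hi
  obtain ⟨T, ⟨hTA, hT1⟩, hTmin⟩ := Set.exists_min_image {a ∈ latticePoints P | S.ρ a = 1}
    (fun a ↦ S.c a) (S.fin.subset (Set.sep_subset _ _)) hup
  -- The functional vanishes on the line through `i` and the leftmost upper point `T`, so `a` is
  -- strictly to the left of this line. In the lower row, `(T, a)` is then a balanced pair to the
  -- left of `i`.
  obtain ⟨a, haA, ha⟩ := S.int_beyond i hi 1 (-(S.c T - S.c i)) (Or.inl one_ne_zero)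
  have ha' : (S.c a - S.c i) - (S.c T - S.c i) * (S.ρ a - S.ρ i) < 0 := by
    have : (((S.c a - S.c i) - (S.c T - S.c i) * (S.ρ a - S.ρ i) : ℤ) : ℝ) < 0 := by
      push_cast; linarith
    exact_mod_cast this
  have hr := S.row a haA
  refine ⟨interior_subset (s := P) hi, hi0, ?_⟩
  have : S.ρ a = 1 ∨ S.ρ a = 0 ∨ S.ρ a = -1 := by omega
  rcases this with h1 | h1 | h1 <;> rw [h1, hi0] at ha'
  · have : S.c T ≤ S.c a := hTmin a ⟨haA, h1⟩
    omega
  · exact ⟨(a, a), ⟨haA, haA, Or.inl ⟨h1, rfl⟩⟩, by simp only; omega⟩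
  · exact ⟨(T, a), ⟨hTA, haA, Or.inr ⟨hT1, h1⟩⟩, by simp only; omega⟩

/-! ### The right boundary of the polygon -/

/-- The segment from `p` down to `q` is on the right boundary. -/
def IsBoundaryPair (p q : ℤ × ℤ) : Prop :=
  p ∈ latticePoints P ∧ q ∈ latticePoints P ∧ S.ρ q < S.ρ p ∧ ∀ a ∈ latticePoints P, S.D p q a ≤ 0

/-- `p` and `q` are rightmost in their rows, so a boundary pair is determined by its two rows. -/
lemma IsBoundaryPair.le {S : Strip P h} {p q a : ℤ × ℤ} (hpq : S.IsBoundaryPair p q)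
    (ha : a ∈ latticePoints P) :
    (S.ρ a = S.ρ p → S.c a ≤ S.c p) ∧ (S.ρ a = S.ρ q → S.c a ≤ S.c q) := by
  obtain ⟨-, -, hρ, hD⟩ := hpq
  have h1 := hD a ha
  simp only [D] at h1
  constructor
  · intro h2
    rw [h2] at h1
    nlinarith
  · intro h2
    rw [h2] at h1
    nlinarith

lemma IsBoundaryPair.eq {S : Strip P h} {p q p' q' : ℤ × ℤ} (h1 : S.IsBoundaryPair p q)
    (h2 : S.IsBoundaryPair p' q') (hp : S.ρ p = S.ρ p') (hq : S.ρ q = S.ρ q') :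
    p = p' ∧ q = q' :=
  ⟨S.inj _ _ (le_antisymm ((h2.le h1.1).1 hp) ((h1.le h2.1).1 hp.symm)) hp,
    S.inj _ _ (le_antisymm ((h2.le h1.2.1).2 hq) ((h1.le h2.2.1).2 hq.symm)) hq⟩

lemma IsBoundaryPair.notMem_interior {S : Strip P h} {p q j : ℤ × ℤ} (h1 : S.IsBoundaryPair p q)
    (hj : j = p ∨ j = q) : j ∉ interiorLatticePoints P := by
  intro hi
  obtain ⟨-, -, hρ, hD⟩ := h1
  have hne : ((S.ρ q : ℝ) - S.ρ p) ≠ 0 := by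
    have : (S.ρ q : ℝ) < S.ρ p := by exact_mod_cast hρ
    linarith
  obtain ⟨a, ha, hlt⟩ := S.int_beyond j hi (S.ρ q - S.ρ p) (-(S.c q - S.c p)) (Or.inl hne)
  have h2 : (S.D p q a : ℝ) ≤ 0 := by exact_mod_cast hD a ha
  simp only [D] at h2
  push_cast at h2
  rcases hj with rfl | rfl <;> linarith

/-- A boundary pair with a point in the middle row shows that not all inner points are interior. -/
lemma IsBoundaryPair.ncard_lt {S : Strip P h} {p q j : ℤ × ℤ} (h1 : S.IsBoundaryPair p q)
    (hj : j = p ∨ j = q) (hj0 : S.ρ j = 0) (hup : ∃ a ∈ latticePoints P, S.ρ a = 1)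
    (hint : (interiorLatticePoints P).Nonempty) :
    (interiorLatticePoints P).ncard + 1 ≤ S.innerPoints.ncard := by
  have hnot := h1.notMem_interior hj
  have hsub := S.interiorLatticePoints_subset hup
  have hfin : S.innerPoints.Finite := S.fin.subset fun i hi ↦ hi.1
  obtain ⟨i, hi⟩ := hint
  have hiI := hsub hi
  have hjA : j ∈ latticePoints P := by
    rcases hj with rfl | rfl
    · exact h1.1
    · exact h1.2.1
  have hle : S.c i ≤ S.c j := by
    rcases hj with rfl | rfl
    · exact (h1.le hiI.1).1 (by rw [hiI.2.1, hj0])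
    · exact (h1.le hiI.1).2 (by rw [hiI.2.1, hj0])
  have hne : S.c i ≠ S.c j := by
    intro h0
    rw [S.inj i j h0 (by rw [hiI.2.1, hj0])] at hi
    exact hnot hi
  have hjI : j ∈ S.innerPoints :=
    ⟨hjA, hj0, (i, i), ⟨hiI.1, hiI.1, Or.inl ⟨hiI.2.1, rfl⟩⟩, by simp only; omega⟩
  rw [← Set.ncard_insert_of_notMem hnot (hfin.subset hsub)]
  exact Set.ncard_le_ncard (Set.insert_subset hjI hsub) hfin

/-- Either the right boundary consists of one edge between the outer rows, or it has at most two
edges, each with an end in the middle row. In the second case this end is inner and not interior,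
which pays for the second edge. -/
lemma ncard_rightBoundary_add_le (hup : ∃ a ∈ latticePoints P, S.ρ a = 1)
    (hint : (interiorLatticePoints P).Nonempty) :
    S.rightBoundary.ncard + genus P ≤ S.innerPoints.ncard + 1 := by
  have hsub := S.interiorLatticePoints_subset hup
  have hfin : S.innerPoints.Finite := S.fin.subset fun i hi ↦ hi.1
  have hg : genus P ≤ S.innerPoints.ncard := Set.ncard_le_ncard hsub hfin
  set r : Set (ℤ × ℤ) → ℤ × ℤ → Prop := fun e τ ↦
    ∃ p q, e = {p, q} ∧ S.IsBoundaryPair p q ∧ τ = (S.ρ p, S.ρ q) with hr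
  have hinj : ∀ e e' τ, r e τ → r e' τ → e = e' := by
    rintro e e' τ ⟨p, q, rfl, h1, rfl⟩ ⟨p', q', rfl, h2, h3⟩
    obtain ⟨rfl, rfl⟩ := h1.eq h2 (Prod.ext_iff.1 h3).1 (Prod.ext_iff.1 h3).2
    rfl
  have hpair : ∀ e ∈ S.rightBoundary, ∃ p q, e = {p, q} ∧ S.IsBoundaryPair p q ∧
      ((S.ρ p = 1 ∧ S.ρ q = 0) ∨ (S.ρ p = 0 ∧ S.ρ q = -1) ∨
        (S.ρ p = 1 ∧ S.ρ q = -1 ∧ Odd (S.c p + S.c q))) := by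
    rintro _ ⟨z, hz, he, p, q, rfl, hρ, hD⟩
    have hsub := subset_of_mem_snd hz he
    have hp := hsub (Set.mem_insert _ _)
    have hq := hsub (Set.mem_insert_of_mem _ rfl)
    refine ⟨p, q, rfl, ⟨hp.1, hq.1, hρ, hD⟩, ?_⟩
    have rp := S.row p hp.1
    have rq := S.row q hq.1
    by_cases h1 : S.ρ p = 1 ∧ S.ρ q = -1
    · right; right
      refine ⟨h1.1, h1.2, ?_⟩
      have hu := isUnitCell_of_mem hz
      -- A third vertex in an outer row would give an even determinant; for one in the middle row
      -- the determinant `±1` is congruent to `S.c p + S.c q` modulo two.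
      obtain ⟨s, hs, hsp, hsq⟩ := exists_third hu p q
      have d := eq_or_eq_neg_of_abs_eq (S.abs_D hu hp hq hs (by rintro rfl; omega) hsp.symm
        hsq.symm)
      have rs := S.row s hs.1
      have : S.ρ s = 1 ∨ S.ρ s = 0 ∨ S.ρ s = -1 := by omega
      rw [Int.odd_iff]
      rcases this with h3 | h3 | h3 <;> simp only [D, h1.1, h1.2, h3] at d <;> omega
    · omega
  -- A boundary edge with an end in the middle row would place this end at the midpoint of `p` and
  -- `q`, which by parity is not a lattice point.
  have hone : ∀ e p q, e ∈ S.rightBoundary → S.IsBoundaryPair p q → S.ρ p = 1 → S.ρ q = -1 →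
      Odd (S.c p + S.c q) → e = {p, q} := by
    intro e p q he h1 hp hq hodd
    obtain ⟨p', q', rfl, h2, h3⟩ := hpair e he
    rw [Int.odd_iff] at hodd
    rcases h3 with ⟨hp', hq'⟩ | ⟨hp', hq'⟩ | ⟨hp', hq', -⟩
    · obtain rfl : p = p' := S.inj _ _ (le_antisymm ((h2.le h1.1).1 (by omega))
        ((h1.le h2.1).1 (by omega))) (by omega)
      have d1 := h1.2.2.2 q' h2.2.1
      have d2 := h2.2.2.2 q h1.2.1
      simp only [D, hp, hq, hq'] at d1 d2
      omega
    · obtain rfl : q = q' := S.inj _ _ (le_antisymm ((h2.le h1.2.1).2 (by omega))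
        ((h1.le h2.2.1).2 (by omega))) (by omega)
      have d1 := h1.2.2.2 p' h2.1
      have d2 := h2.2.2.2 p h1.1
      simp only [D, hp, hq, hp'] at d1 d2
      omega
    · obtain ⟨rfl, rfl⟩ := h1.eq h2 (by omega) (by omega)
      rfl
  by_cases hlong : ∃ p q, S.IsBoundaryPair p q ∧ S.ρ p = 1 ∧ S.ρ q = -1 ∧ Odd (S.c p + S.c q)
  · obtain ⟨p, q, h1, hp, hq, hodd⟩ := hlong
    have : S.rightBoundary.ncard ≤ ({{p, q}} : Set (Set (ℤ × ℤ))).ncard :=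
      Set.ncard_le_ncard (fun e he ↦ hone e p q he h1 hp hq hodd) (Set.finite_singleton _)
    rw [Set.ncard_singleton] at this
    omega
  have hshort : ∀ e ∈ S.rightBoundary, ∃ p q, e = {p, q} ∧ S.IsBoundaryPair p q ∧
      ((S.ρ p = 1 ∧ S.ρ q = 0) ∨ (S.ρ p = 0 ∧ S.ρ q = -1)) := by
    intro e he
    obtain ⟨p, q, rfl, h1, h2 | h2 | h2⟩ := hpair e he
    · exact ⟨p, q, rfl, h1, Or.inl h2⟩
    · exact ⟨p, q, rfl, h1, Or.inr h2⟩
    · exact (hlong ⟨p, q, h1, h2⟩).elim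
  have h2 : S.rightBoundary.ncard ≤ ({(1, 0), (0, -1)} : Set (ℤ × ℤ)).ncard := by
    refine ncard_le_ncard_of_rel r ?_ (fun e _ e' _ τ _ ↦ hinj e e' τ) (by simp)
    intro e he
    obtain ⟨p, q, rfl, h1, h2⟩ := hshort e he
    refine ⟨(S.ρ p, S.ρ q), ?_, p, q, rfl, h1, rfl⟩
    rcases h2 with ⟨h2, h3⟩ | ⟨h2, h3⟩ <;> simp [h2, h3]
  rw [Set.ncard_pair (by decide)] at h2
  rcases S.rightBoundary.eq_empty_or_nonempty with h0 | ⟨e, he⟩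
  · rw [h0, Set.ncard_empty]; omega
  · obtain ⟨p, q, -, h1, h3⟩ := hshort e he
    have : (interiorLatticePoints P).ncard + 1 ≤ S.innerPoints.ncard := by
      rcases h3 with h3 | h3
      · exact h1.ncard_lt (Or.inr rfl) h3.2 hup hint
      · exact h1.ncard_lt (Or.inl rfl) h3.1 hup hint
    rw [genus]
    omega

lemma exists_rows (hint : (interiorLatticePoints P).Nonempty) :
    (∃ a ∈ latticePoints P, S.ρ a = 1) ∧ ∃ a ∈ latticePoints P, S.ρ a = -1 := by
  obtain ⟨i, hi⟩ := hint
  have hi0 := S.int_row i hi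
  constructor
  · obtain ⟨a, ha, hlt⟩ := S.int_beyond i hi 0 (-1) (by simp)
    refine ⟨a, ha, ?_⟩
    have hr := S.row a ha
    have : (0 : ℝ) < S.ρ a := by rw [hi0] at hlt; push_cast at hlt; linarith
    have : 0 < S.ρ a := by exact_mod_cast this
    omega
  · obtain ⟨a, ha, hlt⟩ := S.int_beyond i hi 0 1 (by simp)
    refine ⟨a, ha, ?_⟩
    have hr := S.row a ha
    have : (S.ρ a : ℝ) < 0 := by rw [hi0] at hlt; push_cast at hlt; linarith
    have : S.ρ a < 0 := by exact_mod_cast this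
    omega

/-- The bounded part of the curve has more edges than points. -/
lemma ncard_curvePoints_lt (S : Strip P h) (hn : IsNodal P h) (hg : 3 ≤ genus P)
    (hnum : numParallelograms P h ≤ genus P - 2) :
    (curvePoints P h).ncard + 1 ≤ E(boundedCurve P h).ncard := by
  have hint : (interiorLatticePoints P).Nonempty := by
    rw [Set.nonempty_iff_ne_empty]
    intro h0
    rw [genus, h0, Set.ncard_empty] at hg
    omega
  obtain ⟨hup, hdown⟩ := S.exists_rows hint
  have h1 : (curvePoints P h).ncard + S.splits.ncard ≤ S.rightEdges.ncard + S.flatPoints.ncard :=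
    S.ncard_curvePoints_add_le
  have h2 := S.ncard_slanted_add_vertical_le
  have hsl : S.slantedEdges ⊆ E(boundedCurve P h) := fun e ⟨x, y, hl, _⟩ ↦ hl.edge_mem
  have h3 := Set.ncard_le_ncard (S.rightEdges_subset hn) (((finite_edgeSet S).subset hsl).union
    S.finite_rightBoundary)
  have h4 := Set.ncard_union_le S.slantedEdges S.rightBoundary
  have h5 := S.ncard_innerPoints_le hn hup hdown
  have h6 := S.ncard_flatPoints_add_crossings_le
  have h7 := S.ncard_rightBoundary_add_le hup hint
  -- The inequalities combine to `|E| ≥ slanted + vertical ≥ |V| + inner - boundary - (flat +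
  -- crossings) ≥ |V| + (g - 1) - (g - 2)`; the number of splits cancels.
  omega

lemma tame (hn : IsNodal P h) (hg : 3 ≤ genus P) (hnum : numParallelograms P h ≤ genus P - 2) :
    Tame (boundedCurve P h) S.level where
  finV := finite_curvePoints S
  finE := finite_edgeSet S
  card := S.ncard_curvePoints_lt hn hg hnum
  deg z s _ := sum_incidence_le z s
  covering := ⟨S.cover, S.covering⟩

end Strip

end NodalCurve

theorem proposition4p1 (P : Set (ℝ × ℝ)) (g : ℕ) (hP : NodalCurve.IsLatticePolygon P)
    (hgenus : NodalCurve.genus P = g) (hg : 3 ≤ g) (hhyp : NodalCurve.IsHyperelliptic P)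
    (h : ℤ × ℤ → ℝ) (hnodal : NodalCurve.IsNodal P h)
    (hnum : NodalCurve.numParallelograms P h ≤ g - 2)
    (G : Graph ((ℝ × ℝ) × Set (Set (ℤ × ℤ))) (Set (ℤ × ℤ)))
    (hG : NodalCurve.IsSkeleton (NodalCurve.boundedCurve P h) G)
    (hconn : NodalCurve.Connected G) :
    NodalCurve.IsChain G := by
  subst hgenus
  obtain ⟨S⟩ := NodalCurve.exists_strip hP hg hhyp h
  exact (S.tame hnodal hg hnum).isChain_of_isSkeleton hG hconn
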